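/- **Theorem ($\mathbb{FS}_1$ Work).** Let a program use the batched parallel finger structure $\mathbb{FS}_1$ (a map with one fixed finger at each end, initially empty), and let $D$ be its program DAG. Then $\mathbb{FS}_1$ takes $O(F_L)$ total work for some linearization $L$ of the $\mathbb{FS}_1$-calls in $D$. That is: for every constant $\kappa$ there is a constant $C>0$, depending only on $\kappa$, such that for every program DAG $D$ and every execution in which each invocation of a building block of $\mathbb{FS}_1$ does at most $\kappa$ times its work bound stated below, there is a linearization $L$ of the $\mathbb{FS}_1$-calls in $D$ with total work at most $C\cdot F_L$. (All logarithms are binary.) *Calls, linearizations, finger bound.* A call searches, updates, inserts or deletes an item of a linearly ordered set; its result is the value found for the item, if any. A call blocks until its result is returned. A linearization $L$ lists every call of $D$ exactly once, in an order compatible with the paths of $D$, such that performing the calls sequentially in this order on an empty map gives every call the result that it received in the execution. The finger distance $r$ of an access to $x$ is the number of items from $x$ (always counted) to the nearest end of the map, and $F_L=\sum_i(\log r_i+1)$, where $r_i$ is the finger distance of the $i$-th operation when $L$ is performed. *The structure.* Put $c(k)=2^{2^{k+1}}$ and $t(k)=2c(k)$. The items are stored in order in segments $S_0[0],\dots,S_0[l],S_1[l],\dots,S_1[0]$;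 section $S[k]$ consists of $S_0[k]$ and $S_1[k]$; initially there is one section, with two empty segments. A segment $S_i[k]$ is overfull if its size is more than $t(k)+c(k)$, underfull if it is not the last of its chain $S_i$ and its size is less than $t(k)-c(k)$, and balanced otherwise. An item $x$ fits in $S_0[k]$ (in $S_1[k]$) if $k$ is minimal with $x\le\max S_0[k]$ (with $x\ge\min S_1[k]$), and in $S_0[l]$ if it fits in no segment by this rule. The calls are handled in nonempty input batches, one at a time, each fetched after the previous one is done. A batch $B$ of $b$ operations is handled as follows, where the first slab is $S[0..m-1]$ with $m=\lceil\log\log(2b)\rceil+1$ and the final slab is $S[m..l]$. 1. *Preliminary phase.* For each first-slab section in order, while operations remain: search for the remaining operations' items in both its segments by an unsorted batch search, and tag and remove the operations on items that fit in it. 2. *Separation phase.* Operations on items that fit in the first slab but are not found, other than insertions, return at once. The other operations on items that fit in the first slab (effectual), and those on the other items (residual), are sorted separately by access type (search, update, insertion, deletion), then item, by merge-sort along a height-balanced leaf-based binary tree, where operations of the same type on the same item are combined on merging into one group-operation whose effect is that of its last operation. 3. *Execution phase.* Execute the effectual batch on the first slab and then the residual batch on the final slab: for each section in order, until the batch is empty,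 for each of its two segments and each of the four access types in order, cut out the operations of that type that fit in the segment, perform them as a sorted batch access, and return their results. 4. *Rebalancing phase.* For each chain $S_i$, for each $k$ in increasing order: if $k>0$ and $S_i[k-1]$ is overfull, shift its excess over $t(k-1)$ to $S_i[k]$; if $k>0$, $S_i[k-1]$ is underfull, and $S_i[k]$ has at least $c(k)/2$ items or is the last segment, let $S_i[k']$ be the first underfull segment and fill $S_i[k'..k-1]$ using $S_i[k]$ (for $j$ from $k-1$ down to $k'$, shift items from $S_i[j+1]$ to $S_i[j]$ so that $S_i[k'..j]$ have total size $\sum_{a=k'}^{j}t(a)$ or as close as possible, and remove $S_i[j+1]$ if it is emptied and is the last segment); if $S_i[k]$ is overfull and the last segment, create an empty $S_i[k+1]$; if $S_i[k]$ is balanced and $S[k]$ was skipped by the execution phase, skip the rest of the current slab. Then, while one chain $S_i[0..k]$ is longer than the other chain $S_j[0..k']$: create empty segments $S_j[k'+1..k]$, move all items of $S_i[k]$ to $S_j[k]$, fill the underfull segments of $S_j[k'..k-1]$ using $S_j[k]$, and remove section $S[k]$ if $S_j[k]$ is now empty. *Work.* The work of $\mathbb{FS}_1$ is the sum of the work of all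 invocations of its building blocks. Each segment is a batch-parallel map. Writing $\lambda(n)=\lfloor\log n\rfloor+1$ for $n\ge1$ and $\lambda(0)=1$, the work bounds are: $b\lambda(n)+1$ for an unsorted batch search, or a sorted batch access, of $b$ operations in a map that has size $n$ beforehand; $\lambda(n)$ for splitting a map of size $n$ at a rank, for joining two maps of total size $n$, for reading an end of a map of size $n$, and for splitting a sorted batch of size $n$ at a pivot; $n+1$ for merging two sorted batches of total size $n$, for filtering, partitioning or returning the results of $n$ operations, and for $n$ elementary steps. -/

import Mathlib

namespace FingerStructure

universe u v w

/-! ## Maps, finger distance, finger bound -/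

/-- The accesses that a map (dictionary) with keys `K` and values `V` supports. -/
inductive MapOp (K : Type u) (V : Type v) : Type (max u v)
  | search (x : K)
  | update (x : K) (val : V)
  | insert (x : K) (val : V)
  | delete (x : K)

namespace MapOp

variable {K : Type u} {V : Type v}

/-- The item that is accessed. -/
def item : MapOp K V → K
  | search x => x
  | update x _ => x
  | insert x _ => x
  | delete x => x

/-- The access type, numbered in the order search, update, insertion, deletion. -/
def accessType : MapOp K V → ℕ
  | search _ => 0
  | update _ _ => 1
  | insert _ _ => 2
  | delete _ => 3

/-- What an access does to the entry (`none` = absent) of its item. Updates only change the value of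
an item that is present; insertions add the item, or overwrite its value if it is present. -/
def effect : MapOp K V → Option V → Option V
  | search _, e => e
  | update _ val, e => e.map (fun _ => val)
  | insert _ val, _ => some val
  | delete _, _ => none

/-- Perform an access on (the contents of) a map. -/
def perform [DecidableEq K] (o : MapOp K V) (M : K → Option V) : K → Option V :=
  Function.update M o.item (o.effect (M o.item))

end MapOp

/-- The finger distance of accessing `x` in a map `M` with one fixed finger at each end: the number
of items from `x` to the nearest finger, where `x` itself is always counted (in `M` or not). -/
noncomputable def fingerDist {K : Type u} {V : Type v} [LinearOrder K] (M : K → Option V) (x : K) :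
    ℕ :=
  min (Set.ncard {y | y < x ∧ M y ≠ none}) (Set.ncard {y | x < y ∧ M y ≠ none}) + 1

/-- The finger bound of a sequence of accesses, performed in order starting with the map `M`: the
sum of `log₂ r + 1`, where `r` is the finger distance at the time of the access. -/
noncomputable def fingerBound {K : Type u} {V : Type v} [LinearOrder K] :
    (K → Option V) → List (MapOp K V) → ℝ
  | _, [] => 0
  | M, o :: L => (Real.logb 2 (fingerDist M o.item) + 1) + fingerBound (o.perform M) L

/-- A call: the node of the program that makes it, and the access that it requests. -/
abbrev Call (N : Type w) (K : Type u) (V : Type v) := N × MapOp K V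

/-- The results of a sequence of calls performed one after the other, starting with the map `M`.
The result of an access is the entry that it finds for its item (`none` if the item is absent). -/
def seqResults {N : Type w} {K : Type u} {V : Type v} [DecidableEq K] :
    (K → Option V) → List (Call N K V) → List (N × Option V)
  | _, [] => []
  | M, c :: L => (c.1, M c.2.item) :: seqResults (c.2.perform M) L

/-! ## Program DAGs and linearizations -/

/-- A program DAG: `edge` are the dependencies, and `call` says which nodes are calls to the finger
structure (and of which access); all other nodes are ordinary instructions. -/
structure ProgramDAG (N : Type w) (K : Type u) (V : Type v) where
  edge : N → N → Prop
  acyclic : ∀ a, ¬ Relation.TransGen edge a a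
  call : N → Option (MapOp K V)

namespace ProgramDAG

variable {N : Type w} {K : Type u} {V : Type v}

/-- There is a nonempty path from `a` to `b`. -/
def Precedes (D : ProgramDAG N K V) (a b : N) : Prop := Relation.TransGen D.edge a b

/-- The calls made by the nodes of a list, in order. -/
def calls (D : ProgramDAG N K V) (L : List N) : List (Call N K V) :=
  L.filterMap (fun a => (D.call a).map (fun o => (a, o)))

/-- The accesses requested by the nodes of a list, in order. -/
def accesses (D : ProgramDAG N K V) (L : List N) : List (MapOp K V) := (D.calls L).map Prod.snd

/-- `L` is a linearization of the calls in `D`: it lists each of them once, in an order compatible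
with the dependencies, and performing them one after the other in this order, starting with an empty
map, gives each call the result that it received (according to `results`). -/
structure IsLinearization [DecidableEq K] (D : ProgramDAG N K V) (results : List (N × Option V))
    (L : List N) : Prop where
  nodup : L.Nodup
  mem_iff : ∀ a, a ∈ L ↔ (D.call a).isSome
  ordered : L.Pairwise (fun a b => ¬ D.Precedes b a)
  consistent : (seqResults (fun _ => none) (D.calls L)).Perm results

end ProgramDAG

/-! ## Building blocks and their work -/

/-- One invocation of a building block. -/
inductive Prim
  /-- Elementary work linear in `n`: `n` elementary steps, or filtering, partitioning, or returning
  the results of, a batch of `n` operations. -/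
  | linear (n : ℕ)
  /-- Splitting a sorted batch of `n` elements around a given pivot. -/
  | batchSplit (n : ℕ)
  /-- Merging two sorted batches of `n` elements in total, combining duplicates. -/
  | batchMerge (n : ℕ)
  /-- Unsorted batch search for `b` items in a batch-parallel map of size `n`. -/
  | unsortedSearch (b n : ℕ)
  /-- Sorted batch access of `b` operations on distinct items in a batch-parallel map that has size
  `n` before the access. -/
  | sortedAccess (b n : ℕ)
  /-- Reading the least or greatest item of a batch-parallel map of size `n`. -/
  | readEnd (n : ℕ)
  /-- Splitting a batch-parallel map of size `n` around a given rank. -/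
  | mapSplit (n : ℕ)
  /-- Joining two batch-parallel maps of total size `n`. -/
  | mapJoin (n : ℕ)

/-- The work bound of a building block, up to a constant factor. -/
def Prim.bound : Prim → ℕ
  | linear n => n + 1
  | batchSplit n => Nat.log 2 n + 1
  | batchMerge n => n + 1
  | unsortedSearch b n => b * (Nat.log 2 n + 1) + 1
  | sortedAccess b n => b * (Nat.log 2 n + 1) + 1
  | readEnd n => Nat.log 2 n + 1
  | mapSplit n => Nat.log 2 n + 1
  | mapJoin n => Nat.log 2 n + 1

/-- The outcome of a computation, with the list of all building block invocations that it made. -/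
structure Costed (α : Type u) where
  val : α
  log : List Prim

namespace Costed

variable {α : Type u} {β : Type v}

def pure (a : α) : Costed α := ⟨a, []⟩

/-- Run `x`, and continue with its value. -/
def bind (x : Costed α) (f : α → Costed β) : Costed β := ⟨(f x.val).val, x.log ++ (f x.val).log⟩

/-- Invoke the building block `q`, then run `x`. -/
def tick (q : Prim) (x : Costed α) : Costed α := ⟨x.val, q :: x.log⟩

end Costed

open Costed (tick)

/-! ## The data structure -/

/-- The two ends of the structure. -/
inductive Side
  | front
  | back

/-- The order in which one meets the items when walking inward from an end. -/
def Side.le {K : Type u} [LinearOrder K] : Side → K → K → Prop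
  | front, x, y => x ≤ y
  | back, x, y => y ≤ x

instance Side.decidableLe {K : Type u} [LinearOrder K] : (i : Side) → DecidableRel (i.le (K := K))
  | front => fun x y => inferInstanceAs (Decidable (x ≤ y))
  | back => fun x y => inferInstanceAs (Decidable (y ≤ x))

/-- The contents of a segment, listed from its own end inward: increasing for the front chain,
decreasing for the back chain. -/
abbrev Segment (K : Type u) (V : Type v) := List (K × V)

/-- A chain `S_i[0], S_i[1], …` of segments, from the end inward. -/
abbrev Chain (K : Type u) (V : Type v) := List (Segment K V)

/-- The state between batches: the chains `S_0` (front) and `S_1` (back). -/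
structure FS1 (K : Type u) (V : Type v) where
  front : Chain K V
  back : Chain K V

section Segments

variable {K : Type u} {V : Type v} [LinearOrder K]

/-- The entry of `x` in a segment. -/
def Segment.entry (s : Segment K V) (x : K) : Option V :=
  (s.find? (fun e => decide (e.1 = x))).map Prod.snd

/-- Set the entry of `x` in a segment of chain `i`. -/
def Segment.setEntry (i : Side) (s : Segment K V) (x : K) : Option V → Segment K V
  | none => s.filter (fun e => decide (e.1 ≠ x))
  | some val => (s.filter (fun e => decide (e.1 ≠ x))).orderedInsert
      (fun e e' => i.le e.1 e'.1) (x, val)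

/-- `x ≤ max S_0[k]` for the front chain, `x ≥ min S_1[k]` for the back chain (false if the segment is
empty). -/
def Segment.reaches (i : Side) (s : Segment K V) (x : K) : Bool :=
  s.any (fun e => decide (i.le x e.1))

end Segments

namespace FS1

variable {K : Type u} {V : Type v}

/-- The empty structure: one section, consisting of two empty segments. -/
def empty : FS1 K V := ⟨[[]], [[]]⟩

def chain (S : FS1 K V) : Side → Chain K V
  | .front => S.front
  | .back => S.back

/-- The segment `S_i[k]`. -/
def seg (S : FS1 K V) (i : Side) (k : ℕ) : Segment K V := (S.chain i).getD k []

def setChain (S : FS1 K V) : Side → Chain K V → FS1 K V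
  | .front, ch => { S with front := ch }
  | .back, ch => { S with back := ch }

/-- The number of sections (between batches the chains have equal length). -/
def sections (S : FS1 K V) : ℕ := S.front.length

/-- Whether `x` fits in `S_i[k]`, provided that it does not fit in the sections before `S[k]`. An item
between the two last segments fits in the last segment of the front chain. -/
def fitsSeg [LinearOrder K] (S : FS1 K V) (k : ℕ) (x : K) : Side → Bool
  | .front => (S.seg .front k).reaches .front x ||
      (decide (k + 1 = S.sections) && !(S.seg .back k).reaches .back x)
  | .back => (S.seg .back k).reaches .back x

/-- Whether `x` fits in the section `S[k]`, provided that it does not fit in the sections before. -/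
def fitsSection [LinearOrder K] (S : FS1 K V) (k : ℕ) (x : K) : Bool :=
  S.fitsSeg k x .front || S.fitsSeg k x .back

end FS1

/-! ## Preliminary phase -/

/-- The number of sections of the first slab for a batch of size `b`, that is
`⌈log₂ log₂ (2 b)⌉ + 1`. -/
def slabSize (b : ℕ) : ℕ := Nat.clog 2 (Nat.clog 2 (2 * b)) + 1

/-- The tag of an operation: `pending` as long as its item was not seen to fit in a section of the
first slab; then whether the item was found. -/
inductive Tag
  | pending
  | found
  | absent
  deriving DecidableEq

section Batch

variable {N : Type w} {K : Type u} {V : Type v} [LinearOrder K]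

/-- The operations that are still pending. -/
def pendingOps (B : List (Call N K V × Tag)) : List (Call N K V × Tag) :=
  B.filter (fun c => decide (c.2 = Tag.pending))

/-- Tag the pending operations on items that fit in the section `S[k]`. -/
def tagSection (S : FS1 K V) (k : ℕ) (B : List (Call N K V × Tag)) : List (Call N K V × Tag) :=
  B.map (fun c =>
    if c.2 = Tag.pending ∧ S.fitsSection k c.1.2.item = true then
      (c.1, if ((S.seg .front k).entry c.1.2.item).isSome ∨ ((S.seg .back k).entry c.1.2.item).isSome
        then Tag.found else Tag.absent)
    else c)

/-- The preliminary phase on (at most) `n` sections from `S[k]` on; `B` is the whole batch. -/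
def preliminary (S : FS1 K V) : ℕ → ℕ → List (Call N K V × Tag) → Costed (List (Call N K V × Tag))
  | 0, _, B => .pure B
  | n + 1, k, B =>
    if (pendingOps B).length = 0 ∨ S.sections ≤ k then .pure B else
    tick (.unsortedSearch (pendingOps B).length (S.seg .front k).length) <|
    tick (.unsortedSearch (pendingOps B).length (S.seg .back k).length) <|
    tick (.linear (pendingOps B).length) <|
    preliminary S n (k + 1) (tagSection S k B)

/-! ## Separation phase -/

/-- The preliminary phase of a batch, started with all operations pending. -/
def tagBatch (S : FS1 K V) (B : List (Call N K V)) : Costed (List (Call N K V × Tag)) :=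
  preliminary S (slabSize B.length) 0 (B.map (fun c => (c, Tag.pending)))

/-- Ineffectual operations: the item fits in the first slab, is not found, and is not to be inserted
by the operation. -/
def ineffectual (T : List (Call N K V × Tag)) : List (Call N K V) :=
  (T.filter (fun c => decide (c.2 = Tag.absent ∧ c.1.2.accessType ≠ 2))).map Prod.fst

/-- Effectual operations: the item is found in, or is to be inserted into, the first slab. -/
def effectual (T : List (Call N K V × Tag)) : List (Call N K V) :=
  (T.filter (fun c => decide (c.2 = Tag.found ∨ (c.2 = Tag.absent ∧ c.1.2.accessType = 2)))).map
    Prod.fst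

/-- Residual operations: the item does not fit in the first slab. -/
def residual (T : List (Call N K V × Tag)) : List (Call N K V) :=
  (T.filter (fun c => decide (c.2 = Tag.pending))).map Prod.fst

/-- A group-operation: all operations (listed in their order in the batch) of the same access type on
the same item. -/
structure Group (N : Type w) (K : Type u) (V : Type v) where
  accessType : ℕ
  item : K
  ops : List (Call N K V)

/-- The order by access type, then item. -/
def Group.before (g h : Group N K V) : Prop :=
  g.accessType < h.accessType ∨ (g.accessType = h.accessType ∧ g.item < h.item)

instance (g h : Group N K V) : Decidable (g.before h) :=
  inferInstanceAs (Decidable (_ ∨ (_ ∧ _)))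

/-- Merge sorted batches of group-operations, combining those of the same type on the same item. -/
def mergeGroups : List (Group N K V) → List (Group N K V) → List (Group N K V)
  | [], B => B
  | A, [] => A
  | g :: A, h :: B =>
    if g.before h then g :: mergeGroups A (h :: B)
    else if h.before g then h :: mergeGroups (g :: A) B
    else ⟨g.accessType, g.item, g.ops ++ h.ops⟩ :: mergeGroups A B
termination_by A B => A.length + B.length

/-- Leaf-based binary trees. -/
inductive BTree (α : Type w) : Type w
  | leaf (a : α)
  | node (l r : BTree α)

namespace BTree

variable {α : Type w}

def leaves : BTree α → List α
  | leaf a => [a]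
  | node l r => l.leaves ++ r.leaves

def height : BTree α → ℕ
  | leaf _ => 0
  | node l r => max l.height r.height + 1

/-- Height-balanced: sibling subtrees differ in height by at most one. -/
def Balanced : BTree α → Prop
  | leaf _ => True
  | node l r => l.height ≤ r.height + 1 ∧ r.height ≤ l.height + 1 ∧ l.Balanced ∧ r.Balanced

end BTree

/-- `T` is a representation of the list `l` as a batch, that is as a leaf-based height-balanced binary
tree (`none` is the empty batch). -/
def Represents {α : Type w} : Option (BTree α) → List α → Prop
  | none, l => l = []
  | some T, l => T.leaves = l ∧ T.Balanced

/-- Parallel entropy-sort: merge-sort along the given tree, combining equal operations. -/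
def entropySort : BTree (Call N K V) → Costed (List (Group N K V))
  | .leaf c => tick (.linear 1) (.pure [⟨c.2.accessType, c.2.item, [c]⟩])
  | .node l r =>
    (entropySort l).bind fun A => (entropySort r).bind fun B =>
    tick (.batchMerge (A.length + B.length)) (.pure (mergeGroups A B))

/-- Sort a possibly empty batch. -/
def sortBatch : Option (BTree (Call N K V)) → Costed (List (Group N K V))
  | none => .pure []
  | some T => entropySort T

/-! ## Execution phase -/

/-- The results of the members of a group-operation, given the entry found for the item. -/
def memberResults : Option V → List (Call N K V) → List (N × Option V)
  | _, [] => []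
  | e, c :: cs => (c.1, e) :: memberResults (c.2.effect e) cs

/-- The effect of a group-operation is that of its last operation. -/
def Group.effect (g : Group N K V) (e : Option V) : Option V :=
  match g.ops.getLast? with
  | none => e
  | some c => c.2.effect e

/-- Perform a sorted batch of group-operations on a segment of chain `i`. -/
def performGroups (i : Side) : Segment K V → List (Group N K V) → Segment K V × List (N × Option V)
  | s, [] => (s, [])
  | s, g :: gs =>
    let rest := performGroups i (s.setEntry i g.item (g.effect (s.entry g.item))) gs
    (rest.1, memberResults (s.entry g.item) g.ops ++ rest.2)

/-- The state of the execution phase: the structure, the remaining batch (sorted by type, then item),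
and the results returned so far. -/
structure ExecState (N : Type w) (K : Type u) (V : Type v) where
  str : FS1 K V
  batch : List (Group N K V)
  results : List (N × Option V)

/-- Cut out the group-operations of access type `a` that fit in `S_i[k]`, perform them on `S_i[k]`,
and return their results. -/
def execType (k : ℕ) (i : Side) (a : ℕ) (E : ExecState N K V) : Costed (ExecState N K V) :=
  let s := E.str.seg i k
  let G := E.batch.filter (fun g => decide (g.accessType = a))
  let cut := G.filter (fun g => E.str.fitsSeg k g.item i)
  let rest := E.batch.filter
    (fun g => decide (¬ (g.accessType = a ∧ E.str.fitsSeg k g.item i = true)))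
  let out := performGroups i s cut
  tick (.readEnd (E.str.seg .front k).length) <|
  tick (.readEnd (E.str.seg .back k).length) <|
  tick (.batchSplit G.length) <|
  tick (.sortedAccess cut.length s.length) <|
  tick (.linear (cut.map (fun g => g.ops.length)).sum) <|
  .pure ⟨E.str.setChain i ((E.str.chain i).set k out.1), rest, E.results ++ out.2⟩

/-- Execute the batch on the segment `S_i[k]`, one access type after the other. -/
def execSegment (k : ℕ) (i : Side) (E : ExecState N K V) : Costed (ExecState N K V) :=
  (execType k i 0 E).bind fun E => (execType k i 1 E).bind fun E =>
  (execType k i 2 E).bind fun E => execType k i 3 E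

/-- Execute the batch on the (at most) `n` sections of a slab from `S[k]` on. The second component is
the index of the first section that is skipped. -/
def execSlab : ℕ → ℕ → ExecState N K V → Costed (ExecState N K V × ℕ)
  | 0, k, E => .pure (E, k)
  | n + 1, k, E =>
    if E.batch.length = 0 then .pure (E, k) else
    tick (.batchSplit E.batch.length) <|
    (execSegment k .front E).bind fun E => (execSegment k .back E).bind fun E =>
    execSlab n (k + 1) E

end Batch

/-! ## Rebalancing phase -/

/-- `c(k)`. -/
def cap (k : ℕ) : ℕ := 2 ^ 2 ^ (k + 1)

/-- The target size `t(k)`. -/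
def target (k : ℕ) : ℕ := 2 * cap k

namespace Chain

variable {K : Type u} {V : Type v}

/-- The size of the segment with index `k`. -/
def size (ch : Chain K V) (k : ℕ) : ℕ := (ch.getD k []).length

def IsLast (ch : Chain K V) (k : ℕ) : Prop := k + 1 = ch.length

instance (ch : Chain K V) (k : ℕ) : Decidable (ch.IsLast k) :=
  inferInstanceAs (Decidable (_ = _))

/-- More than `c(k)` items above target capacity. -/
def Overfull (ch : Chain K V) (k : ℕ) : Prop := target k + cap k < ch.size k

instance (ch : Chain K V) (k : ℕ) : Decidable (ch.Overfull k) :=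
  inferInstanceAs (Decidable (_ < _))

/-- More than `c(k)` items below target capacity, which is `[t(k), t(k)]`, except that it is
`[0, t(k)]` for the last segment. -/
def Underfull (ch : Chain K V) (k : ℕ) : Prop := ¬ ch.IsLast k ∧ ch.size k + cap k < target k

instance (ch : Chain K V) (k : ℕ) : Decidable (ch.Underfull k) :=
  inferInstanceAs (Decidable (_ ∧ _))

/-- Shift the `q` innermost items of segment `k` to segment `k + 1`. -/
def shiftIn (ch : Chain K V) (k q : ℕ) : Costed (Chain K V) :=
  let s := ch.getD k []
  let s' := ch.getD (k + 1) []
  tick (.mapSplit s.length) <| tick (.mapJoin (q + s'.length)) <|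
  .pure ((ch.set k (s.take (s.length - q))).set (k + 1) (s.drop (s.length - q) ++ s'))

/-- Shift the `q` outermost items of segment `k + 1` to segment `k`. -/
def shiftOut (ch : Chain K V) (k q : ℕ) : Costed (Chain K V) :=
  let s := ch.getD k []
  let s' := ch.getD (k + 1) []
  tick (.mapSplit s'.length) <| tick (.mapJoin (s.length + q)) <|
  .pure ((ch.set k (s ++ s'.take q)).set (k + 1) (s'.drop q))

/-- Fill the segments `k₀, …, k₀ + d` using segment `k₀ + d + 1`: for `j` from `k₀ + d` down to `k₀`,
shift items from segment `j + 1` to segment `j` so that the segments `k₀, …, j` have the sum of their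
target sizes as total size, or as close as possible, and remove segment `j + 1` (the last one) if it
is emptied. -/
def fill (k₀ : ℕ) : ℕ → Chain K V → Costed (Chain K V)
  | d, ch =>
    let j := k₀ + d
    let need := (∑ a ∈ Finset.range (d + 1), target (k₀ + a)) -
      ∑ a ∈ Finset.range (d + 1), ch.size (k₀ + a)
    (ch.shiftOut j (min need (ch.size (j + 1)))).bind fun ch =>
    let ch := if ch.size (j + 1) = 0 ∧ ch.IsLast (j + 1) then ch.take (j + 1) else ch
    match d with
    | 0 => .pure ch
    | d + 1 => fill k₀ d ch

/-- Fill all segments from the first underfull one up to segment `k - 1`, using segment `k`. -/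
def fillUsing (k : ℕ) (ch : Chain K V) : Costed (Chain K V) :=
  match (List.range k).find? (fun a => decide (ch.Underfull a)) with
  | none => .pure ch
  | some k₀ => tick (.linear (k - k₀)) (fill k₀ (k - 1 - k₀) ch)

/-- First part of an iteration of segment rebalancing: if segment `k - 1` is overfull, shift its
excess over the target size to segment `k`. -/
def overflowStep (k : ℕ) (ch : Chain K V) : Costed (Chain K V) :=
  if 0 < k ∧ ch.Overfull (k - 1) then ch.shiftIn (k - 1) (ch.size (k - 1) - target (k - 1))
  else .pure ch

/-- Second part: if segment `k - 1` is underfull, and segment `k` has at least `c(k) / 2` items or is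
the last one, fill the underfull segments using segment `k`. -/
def fillStep (k : ℕ) (ch : Chain K V) : Costed (Chain K V) :=
  if 0 < k ∧ ch.Underfull (k - 1) ∧ (cap k ≤ 2 * ch.size k ∨ ch.IsLast k) then ch.fillUsing k
  else .pure ch

/-- Third part: if segment `k` is overfull and the last one, create a new segment. -/
def growStep (k : ℕ) (ch : Chain K V) : Chain K V :=
  if ch.Overfull k ∧ ch.IsLast k then ch ++ [[]] else ch

/-- Segment rebalancing of a chain from segment `k` on, with `m` the size of the first slab and
`skipped` the sections skipped by the execution phase. The first argument bounds the number of
iterations. -/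
def rebalanceSegments (m : ℕ) (skipped : ℕ → Bool) : ℕ → ℕ → Chain K V → Costed (Chain K V)
  | 0, _, ch => .pure ch
  | f + 1, k, ch =>
    if ch.length ≤ k then .pure ch else
    tick (.linear 1) <|
    (ch.overflowStep k).bind fun ch => (ch.fillStep k).bind fun ch =>
    let ch := ch.growStep k
    if ch.length ≤ k then .pure ch
    else if ¬ ch.Overfull k ∧ ¬ ch.Underfull k ∧ skipped k = true then
      (if k < m then rebalanceSegments m skipped f m ch else .pure ch)
    else rebalanceSegments m skipped f (k + 1) ch

/-- Segment rebalancing of a whole chain. Iterations have increasing `k`, and each newly created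
segment follows one in which at least one item is left for good, so the bound on their number is never
attained. -/
def rebalance (m : ℕ) (skipped : ℕ → Bool) (ch : Chain K V) : Costed (Chain K V) :=
  rebalanceSegments m skipped (ch.length + ch.flatten.length + 1) 0 ch

/-- One iteration of chain rebalancing, for a chain `long` that is longer than the chain `short`. Both
chains list items from their own end inward, so a transferred segment is reversed. -/
def transfer (long short : Chain K V) : Costed (Chain K V × Chain K V) :=
  let k := long.length - 1
  tick (.linear (long.length - short.length)) <|
  (fillUsing k ((short ++ List.replicate (long.length - short.length) []).set k
    (long.getD k []).reverse)).bind fun short =>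
  if short.size k = 0 then .pure (long.take k, short.take k)
  else .pure (long.set k [], short)

end Chain

namespace FS1

variable {N : Type w} {K : Type u} {V : Type v}

/-- Chain rebalancing: transfer until the chains have equal length. The first argument bounds the
number of iterations. -/
def rebalanceChains : ℕ → FS1 K V → Costed (FS1 K V)
  | 0, S => .pure S
  | f + 1, S =>
    tick (.linear 1) <|
    if S.back.length < S.front.length then
      (Chain.transfer S.front S.back).bind fun p => rebalanceChains f ⟨p.1, p.2⟩
    else if S.front.length < S.back.length then
      (Chain.transfer S.back S.front).bind fun p => rebalanceChains f ⟨p.2, p.1⟩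
    else .pure S

/-- The rebalancing phase. Every iteration of chain rebalancing makes the lengths of the chains equal
or shortens the longer chain, so the bound on their number has no effect. -/
def rebalance (m : ℕ) (skipped : ℕ → Bool) (S : FS1 K V) : Costed (FS1 K V) :=
  (S.front.rebalance m skipped).bind fun front =>
  (S.back.rebalance m skipped).bind fun back =>
  rebalanceChains (max front.length back.length + 1) ⟨front, back⟩

/-! ## Whole batches and whole executions -/

variable [LinearOrder K]

/-- All four phases on the batch `B`, given tree representations of the effectual and the residual
operations. The value is the new state and the results returned. -/
def runBatch (S : FS1 K V) (B : List (Call N K V)) (Teff Tres : Option (BTree (Call N K V))) :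
    Costed (FS1 K V × List (N × Option V)) :=
  let m := slabSize B.length
  tick (.linear B.length) <|
  (tagBatch S B).bind fun T =>
  tick (.linear B.length) <|
  (sortBatch Teff).bind fun eff =>
  (sortBatch Tres).bind fun res =>
  (execSlab (min m S.sections) 0
    ⟨S, eff, (ineffectual T).map (fun c => (c.1, none))⟩).bind fun E₁ =>
  (execSlab (S.sections - m) m ⟨E₁.1.str, res, E₁.1.results⟩).bind fun E₂ =>
  (E₂.1.str.rebalance m
    (fun k => decide (¬ (k < E₁.2 ∨ (m ≤ k ∧ k < E₂.2))))).bind fun S' =>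
  .pure (S', E₂.1.results)

/-- `Runs S Bs results log`: starting in state `S` and handling the (nonempty) input batches `Bs` one
after the other, the structure may return the results `results` and make the building block
invocations `log`. -/
inductive Runs : FS1 K V → List (List (Call N K V)) → List (N × Option V) → List Prim → Prop
  | nil (S : FS1 K V) : Runs S [] [] []
  | cons {S : FS1 K V} {B : List (Call N K V)} {Bs : List (List (Call N K V))}
      {Teff Tres : Option (BTree (Call N K V))}
      {results : List (N × Option V)} {log : List Prim}
      (nonempty : B ≠ [])
      (repr_eff : Represents Teff (effectual (tagBatch S B).val))
      (repr_res : Represents Tres (residual (tagBatch S B).val))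
      (rest : Runs (runBatch S B Teff Tres).val.1 Bs results log) :
      Runs S (B :: Bs) ((runBatch S B Teff Tres).val.2 ++ results)
        ((runBatch S B Teff Tres).log ++ log)

end FS1

/-- An execution of a program with program DAG `D` that uses the finger structure, initially empty.
Each call is in exactly one input batch. As a call blocks until its result is returned and the next
batch is fetched only when the previous batch is done, a call that depends on another call is in a
later batch. -/
structure Execution {N : Type w} {K : Type u} {V : Type v} [LinearOrder K]
    (D : ProgramDAG N K V) where
  /-- The input batches, in order. -/
  batches : List (List N)
  nodup : batches.flatten.Nodup
  mem_iff : ∀ a, a ∈ batches.flatten ↔ (D.call a).isSome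
  ordered : ∀ (i j : ℕ) (hi : i < batches.length) (hj : j < batches.length) (a b : N),
    a ∈ batches[i] → b ∈ batches[j] → D.Precedes a b → i < j
  /-- The results returned to the calls. -/
  results : List (N × Option V)
  /-- All building block invocations made. -/
  log : List Prim
  runs : FS1.Runs FS1.empty (batches.map D.calls) results log
  /-- The work done by each of them. -/
  work : List ℝ

namespace Execution

variable {N : Type w} {K : Type u} {V : Type v} [LinearOrder K] {D : ProgramDAG N K V}

/-- Each building block invocation did work within its bound, with constant factor `κ`. -/
def WithinBounds (E : Execution D) (κ : ℝ) : Prop :=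
  List.Forall₂ (fun (q : Prim) (t : ℝ) => t ≤ κ * (q.bound : ℝ)) E.log E.work

/-- The total work done by the finger structure. -/
def totalWork (E : Execution D) : ℝ := E.work.sum

end Execution

end FingerStructure

namespace FingerStructure

universe u v w

section

/-! ## Total bounds of logs -/

/-! For each batch, the work plus the increase of a potential is bounded by a constant times the
finger bound of a suitable order of its calls. The bounds telescope. The initial potential, 1200, is
also a lower bound of every later one, so no additive constant remains.

Depth against distance. Between batches no segment is overfull or underfull. Hence an item that fits
in section k + 1 has at least c(k) items on either side, and since log c(k) = 2^(k+1), an item that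
fits in section j has finger distance r with 2^j ≤ log r + 1 (`FS1.Inv.two_pow_fitIdx_le`). Handling
an operation in section j costs O(2^j). These costs form a geometric series up to the section where
the item fits, so carrying the operation there is paid for by log r + 1 (`credit`, `execSlab_spec`).

Rebalancing. An item of excess or deficit in segment k has potential proportional to `wt k` = 2^k /
c(k), so an imbalance of c(k) items is worth about 2^k, the order of the cost of a split or join
there, and an insertion or deletion in section k changes the potential by O(2^k). The weights at
least halve from one segment to the next. Hence an imbalance that is pushed one segment inward loses
half of its potential, and the other half pays for the work. A flat term for a nonempty last segment
and a term `600 * 2 ^ length` pay for changes of the number of sections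
(`Chain.rebalanceSegments_spec`, `Chain.transfer_spec`, `FS1.rebalance_spec`).

Linearization. In each batch the ineffectual calls come first, then searches and updates, then
insertions by increasing and finally deletions by decreasing finger distance, measured in the set A₁
of old and newly inserted items. Calls on different items commute, and the structure itself treats
the executed calls on one item by type, so the results agree. The finger distance of an item is
determined by the items of smaller finger distance (`fd_le_of_outermost`). These are present
whenever it is inserted or deleted in this order, so every such call has at least its finger
distance in A₁ (`exists_batch_order`).

Sorting. In merge-sort, let a key of weight ρ be charged once per leaf at heights below 4 (log ρ +
1), and once per tree node above that. A height-balanced tree with b leaves has O(b / ρ²) nodes that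
high. With finger distances as weights, at most two items share a weight, so the sum of 1 / ρ² is
bounded and the cost is O(∑ (log ρ + 1) + b) (`cost_sortBatch_of_weights`). Residual operations lie
so deep that log b ≤ 2^j, and the ordinary b log b bound suffices for them.

Swollen segments. Deletions may meet a segment that insertions of the same batch have enlarged.
Apart from terms that are paid anyway, d deletions then cost an extra d log d, and d distinct items
always have a total logarithmic finger distance of that order (`card_mul_log_le`). -/

/-- The sum of the work bounds of a list of invocations. -/
def cost (l : List Prim) : ℕ := (l.map Prim.bound).sum

@[simp] theorem cost_nil : cost [] = 0 := rfl
@[simp] theorem cost_cons (q : Prim) (l : List Prim) : cost (q :: l) = q.bound + cost l := by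
  simp [cost]
@[simp] theorem cost_append (l l' : List Prim) : cost (l ++ l') = cost l + cost l' := by
  simp [cost]

namespace Costed

variable {α : Type u} {β : Type v}

@[simp] theorem pure_val (a : α) : (Costed.pure a).val = a := rfl
@[simp] theorem pure_log (a : α) : (Costed.pure a).log = [] := rfl
@[simp] theorem bind_val (x : Costed α) (f : α → Costed β) : (x.bind f).val = (f x.val).val := rfl
@[simp] theorem bind_log (x : Costed α) (f : α → Costed β) :
    (x.bind f).log = x.log ++ (f x.val).log := rfl
@[simp] theorem tick_val (q : Prim) (x : Costed α) : (tick q x).val = x.val := rfl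
@[simp] theorem tick_log (q : Prim) (x : Costed α) : (tick q x).log = q :: x.log := rfl

end Costed

/-! ## Capacities -/

theorem cap_pos (k : ℕ) : 0 < cap k := by unfold cap; positivity

theorem four_le_cap (k : ℕ) : 4 ≤ cap k := by
  unfold cap
  calc 4 = 2 ^ 2 := by norm_num
    _ ≤ 2 ^ 2 ^ (k + 1) := by
      apply Nat.pow_le_pow_right (by norm_num)
      calc 2 = 2 ^ 1 := by norm_num
        _ ≤ 2 ^ (k + 1) := Nat.pow_le_pow_right (by norm_num) (by omega)

theorem cap_succ (k : ℕ) : cap (k + 1) = cap k * cap k := by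
  unfold cap
  rw [← pow_add]; congr 1; ring

/-- Serves to bound the number of iterations: an overfull segment of index k holds more than k + 2
items. -/
theorem lt_cap (k : ℕ) : k + 2 < cap k := by
  induction k with
  | zero => simp [cap]
  | succ k ih => rw [cap_succ]; nlinarith [four_le_cap k]

/-- Capacities square from one index to the next, so all earlier targets together stay below half of
the next capacity. This is why c(k) / 2 items in segment k are enough to fill any run of segments
before it. -/
theorem sum_target_le_half_cap (k₀ d : ℕ) :
    2 * ∑ a ∈ Finset.range (d + 1), target (k₀ + a) ≤ cap (k₀ + d + 1) := by
  induction d with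
  | zero =>
    have := four_le_cap k₀
    simp only [zero_add, Finset.sum_range_one, add_zero, target, cap_succ]
    nlinarith
  | succ d ih =>
    rw [Finset.sum_range_succ]
    have h1 : 16 ≤ cap (k₀ + d + 1) := by rw [cap_succ]; nlinarith [four_le_cap (k₀ + d)]
    have h2 : cap (k₀ + (d + 1) + 1) = cap (k₀ + d + 1) * cap (k₀ + d + 1) := cap_succ _
    have h3 : target (k₀ + (d + 1)) = 2 * cap (k₀ + d + 1) := rfl
    rw [h2, h3]; nlinarith

theorem sum_target_le (k₀ d : ℕ) :
    ∑ a ∈ Finset.range (d + 1), target (k₀ + a) ≤ 4 * cap (k₀ + d) := by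
  cases d with
  | zero => simp [target]; omega
  | succ d =>
    rw [Finset.sum_range_succ]
    have h1 := sum_target_le_half_cap k₀ d
    have h3 : target (k₀ + (d + 1)) = 2 * cap (k₀ + d + 1) := rfl
    have h4 : k₀ + (d + 1) = k₀ + d + 1 := rfl
    rw [h3, h4]; omega

/-- The logarithm of c(k) is 2 * 2^k, and the three further units are absorbed because 2^k ≥ 1. -/
theorem log_four_cap {k n : ℕ} (h : n ≤ 4 * cap k) : Nat.log 2 n + 1 ≤ 5 * 2 ^ k := by
  have h1 : Nat.log 2 n ≤ Nat.log 2 (2 ^ (2 ^ (k + 1) + 2)) := Nat.log_mono_right (by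
    unfold cap at h; rw [pow_add]; omega)
  rw [Nat.log_pow (by norm_num)] at h1
  have : 1 ≤ 2 ^ k := Nat.one_le_two_pow
  rw [pow_succ] at h1; omega

/-- With x = ⌊e / c(k)⌋ the argument is at most c(k) (4 + x), and 4 + x ≤ 2^(2 + x). So c(k) surplus
items raise the bound by only one unit, which is what lets the excess potential pay for accesses to
oversized segments. -/
theorem log_cap_add (k e : ℕ) :
    ((Nat.log 2 (3 * cap k + e) : ℕ) : ℝ) + 1 ≤ 5 * 2 ^ k + (e : ℝ) / cap k := by
  have hc : (0 : ℝ) < cap k := by exact_mod_cast cap_pos k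
  have h1 : 3 * cap k + e ≤ cap k * (4 + e / cap k) := by
    have := Nat.div_add_mod e (cap k)
    have := Nat.mod_lt e (cap_pos k)
    nlinarith
  have h2 : 4 + e / cap k ≤ 2 ^ (2 + e / cap k) := by
    generalize e / cap k = x
    induction x with
    | zero => norm_num
    | succ x ih =>
      rw [show 2 + (x + 1) = (2 + x) + 1 by ring, pow_succ 2 (2 + x)]; omega
  have h3 : Nat.log 2 (3 * cap k + e) ≤ 2 ^ (k + 1) + (2 + e / cap k) := by
    have h4 : 3 * cap k + e ≤ 2 ^ (2 ^ (k + 1) + (2 + e / cap k)) := by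
      rw [pow_add]; exact h1.trans (Nat.mul_le_mul_left _ h2)
    have := Nat.log_mono_right (b := 2) h4
    rwa [Nat.log_pow (by norm_num)] at this
  have h5 : ((Nat.log 2 (3 * cap k + e) : ℕ) : ℝ) ≤ 2 ^ (k + 1) + (2 + (e / cap k : ℕ)) := by
    exact_mod_cast h3
  have h6 : ((e / cap k : ℕ) : ℝ) ≤ (e : ℝ) / cap k := Nat.cast_div_le
  have h7 : (1 : ℝ) ≤ 2 ^ k := one_le_pow₀ (by norm_num)
  rw [pow_succ] at h5; linarith

/-! ### Shifting and filling within a chain: sizes, contents and cost -/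

namespace Chain

variable {K : Type u} {V : Type v}

/-! ## Sizes of segments -/

theorem size_of_length_le {ch : Chain K V} {k : ℕ} (h : ch.length ≤ k) : size ch k = 0 := by
  unfold size; rw [List.getD_eq_default _ _ h]; rfl

theorem size_set (ch : Chain K V) (k j : ℕ) (s : Segment K V) (hk : k < ch.length) :
    size (ch.set k s) j = if j = k then s.length else size ch j := by
  unfold size
  rw [List.getD_eq_getElem?_getD, List.getD_eq_getElem?_getD, List.getElem?_set]
  by_cases h : k = j
  · subst h; simp [hk]
  · simp [h, Ne.symm h]

theorem size_take (ch : Chain K V) (k j : ℕ) :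
    size (ch.take k) j = if j < k then size ch j else 0 := by
  unfold size
  rw [List.getD_eq_getElem?_getD, List.getD_eq_getElem?_getD, List.getElem?_take]
  split_ifs <;> simp

theorem size_append_nil (ch : Chain K V) (n j : ℕ) :
    size (ch ++ List.replicate n []) j = size ch j := by
  unfold size
  rw [List.getD_eq_getElem?_getD, List.getD_eq_getElem?_getD, List.getElem?_append]
  split_ifs with h
  · rfl
  · rw [List.getElem?_replicate, List.getElem?_eq_none (by omega : ch.length ≤ j)]
    split_ifs <;> rfl

theorem flatten_append_nil (ch : Chain K V) (n : ℕ) :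
    List.flatten (ch ++ List.replicate n []) = List.flatten ch := by
  simp

theorem size_le_length_flatten (ch : Chain K V) (k : ℕ) :
    size ch k ≤ (List.flatten ch).length := by
  unfold size
  induction ch generalizing k with
  | nil => simp
  | cons a ch ih =>
    cases k with
    | zero => simp
    | succ k => simp only [List.getD_cons_succ, List.flatten_cons, List.length_append]
                exact (ih k).trans (Nat.le_add_left _ _)

theorem flatten_set_set (ch : Chain K V) (k : ℕ) (a b : Segment K V) (hk : k + 1 < ch.length)
    (h : a ++ b = ch.getD k [] ++ ch.getD (k + 1) []) :
    List.flatten ((ch.set k a).set (k + 1) b) = List.flatten ch := by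
  induction ch generalizing k with
  | nil => simp at hk
  | cons c ch ih =>
    cases k with
    | zero =>
      cases ch with
      | nil => simp at hk
      | cons d ch => simp at h; simp [← List.append_assoc, h]
    | succ k =>
      simp only [List.set_cons_succ, List.flatten_cons]
      rw [ih k (by simpa using hk) (by simpa using h)]

theorem flatten_take_of_last {ch : Chain K V} {k : ℕ} (hk : ch.length ≤ k + 1)
    (h : size ch k = 0) : List.flatten (List.take k ch) = List.flatten ch := by
  induction ch generalizing k with
  | nil => simp
  | cons c ch ih =>
    cases k with
    | zero =>
      have : ch = [] := List.length_eq_zero_iff.mp (by simpa using hk)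
      subst this
      simpa [size, eq_comm] using h
    | succ k =>
      simp only [List.take_succ_cons, List.flatten_cons]
      rw [ih (by simpa using hk) (by simpa [size] using h)]

/-! ## Shifts -/

theorem shiftIn_length (ch : Chain K V) (k q : ℕ) :
    (shiftIn ch k q).val.length = ch.length := by
  simp [shiftIn]

theorem shiftOut_length (ch : Chain K V) (k q : ℕ) :
    (shiftOut ch k q).val.length = ch.length := by
  simp [shiftOut]

theorem size_shiftIn (ch : Chain K V) (k q j : ℕ) (hk : k + 1 < ch.length) (hq : q ≤ size ch k) :
    size (shiftIn ch k q).val j =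
      if j = k then size ch k - q else if j = k + 1 then q + size ch (k + 1) else size ch j := by
  simp only [shiftIn, Costed.tick_val, Costed.pure_val]
  rw [size_set _ _ _ _ (by simpa using hk), size_set _ _ _ _ (by omega)]
  unfold size at *
  split_ifs <;> simp_all <;> omega

theorem size_shiftOut (ch : Chain K V) (k q j : ℕ) (hk : k + 1 < ch.length)
    (hq : q ≤ size ch (k + 1)) :
    size (shiftOut ch k q).val j =
      if j = k then size ch k + q else if j = k + 1 then size ch (k + 1) - q else size ch j := by
  simp only [shiftOut, Costed.tick_val, Costed.pure_val]
  rw [size_set _ _ _ _ (by simpa using hk), size_set _ _ _ _ (by omega)]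
  unfold size at *
  split_ifs <;> simp_all

theorem flatten_shiftIn (ch : Chain K V) (k q : ℕ) (hk : k + 1 < ch.length) :
    List.flatten (shiftIn ch k q).val = List.flatten ch := by
  simp only [shiftIn, Costed.tick_val, Costed.pure_val]
  exact flatten_set_set _ _ _ _ hk (by rw [← List.append_assoc, List.take_append_drop])

theorem flatten_shiftOut (ch : Chain K V) (k q : ℕ) (hk : k + 1 < ch.length) :
    List.flatten (shiftOut ch k q).val = List.flatten ch := by
  simp only [shiftOut, Costed.tick_val, Costed.pure_val]
  exact flatten_set_set _ _ _ _ hk (by rw [List.append_assoc, List.take_append_drop])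

/-- Remove segment `j + 1` if it is empty and the last one. -/
def trim (j : ℕ) (ch : Chain K V) : Chain K V :=
  if size ch (j + 1) = 0 ∧ IsLast ch (j + 1) then ch.take (j + 1) else ch

theorem flatten_trim (j : ℕ) (ch : Chain K V) : List.flatten (trim j ch) = List.flatten ch := by
  unfold trim
  split_ifs with h
  · exact flatten_take_of_last (by have := h.2; unfold IsLast at this; omega) h.1
  · rfl

/-- The number of items missing in the segments `k₀, …, k₀ + d`. -/
def need (k₀ d : ℕ) (ch : Chain K V) : ℕ :=
  (∑ a ∈ Finset.range (d + 1), target (k₀ + a)) - ∑ a ∈ Finset.range (d + 1), size ch (k₀ + a)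

/-- The first round of `fill`. -/
def fillRound (k₀ d : ℕ) (ch : Chain K V) : Chain K V :=
  trim (k₀ + d) (shiftOut ch (k₀ + d) (min (need k₀ d ch) (size ch (k₀ + d + 1)))).val

theorem fill_zero_val (k₀ : ℕ) (ch : Chain K V) : (fill k₀ 0 ch).val = fillRound k₀ 0 ch := rfl

theorem fill_succ_val (k₀ d : ℕ) (ch : Chain K V) :
    (fill k₀ (d + 1) ch).val = (fill k₀ d (fillRound k₀ (d + 1) ch)).val := rfl

theorem cost_fill_zero (k₀ : ℕ) (ch : Chain K V) :
    cost (fill k₀ 0 ch).log = (Nat.log 2 (size ch (k₀ + 1)) + 1) +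
      (Nat.log 2 (size ch k₀ + min (need k₀ 0 ch) (size ch (k₀ + 1))) + 1) := by
  simp [fill, shiftOut, Prim.bound, need, size]

theorem cost_fill_succ (k₀ d : ℕ) (ch : Chain K V) :
    cost (fill k₀ (d + 1) ch).log = (Nat.log 2 (size ch (k₀ + d + 2)) + 1) +
      (Nat.log 2 (size ch (k₀ + d + 1) + min (need k₀ (d + 1) ch) (size ch (k₀ + d + 2))) + 1) +
      cost (fill k₀ d (fillRound k₀ (d + 1) ch)).log := by
  have : (fill k₀ (d + 1) ch).log = (shiftOut ch (k₀ + (d + 1))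
      (min (need k₀ (d + 1) ch) (size ch (k₀ + (d + 1) + 1)))).log ++
      (fill k₀ d (fillRound k₀ (d + 1) ch)).log := rfl
  rw [this, cost_append]
  simp [shiftOut, Prim.bound, size, add_assoc]

theorem fillRound_length (k₀ d : ℕ) (ch : Chain K V) (hk : k₀ + d + 1 < ch.length) :
    (fillRound k₀ d ch).length =
      if k₀ + d + 2 = ch.length ∧ size ch (k₀ + d + 1) ≤ need k₀ d ch then k₀ + d + 1
      else ch.length := by
  unfold fillRound trim
  have hs1 := size_shiftOut ch (k₀ + d) (min (need k₀ d ch) (size ch (k₀ + d + 1))) (k₀ + d + 1) hk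
    (min_le_right _ _)
  rw [if_neg (by omega), if_pos rfl] at hs1
  have hL := shiftOut_length ch (k₀ + d) (min (need k₀ d ch) (size ch (k₀ + d + 1)))
  split_ifs with h1 h2 h2
  · rw [List.length_take, hL]; omega
  · have := h1.2; unfold IsLast at this; omega
  · exact absurd ⟨by omega, by unfold IsLast; omega⟩ h1
  · exact hL

theorem size_fillRound (k₀ d j : ℕ) (ch : Chain K V) (hk : k₀ + d + 1 < ch.length) :
    size (fillRound k₀ d ch) j =
      if j = k₀ + d then size ch (k₀ + d) + min (need k₀ d ch) (size ch (k₀ + d + 1))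
      else if j = k₀ + d + 1 then size ch (k₀ + d + 1) - need k₀ d ch else size ch j := by
  have hs := size_shiftOut ch (k₀ + d) (min (need k₀ d ch) (size ch (k₀ + d + 1))) j hk
    (min_le_right _ _)
  have hs1 := size_shiftOut ch (k₀ + d) (min (need k₀ d ch) (size ch (k₀ + d + 1))) (k₀ + d + 1) hk
    (min_le_right _ _)
  unfold fillRound trim
  by_cases h : size (shiftOut ch (k₀ + d) (min (need k₀ d ch) (size ch (k₀ + d + 1)))).val
      (k₀ + d + 1) = 0 ∧
      IsLast (shiftOut ch (k₀ + d) (min (need k₀ d ch) (size ch (k₀ + d + 1)))).val (k₀ + d + 1)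
  · rw [if_pos h, size_take]
    have h2 := h.2
    unfold IsLast at h2
    rw [shiftOut_length] at h2
    have h1 := h.1
    rw [hs1] at h1
    split_ifs at h1 ⊢ <;> first | omega | (rw [hs]; split_ifs <;> omega) | skip
    rw [size_of_length_le]; omega
  · rw [if_neg h, hs]
    split_ifs <;> omega

theorem flatten_fillRound (k₀ d : ℕ) (ch : Chain K V) (hk : k₀ + d + 1 < ch.length) :
    List.flatten (fillRound k₀ d ch) = List.flatten ch := by
  unfold fillRound
  rw [flatten_trim, flatten_shiftOut _ _ _ hk]

theorem le_fillRound_length (k₀ d : ℕ) (ch : Chain K V) (hk : k₀ + d + 1 < ch.length) :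
    k₀ + d + 1 ≤ (fillRound k₀ d ch).length := by
  rw [fillRound_length _ _ _ hk]; split_ifs <;> omega

theorem flatten_fill (k₀ d : ℕ) (ch : Chain K V) (hk : k₀ + d + 1 < ch.length) :
    List.flatten (fill k₀ d ch).val = List.flatten ch := by
  induction d generalizing ch with
  | zero => exact flatten_fillRound k₀ 0 ch hk
  | succ d ih =>
    rw [fill_succ_val, ih, flatten_fillRound _ _ _ hk]
    exact le_fillRound_length k₀ (d + 1) ch hk

/-- No prefix of the segments `k₀, …, k₀ + d` has more items than its target. -/
def PrefixLow (k₀ d : ℕ) (ch : Chain K V) : Prop :=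
  ∀ i ≤ d, ∑ a ∈ Finset.range (i + 1), size ch (k₀ + a) ≤
    ∑ a ∈ Finset.range (i + 1), target (k₀ + a)

/-- A round only touches the segments k₀ + d and k₀ + d + 1, so the needs of all shorter runs stay
the same. -/
theorem sum_size_fillRound (k₀ d i : ℕ) (ch : Chain K V) (hk : k₀ + d + 1 < ch.length)
    (hi : i ≤ d) :
    ∑ a ∈ Finset.range i, size (fillRound k₀ d ch) (k₀ + a) =
      ∑ a ∈ Finset.range i, size ch (k₀ + a) := by
  refine Finset.sum_congr rfl fun a ha => ?_
  have := Finset.mem_range.mp ha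
  rw [size_fillRound _ _ _ _ hk]
  split_ifs <;> omega

theorem PrefixLow.fillRound {k₀ d : ℕ} {ch : Chain K V} (h : PrefixLow k₀ (d + 1) ch)
    (hk : k₀ + (d + 1) + 1 < ch.length) : PrefixLow k₀ d (fillRound k₀ (d + 1) ch) := by
  intro i hi
  rw [sum_size_fillRound _ _ _ _ hk (by omega)]
  exact h i (by omega)

/-- A segment never receives more than its prefix lacks, so afterwards it holds at most the total
target of the prefix, which is dominated by its last summand. -/
theorem PrefixLow.add_min_le {k₀ d : ℕ} {ch : Chain K V} (h : PrefixLow k₀ d ch) :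
    size ch (k₀ + d) + min (need k₀ d ch) (size ch (k₀ + d + 1)) ≤ 4 * cap (k₀ + d) := by
  have h1 := h d le_rfl
  have h2 := sum_target_le k₀ d
  have h3 : size ch (k₀ + d) ≤ ∑ a ∈ Finset.range (d + 1), size ch (k₀ + a) :=
    Finset.single_le_sum (f := fun a => size ch (k₀ + a)) (fun _ _ => Nat.zero_le _)
      (Finset.self_mem_range_succ d)
  have : min (need k₀ d ch) (size ch (k₀ + d + 1)) ≤ need k₀ d ch := min_le_left _ _
  unfold need at *; omega

/-- Only the first split can be on a large segment, and its logarithm is kept in the bound. All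
other splits and joins are on at most 4 c(j) items and cost at most 5 * 2^j each, two per segment: a
geometric sum. -/
theorem cost_fill (k₀ d : ℕ) (ch : Chain K V) (hk : k₀ + d + 1 < ch.length)
    (h : PrefixLow k₀ d ch) :
    cost (fill k₀ d ch).log ≤ (Nat.log 2 (size ch (k₀ + d + 1)) + 1) + 20 * 2 ^ (k₀ + d) := by
  induction d generalizing ch with
  | zero =>
    have h1 := log_four_cap h.add_min_le
    rw [cost_fill_zero]; simp only [add_zero] at *; omega
  | succ d ih =>
    have h1 := log_four_cap h.add_min_le
    have h2 := ih _ (le_fillRound_length k₀ (d + 1) ch hk) (h.fillRound hk)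
    rw [cost_fill_succ]
    have h3 : size (Chain.fillRound k₀ (d + 1) ch) (k₀ + d + 1) =
        size ch (k₀ + (d + 1)) + min (need k₀ (d + 1) ch) (size ch (k₀ + (d + 1) + 1)) := by
      rw [size_fillRound _ _ _ _ hk, if_pos (by rfl)]
    rw [h3] at h2
    have h4 : k₀ + (d + 1) = k₀ + d + 1 := rfl
    simp only [h4, show k₀ + d + 1 + 1 = k₀ + d + 2 from rfl] at *
    rw [pow_succ] at *
    omega

/-- Filling with enough items. -/
theorem fill_of_enough (k₀ d : ℕ) (ch : Chain K V) (hk : k₀ + d + 1 < ch.length)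
    (h : PrefixLow k₀ d ch)
    (hn : need k₀ d ch < size ch (k₀ + d + 1) ∨
      (need k₀ d ch ≤ size ch (k₀ + d + 1) ∧ k₀ + d + 2 < ch.length)) :
    (fill k₀ d ch).val.length = ch.length ∧ ∀ j, size (fill k₀ d ch).val j =
      if k₀ ≤ j ∧ j ≤ k₀ + d then target j
      else if j = k₀ + d + 1 then size ch (k₀ + d + 1) - need k₀ d ch else size ch j := by
  have hl : (fillRound k₀ d ch).length = ch.length := by
    rw [fillRound_length _ _ _ hk, if_neg (by omega)]
  have hmin : min (need k₀ d ch) (size ch (k₀ + d + 1)) = need k₀ d ch := min_eq_left (by omega)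
  induction d generalizing ch with
  | zero =>
    refine ⟨hl, fun j => ?_⟩
    rw [fill_zero_val, size_fillRound _ _ _ _ hk, hmin]
    have := h 0 le_rfl
    simp only [need, zero_add, Finset.sum_range_one, add_zero] at *
    split_ifs <;> first | omega | simp_all
  | succ d ih =>
    have hlow := h.fillRound hk
    have hsum := sum_size_fillRound k₀ (d + 1) (d + 1) ch hk le_rfl
    have hneed : need k₀ d (Chain.fillRound k₀ (d + 1) ch) = need k₀ d ch := by
      unfold need; rw [hsum]
    have h1 : size (Chain.fillRound k₀ (d + 1) ch) (k₀ + d + 1) =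
        size ch (k₀ + d + 1) + need k₀ (d + 1) ch := by
      rw [size_fillRound _ _ _ _ hk, if_pos (by rfl), hmin]; rfl
    have hd := h d (by omega)
    have hd1 := h (d + 1) le_rfl
    -- The amount pulled into segment k₀ + d + 1 is such that, once its own target is kept back,
    -- exactly the need of the shorter run remains to be passed on.
    have e1 : need k₀ (d + 1) ch + size ch (k₀ + d + 1) = need k₀ d ch + target (k₀ + d + 1) := by
      unfold need
      rw [Finset.sum_range_succ _ (d + 1), Finset.sum_range_succ _ (d + 1)] at *
      simp only [← add_assoc] at *
      omega
    have hle : need k₀ d ch ≤ size (Chain.fillRound k₀ (d + 1) ch) (k₀ + d + 1) := by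
      rw [h1]; omega
    have hk' : k₀ + d + 1 < (Chain.fillRound k₀ (d + 1) ch).length := by rw [hl]; omega
    have := ih (Chain.fillRound k₀ (d + 1) ch) hk' hlow
      (Or.inr ⟨by rw [hneed]; exact hle, by rw [hl]; omega⟩)
      (by rw [fillRound_length _ _ _ hk', if_neg (by rw [hl]; omega)])
      (by rw [hneed]; exact min_eq_left hle)
    rw [fill_succ_val]
    refine ⟨by rw [this.1, hl], fun j => ?_⟩
    rw [this.2, hneed, h1, size_fillRound _ _ _ _ hk, hmin]
    have h4 : k₀ + (d + 1) = k₀ + d + 1 := rfl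
    simp only [h4, show k₀ + d + 1 + 1 = k₀ + d + 2 from rfl] at *
    have : j = k₀ + d + 1 → target j = target (k₀ + d + 1) := fun h => by rw [h]
    split_ifs <;> omega

/-- Filling with too few items, from the last segment. -/
theorem fill_of_exhausted (k₀ d : ℕ) (ch : Chain K V) (hk : k₀ + d + 2 = ch.length)
    (h : PrefixLow k₀ d ch) (hn : size ch (k₀ + d + 1) ≤ need k₀ d ch) :
    k₀ + 1 ≤ (fill k₀ d ch).val.length ∧ (fill k₀ d ch).val.length ≤ k₀ + d + 1 ∧
    (∀ j < k₀, size (fill k₀ d ch).val j = size ch j) ∧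
    (∀ j, k₀ ≤ j → j + 1 < (fill k₀ d ch).val.length → size (fill k₀ d ch).val j = target j) ∧
    size (fill k₀ d ch).val ((fill k₀ d ch).val.length - 1) ≤
      target ((fill k₀ d ch).val.length - 1) ∧
    ((fill k₀ d ch).val.length = k₀ + d + 1 →
      size (fill k₀ d ch).val (k₀ + d) ≤ size ch (k₀ + d) + size ch (k₀ + d + 1)) := by
  have hl : (fillRound k₀ d ch).length = k₀ + d + 1 := by
    rw [fillRound_length _ _ _ (by omega), if_pos (by omega)]
  have hmin : min (need k₀ d ch) (size ch (k₀ + d + 1)) = size ch (k₀ + d + 1) :=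
    min_eq_right (by omega)
  have hsize := fun j => size_fillRound k₀ d j ch (by omega)
  rw [hmin] at hsize
  induction d generalizing ch with
  | zero =>
    rw [fill_zero_val, hl]
    have := h 0 le_rfl
    simp only [need, zero_add, Finset.sum_range_one, add_zero] at *
    refine ⟨le_rfl, le_rfl, fun j hj => ?_, fun j hj hj' => ?_, ?_, fun _ => ?_⟩
    · rw [hsize]; split_ifs <;> omega
    · omega
    · rw [hsize, if_pos (by omega)]
      have : k₀ + 1 - 1 = k₀ := rfl
      rw [this]; omega
    · rw [hsize, if_pos rfl]
  | succ d ih =>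
    have hk1 : k₀ + (d + 1) + 1 < ch.length := by omega
    have hlow := h.fillRound hk1
    have hsum := sum_size_fillRound k₀ (d + 1) (d + 1) ch hk1 le_rfl
    have hneed : need k₀ d (Chain.fillRound k₀ (d + 1) ch) = need k₀ d ch := by
      unfold need; rw [hsum]
    have h1 : size (Chain.fillRound k₀ (d + 1) ch) (k₀ + d + 1) =
        size ch (k₀ + d + 1) + size ch (k₀ + d + 2) := by
      rw [hsize, if_pos (by rfl)]; rfl
    have hd := h d (by omega)
    have hd1 := h (d + 1) le_rfl
    have e1 : need k₀ (d + 1) ch + size ch (k₀ + d + 1) = need k₀ d ch + target (k₀ + d + 1) := by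
      unfold need
      rw [Finset.sum_range_succ _ (d + 1), Finset.sum_range_succ _ (d + 1)] at *
      simp only [← add_assoc] at *
      omega
    have hk' : k₀ + d + 1 < (Chain.fillRound k₀ (d + 1) ch).length := by rw [hl]; omega
    have h4 : k₀ + (d + 1) = k₀ + d + 1 := rfl
    rw [fill_succ_val]
    -- If the segment that received the last items has more than the shorter run needs, that run is
    -- filled completely and this segment stays as the last one. Otherwise it is exhausted in turn
    -- and the induction hypothesis applies.
    by_cases hc : need k₀ d ch < size (Chain.fillRound k₀ (d + 1) ch) (k₀ + d + 1)
    · obtain ⟨a1, a2⟩ := fill_of_enough k₀ d _ hk' hlow (Or.inl (by rw [hneed]; exact hc))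
      rw [a1, hl]
      refine ⟨by omega, by omega, fun j hj => ?_, fun j hj hj' => ?_, ?_, fun _ => ?_⟩
      · rw [a2, if_neg (by omega), if_neg (by omega), hsize, if_neg (by omega), if_neg (by omega)]
      · rw [a2, if_pos (by omega)]
      · rw [show k₀ + (d + 1) + 1 - 1 = k₀ + d + 1 by omega, a2, if_neg (by omega),
          if_pos (by omega), h1, hneed]
        simp only [h4, show k₀ + d + 1 + 1 = k₀ + d + 2 from rfl] at *; omega
      · rw [a2, if_neg (by omega), if_pos (by omega), h1, hneed]
        simp only [h4, show k₀ + d + 1 + 1 = k₀ + d + 2 from rfl] at *; omega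
    · obtain ⟨a1, a2, a3, a4, a5, a6⟩ := ih _ (by rw [hl]; omega) hlow
        (by rw [hneed]; omega)
        (by rw [fillRound_length _ _ _ hk', if_pos (by rw [hl, hneed]; omega)])
        (by rw [hneed]; exact min_eq_right (by omega))
        (fun j => by
          rw [size_fillRound _ _ _ _ hk', min_eq_right (by rw [hneed]; omega)])
      refine ⟨a1, by omega, fun j hj => ?_, a4, a5, fun hh => by omega⟩
      rw [a3 j hj, hsize, if_neg (by omega), if_neg (by omega)]

end Chain

end

/-! ### The potential function, and how filling a run lowers it -/

section

/-! ## The potential -/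

/-- The potential of one item of excess or deficit in segment `k`, up to a constant factor. -/
noncomputable def wt (k : ℕ) : ℝ := 2 ^ k / cap k

theorem wt_pos (k : ℕ) : 0 < wt k := by
  have : (0 : ℝ) < cap k := by exact_mod_cast cap_pos k
  unfold wt; positivity

theorem wt_mul_cap (k : ℕ) : wt k * cap k = 2 ^ k := by
  have : (0 : ℝ) < cap k := by exact_mod_cast cap_pos k
  unfold wt; field_simp

/-- As c(k+1) = c(k)² with c(k) ≥ 4, the weights fall by a factor of at least 2. An imbalance handed
to the next segment thus frees half of its potential for the work of the transfer. -/
theorem wt_succ_le (k : ℕ) : wt (k + 1) ≤ wt k / 2 := by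
  have h0 : (0 : ℝ) < cap k := by exact_mod_cast cap_pos k
  have h : (4 : ℝ) ≤ cap k := by exact_mod_cast four_le_cap k
  unfold wt
  rw [cap_succ, pow_succ, Nat.cast_mul, div_div, div_le_div_iff₀ (by positivity) (by positivity)]
  have : (0 : ℝ) < 2 ^ k := by positivity
  nlinarith [mul_pos this h0, mul_nonneg (mul_pos this h0).le (sub_nonneg.2 h)]

theorem wt_antitone : Antitone wt :=
  antitone_nat_of_succ_le fun k => (wt_succ_le k).trans (by linarith [wt_pos k])

theorem wt_le_one (k : ℕ) : wt k ≤ 1 := by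
  have h := wt_antitone (Nat.zero_le k)
  refine h.trans ?_
  unfold wt cap; norm_num

theorem inv_cap_le_wt (k : ℕ) (x : ℝ) (hx : 0 ≤ x) : x / cap k ≤ wt k * x := by
  have h0 : (0 : ℝ) < cap k := by exact_mod_cast cap_pos k
  unfold wt
  rw [div_mul_eq_mul_div, div_le_div_iff_of_pos_right h0]
  exact le_mul_of_one_le_left hx (one_le_pow₀ (by norm_num))

/-- The work of an access to the end of a segment of index `k` of size `n`. -/
theorem log_le_wt (k n : ℕ) :
    ((Nat.log 2 n : ℕ) : ℝ) + 1 ≤ 5 * 2 ^ k + wt k * ((n - 3 * cap k : ℕ) : ℝ) := by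
  have h1 := log_cap_add k (n - 3 * cap k)
  have h2 : Nat.log 2 n ≤ Nat.log 2 (3 * cap k + (n - 3 * cap k)) := Nat.log_mono_right (by omega)
  have h3 : ((Nat.log 2 n : ℕ) : ℝ) ≤ (Nat.log 2 (3 * cap k + (n - 3 * cap k)) : ℕ) := by
    exact_mod_cast h2
  have h4 := inv_cap_le_wt k ((n - 3 * cap k : ℕ) : ℝ) (Nat.cast_nonneg _)
  linarith

/-- The potential of segment `k` with `s` items, in a chain of `n` segments. -/
noncomputable def segPot (k n s : ℕ) : ℝ :=
  32768 * wt k * ((s - target k : ℕ) : ℝ) +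
    if k + 1 < n then 256 * wt k * ((target k - s : ℕ) : ℝ) else if s = 0 then 0 else 128 * 2 ^ k

theorem segPot_nonneg (k n s : ℕ) : 0 ≤ segPot k n s := by
  have := wt_pos k
  unfold segPot; split_ifs <;> positivity

theorem segPot_zero_last (k n : ℕ) (h : n ≤ k + 1) : segPot k n 0 = 0 := by
  unfold segPot; rw [if_neg (by omega)]; simp

theorem segPot_target (k n : ℕ) (h : k + 1 < n) : segPot k n (target k) = 0 := by
  unfold segPot; rw [if_pos h]; simp

theorem segPot_of_le_target {k n s : ℕ} (h : k + 1 < n) (hs : s ≤ target k) :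
    segPot k n s = 256 * (wt k * ((target k - s : ℕ) : ℝ)) := by
  unfold segPot; rw [if_pos h, Nat.sub_eq_zero_of_le hs]; simp; ring

theorem segPot_last_le {k n s : ℕ} (h : n ≤ k + 1) (hs : s ≤ target k) :
    segPot k n s ≤ 128 * 2 ^ k := by
  unfold segPot; rw [if_neg (by omega), Nat.sub_eq_zero_of_le hs]
  split_ifs <;> simp

theorem le_segPot_last {k n s : ℕ} (h : n ≤ k + 1) (hs : s ≠ 0) :
    128 * 2 ^ k ≤ segPot k n s := by
  have := wt_pos k
  unfold segPot; rw [if_neg (by omega), if_neg hs]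
  have : 0 ≤ 32768 * wt k * ((s - target k : ℕ) : ℝ) := by positivity
  linarith

theorem segPot_congr {k n n' s : ℕ} (h : k + 1 < n) (h' : k + 1 < n') :
    segPot k n s = segPot k n' s := by
  unfold segPot; rw [if_pos h, if_pos h']

theorem segPot_sub_le {k n s q : ℕ} (hq : q ≤ s) (hs : q < s ∨ k + 1 < n) :
    segPot k n (s - q) ≤ segPot k n s + 256 * wt k * q := by
  have hw := wt_pos k
  have h1 : ((s - q - target k : ℕ) : ℝ) ≤ ((s - target k : ℕ) : ℝ) := by
    exact_mod_cast (by omega : s - q - target k ≤ s - target k)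
  have h2 : ((target k - (s - q) : ℕ) : ℝ) ≤ ((target k - s : ℕ) : ℝ) + q := by
    exact_mod_cast (by omega : target k - (s - q) ≤ target k - s + q)
  unfold segPot
  have h3 : 0 ≤ 256 * wt k * (q : ℝ) := by positivity
  split_ifs <;> first | omega | nlinarith

/-- The last summand covers an empty last segment that becomes nonempty. -/
theorem segPot_add_le (k n s q : ℕ) :
    segPot k n (s + q) ≤ segPot k n s + 32768 * wt k * q + 128 * 2 ^ k := by
  have hw := wt_pos k
  have h1 : ((s + q - target k : ℕ) : ℝ) ≤ ((s - target k : ℕ) : ℝ) + q := by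
    exact_mod_cast (by omega : s + q - target k ≤ s - target k + q)
  have h2 : ((target k - (s + q) : ℕ) : ℝ) ≤ ((target k - s : ℕ) : ℝ) := by
    exact_mod_cast (by omega : target k - (s + q) ≤ target k - s)
  have h4 : (0 : ℝ) < 2 ^ k := by positivity
  unfold segPot
  split_ifs <;> first | omega | nlinarith

/-- One insertion or deletion. -/
theorem segPot_lipschitz (k n s s' q : ℕ) (h1 : s ≤ s' + q) (h2 : s' ≤ s + q) :
    segPot k n s' ≤ segPot k n s + 33152 * 2 ^ k * q := by
  rcases Nat.eq_zero_or_pos q with rfl | hq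
  · have : s = s' := by omega
    subst this; simp
  have hw := wt_pos k
  have hw1 := wt_le_one k
  have h3 : ((s' - target k : ℕ) : ℝ) ≤ ((s - target k : ℕ) : ℝ) + q := by
    exact_mod_cast (by omega : s' - target k ≤ s - target k + q)
  have h4 : ((target k - s' : ℕ) : ℝ) ≤ ((target k - s : ℕ) : ℝ) + q := by
    exact_mod_cast (by omega : target k - s' ≤ target k - s + q)
  have h5 : (1 : ℝ) ≤ 2 ^ k := one_le_pow₀ (by norm_num)
  have h6 : (1 : ℝ) ≤ q := by exact_mod_cast hq
  have h7 : wt k * ((s' - target k : ℕ) : ℝ) ≤ wt k * ((s - target k : ℕ) : ℝ) + 2 ^ k * q := by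
    nlinarith [mul_le_mul_of_nonneg_left h3 hw.le, mul_le_mul_of_nonneg_right (hw1.trans h5)
      (by linarith : (0 : ℝ) ≤ q)]
  have h8 : wt k * ((target k - s' : ℕ) : ℝ) ≤ wt k * ((target k - s : ℕ) : ℝ) + 2 ^ k * q := by
    nlinarith [mul_le_mul_of_nonneg_left h4 hw.le, mul_le_mul_of_nonneg_right (hw1.trans h5)
      (by linarith : (0 : ℝ) ≤ q)]
  -- The flat term of a last segment that becomes nonempty is charged to the q ≥ 1 changed items:
  -- 32768 + 256 + 128 = 33152.
  have h9 : (2 : ℝ) ^ k ≤ 2 ^ k * q := le_mul_of_one_le_right (by positivity) h6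
  have h10 : (0 : ℝ) < 2 ^ k := by positivity
  unfold segPot
  split_ifs <;> linarith

theorem sum_range_sub_of_two {f g : ℕ → ℝ} {n j : ℕ} (hj : j + 1 < n)
    (h : ∀ i, i ≠ j → i ≠ j + 1 → f i = g i) :
    ∑ i ∈ Finset.range n, f i =
      ∑ i ∈ Finset.range n, g i + (f j - g j) + (f (j + 1) - g (j + 1)) := by
  have h1 : ∑ i ∈ Finset.range n, (f i - g i) = ∑ i ∈ {j, j + 1}, (f i - g i) := by
    symm
    apply Finset.sum_subset
    · intro i hi
      simp only [Finset.mem_insert, Finset.mem_singleton] at hi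
      rw [Finset.mem_range]; omega
    · intro i _ hi
      simp only [Finset.mem_insert, Finset.mem_singleton, not_or] at hi
      rw [h i hi.1 hi.2, sub_self]
  rw [Finset.sum_sub_distrib, Finset.sum_pair (by omega)] at h1
  linarith

namespace Chain

variable {K : Type u} {V : Type v}

/-- The potential of a chain. -/
noncomputable def pot (ch : Chain K V) : ℝ :=
  ∑ k ∈ Finset.range ch.length, segPot k ch.length (size ch k)

theorem pot_nonneg (ch : Chain K V) : 0 ≤ pot ch :=
  Finset.sum_nonneg fun _ _ => segPot_nonneg _ _ _

/-- The potential that the last segment would have for its deficit if it were not the last. -/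
noncomputable def lastDef (ch : Chain K V) : ℝ :=
  if target (ch.length - 1) ≤ size ch (ch.length - 1) + cap (ch.length - 1) then
    256 * wt (ch.length - 1) * ((target (ch.length - 1) - size ch (ch.length - 1) : ℕ) : ℝ)
  else 0

/-- The deficit is counted only while it is at most c(k), and c(k) items weigh 2^k. -/
theorem lastDef_le (ch : Chain K V) : lastDef ch ≤ 256 * 2 ^ (ch.length - 1) := by
  unfold lastDef
  split_ifs with h
  · rw [← wt_mul_cap, mul_assoc]
    have h1 : ((target (ch.length - 1) - size ch (ch.length - 1) : ℕ) : ℝ) ≤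
        cap (ch.length - 1) := by exact_mod_cast (by omega)
    have := mul_le_mul_of_nonneg_left h1 (wt_pos (ch.length - 1)).le
    linarith
  · positivity

theorem lastDef_nonneg (ch : Chain K V) : 0 ≤ lastDef ch := by
  have := wt_pos (ch.length - 1)
  unfold lastDef
  split_ifs <;> positivity

/-! ## Filling a run of underfull segments -/

theorem fillUsing_of_underfull {ch : Chain K V} {k k₀ : ℕ} (hk : k₀ < k) (h : Underfull ch k₀)
    (hmin : ∀ j < k₀, ¬ Underfull ch j) :
    fillUsing k ch = Costed.tick (.linear (k - k₀)) (fill k₀ (k - 1 - k₀) ch) := by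
  have : (List.range k).find? (fun a => decide (Underfull ch a)) = some k₀ := by
    rw [List.find?_range_eq_some]
    simp; exact ⟨h, hk, hmin⟩
  unfold fillUsing; rw [this]

theorem fillUsing_of_not_underfull {ch : Chain K V} {k : ℕ} (h : ∀ j < k, ¬ Underfull ch j) :
    fillUsing k ch = Costed.pure ch := by
  have : (List.range k).find? (fun a => decide (Underfull ch a)) = none := by
    rw [List.find?_range_eq_none]
    simpa using h
  unfold fillUsing; rw [this]

theorem prefixLow_of_run {ch : Chain K V} {k₀ d : ℕ}
    (h : ∀ a, k₀ ≤ a → a ≤ k₀ + d → Underfull ch a) : PrefixLow k₀ d ch := by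
  intro i hi
  refine Finset.sum_le_sum fun a ha => ?_
  have := Finset.mem_range.mp ha
  have := (h (k₀ + a) (by omega) (by omega)).2
  omega

theorem need_le (k₀ d : ℕ) (ch : Chain K V) : 2 * need k₀ d ch ≤ cap (k₀ + d + 1) := by
  have := sum_target_le_half_cap k₀ d
  unfold need; omega

/-- The weighted deficit of the segments `k₀, …, k₀ + d`. -/
noncomputable def deficit (k₀ d : ℕ) (ch : Chain K V) : ℝ :=
  ∑ a ∈ Finset.range (d + 1), wt (k₀ + a) * ((target (k₀ + a) - size ch (k₀ + a) : ℕ) : ℝ)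

/-- The need is at most the sum of the deficits, and a missing item weighs at most half as much in
the source segment as in any segment of the run. -/
theorem wt_mul_need_le (k₀ d : ℕ) (ch : Chain K V) :
    wt (k₀ + d + 1) * (need k₀ d ch : ℝ) ≤ deficit k₀ d ch / 2 := by
  have h1 : (need k₀ d ch : ℝ) ≤
      ∑ a ∈ Finset.range (d + 1), ((target (k₀ + a) - size ch (k₀ + a) : ℕ) : ℝ) := by
    have : need k₀ d ch ≤ ∑ a ∈ Finset.range (d + 1), (target (k₀ + a) - size ch (k₀ + a)) := by
      unfold need
      rw [Nat.sub_le_iff_le_add, ← Finset.sum_add_distrib]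
      exact Finset.sum_le_sum fun a _ => by omega
    exact_mod_cast this
  refine (mul_le_mul_of_nonneg_left h1 (wt_pos _).le).trans ?_
  unfold deficit
  rw [Finset.mul_sum, Finset.sum_div]
  refine Finset.sum_le_sum fun a ha => ?_
  have ha' := Finset.mem_range.mp ha
  have h2 := wt_succ_le (k₀ + d)
  have h3 := wt_antitone (by omega : k₀ + a ≤ k₀ + d)
  have h4 : (0 : ℝ) ≤ ((target (k₀ + a) - size ch (k₀ + a) : ℕ) : ℝ) := Nat.cast_nonneg _
  nlinarith

theorem deficit_ge {k₀ d a : ℕ} (ch : Chain K V) (ha : a ≤ d) :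
    wt (k₀ + a) * ((target (k₀ + a) - size ch (k₀ + a) : ℕ) : ℝ) ≤ deficit k₀ d ch :=
  Finset.single_le_sum
    (f := fun a => wt (k₀ + a) * ((target (k₀ + a) - size ch (k₀ + a) : ℕ) : ℝ))
    (fun _ _ => mul_nonneg (wt_pos _).le (Nat.cast_nonneg _)) (Finset.mem_range.mpr (by omega))

theorem wt_mul_def_ge {ch : Chain K V} {k : ℕ} (h : size ch k + cap k < target k) :
    2 ^ k ≤ wt k * ((target k - size ch k : ℕ) : ℝ) := by
  rw [← wt_mul_cap]
  refine mul_le_mul_of_nonneg_left ?_ (wt_pos k).le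
  exact_mod_cast (by omega)

/-- An underfull segment has no excess and is not last, so its potential is just the deficit term.
-/
theorem pot_eq_of_run {ch : Chain K V} {k₀ d : ℕ} (hk : k₀ + d + 1 < ch.length)
    (h : ∀ a, k₀ ≤ a → a ≤ k₀ + d → Underfull ch a) :
    pot ch = ∑ j ∈ Finset.range k₀, segPot j ch.length (size ch j) + 256 * deficit k₀ d ch +
      ∑ j ∈ Finset.Ico (k₀ + d + 1) ch.length, segPot j ch.length (size ch j) := by
  have e1 : ∑ j ∈ Finset.Ico k₀ (k₀ + d + 1), segPot j ch.length (size ch j) =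
      256 * deficit k₀ d ch := by
    unfold deficit
    rw [Finset.sum_Ico_eq_sum_range, Finset.mul_sum, show k₀ + d + 1 - k₀ = d + 1 by omega]
    refine Finset.sum_congr rfl fun a ha => ?_
    have ha' := Finset.mem_range.mp ha
    have := (h (k₀ + a) (by omega) (by omega)).2
    exact segPot_of_le_target (by omega) (by omega)
  unfold pot
  rw [Finset.range_eq_Ico, ← Finset.sum_Ico_consecutive _ (Nat.zero_le k₀) (by omega),
    ← Finset.sum_Ico_consecutive _ (by omega : k₀ ≤ k₀ + d + 1) hk.le, e1, ← add_assoc, Finset.range_eq_Ico]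

theorem pot_fill_eq {k₀ d : ℕ} {ch : Chain K V} (hk : k₀ + d + 1 < ch.length)
    (h : ∀ a, k₀ ≤ a → a ≤ k₀ + d → Underfull ch a)
    (hn : need k₀ d ch < size ch (k₀ + d + 1) ∨
      (need k₀ d ch ≤ size ch (k₀ + d + 1) ∧ k₀ + d + 2 < ch.length)) :
    pot (fill k₀ d ch).val = ∑ j ∈ Finset.range k₀, segPot j ch.length (size ch j) +
      ∑ j ∈ Finset.Ico (k₀ + d + 1) ch.length,
        segPot j ch.length (size (fill k₀ d ch).val j) := by
  obtain ⟨h1, h2⟩ := fill_of_enough k₀ d ch hk (prefixLow_of_run h) hn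
  unfold pot
  rw [h1, Finset.range_eq_Ico, ← Finset.sum_Ico_consecutive _ (Nat.zero_le k₀) (by omega),
    ← Finset.sum_Ico_consecutive _ (by omega : k₀ ≤ k₀ + d + 1) hk.le]
  have e1 : ∑ j ∈ Finset.Ico k₀ (k₀ + d + 1),
      segPot j ch.length (size (fill k₀ d ch).val j) = 0 := by
    refine Finset.sum_eq_zero fun j hj => ?_
    have hj' := Finset.mem_Ico.mp hj
    rw [h2, if_pos (by omega), segPot_target _ _ (by omega)]
  rw [e1, zero_add, Finset.range_eq_Ico]
  congr 1
  refine Finset.sum_congr rfl fun j hj => ?_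
  have hj' := Finset.mem_Ico.mp hj
  rw [h2, if_neg (by omega), if_neg (by omega)]

/-- The effect on the potential of filling a run with enough items. -/
theorem pot_fill_of_enough {k₀ d : ℕ} {ch : Chain K V} (hk : k₀ + d + 1 < ch.length)
    (h : ∀ a, k₀ ≤ a → a ≤ k₀ + d → Underfull ch a)
    (hn : need k₀ d ch < size ch (k₀ + d + 1) ∨
      (need k₀ d ch ≤ size ch (k₀ + d + 1) ∧ k₀ + d + 2 < ch.length)) :
    pot (fill k₀ d ch).val + 128 * deficit k₀ d ch ≤ pot ch := by
  obtain ⟨h1, h2⟩ := fill_of_enough k₀ d ch hk (prefixLow_of_run h) hn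
  rw [pot_fill_eq hk h hn, pot_eq_of_run hk h, Finset.sum_eq_sum_Ico_succ_bot hk,
    Finset.sum_eq_sum_Ico_succ_bot hk]
  have e2 : ∑ j ∈ Finset.Ico (k₀ + d + 1 + 1) ch.length,
      segPot j ch.length (size (fill k₀ d ch).val j) =
      ∑ j ∈ Finset.Ico (k₀ + d + 1 + 1) ch.length, segPot j ch.length (size ch j) := by
    refine Finset.sum_congr rfl fun j hj => ?_
    have hj' := Finset.mem_Ico.mp hj
    rw [h2, if_neg (by omega), if_neg (by omega)]
  rw [e2, h2, if_neg (by omega), if_pos rfl]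
  -- Of the potential `256 * deficit` that the run releases, at most half reappears in the source as
  -- `256 * wt * need`; the remaining `128 * deficit` is free.
  have h4 := segPot_sub_le (k := k₀ + d + 1) (n := ch.length) (s := size ch (k₀ + d + 1))
    (q := need k₀ d ch) (by omega) (by omega)
  have h5 := wt_mul_need_le k₀ d ch
  linarith

/-- The effect on the potential of filling a run with too few items. -/
theorem pot_fill_of_exhausted {k₀ d : ℕ} {ch : Chain K V} (hk : k₀ + d + 2 = ch.length)
    (h : ∀ a, k₀ ≤ a → a ≤ k₀ + d → Underfull ch a)
    (hn : size ch (k₀ + d + 1) ≤ need k₀ d ch) :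
    pot (fill k₀ d ch).val + 60 * 2 ^ (k₀ + d + 1) + lastDef (fill k₀ d ch).val ≤ pot ch := by
  obtain ⟨h1, h2, h3, h4, h5, h6⟩ := fill_of_exhausted k₀ d ch hk (prefixLow_of_run h) hn
  set ch' := (fill k₀ d ch).val with hch'
  set l := ch'.length - 1 with hl
  have hl1 : ch'.length = l + 1 := by omega
  have e0 : pot ch' ≤ ∑ j ∈ Finset.range k₀, segPot j ch.length (size ch j) + 128 * 2 ^ l := by
    unfold pot
    rw [Finset.range_eq_Ico, ← Finset.sum_Ico_consecutive _ (Nat.zero_le k₀) (by omega),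
      hl1, Finset.sum_Ico_succ_top (by omega), Finset.range_eq_Ico]
    have e1 : ∑ j ∈ Finset.Ico k₀ l, segPot j (l + 1) (size ch' j) = 0 := by
      refine Finset.sum_eq_zero fun j hj => ?_
      have hj' := Finset.mem_Ico.mp hj
      rw [h4 j (by omega) (by omega), segPot_target _ _ (by omega)]
    have e2 : ∑ j ∈ Finset.Ico 0 k₀, segPot j (l + 1) (size ch' j) =
        ∑ j ∈ Finset.Ico 0 k₀, segPot j ch.length (size ch j) := by
      refine Finset.sum_congr rfl fun j hj => ?_
      have hj' := Finset.mem_Ico.mp hj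
      rw [h3 j (by omega)]
      exact segPot_congr (by omega) (by omega)
    have e3 := segPot_last_le (le_refl (l + 1)) h5
    rw [e1, e2]; linarith
  rw [pot_eq_of_run (by omega) h, ← hk, Finset.sum_Ico_succ_top le_rfl, Finset.Ico_self,
    Finset.sum_empty, zero_add]
  rw [← hk] at e0
  generalize ∑ j ∈ Finset.range k₀, segPot j (k₀ + d + 2) (size ch j) = A at e0 ⊢
  have hp : (2 : ℝ) ^ (k₀ + d + 1) = 2 * 2 ^ (k₀ + d) := by ring
  have hX : (0 : ℝ) < 2 ^ (k₀ + d) := by positivity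
  have hlp : (2 : ℝ) ^ l ≤ 2 ^ (k₀ + d) := pow_le_pow_right₀ (by norm_num) (by omega)
  -- Segment l was underfull, so its old weighted deficit was at least 2^l, whereas `lastDef` is at
  -- most 256 * 2^l. The potential already stored for segment l therefore covers the new `lastDef`.
  have hlast : lastDef ch' ≤ 256 * (wt l * ((target l - size ch l : ℕ) : ℝ)) := by
    have h7 := (h l (by omega) (by omega)).2
    have h8 := wt_mul_def_ge h7
    have h9 := lastDef_le ch'
    rw [← hl] at h9
    linarith
  have hd : wt l * ((target l - size ch l : ℕ) : ℝ) ≤ deficit k₀ d ch := by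
    have := deficit_ge (k₀ := k₀) (d := d) (a := l - k₀) ch (by omega)
    rwa [show k₀ + (l - k₀) = l by omega] at this
  -- A nonempty source has the flat potential 128 * 2^(k₀+d+1), which pays for the flat term of the
  -- new last segment and for the surplus. If the source is empty, the deficits of the run have to
  -- pay for these as well.
  by_cases hs : size ch (k₀ + d + 1) = 0
  · have hpos := segPot_nonneg (k₀ + d + 1) (k₀ + d + 2) (size ch (k₀ + d + 1))
    have h7 := wt_mul_def_ge (h (k₀ + d) (by omega) le_rfl).2
    by_cases hld : l = k₀ + d
    · have h8 := h6 (by omega)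
      -- Nothing could be moved into segment k₀ + d, so it is still missing more than c(k₀ + d)
      -- items, and such a deficit is not counted.
      have h9 : lastDef ch' = 0 := by
        unfold lastDef
        rw [← hl, if_neg]
        have := (h l (by omega) (by omega)).2
        rw [hld] at this ⊢; omega
      rw [hld] at hd e0
      linarith
    -- Now l < k₀ + d, and two different segments pay separately: the deficit of l for `lastDef`,
    -- that of k₀ + d for the rest.
    · have h8 : wt l * ((target l - size ch l : ℕ) : ℝ) +
          wt (k₀ + d) * ((target (k₀ + d) - size ch (k₀ + d) : ℕ) : ℝ) ≤ deficit k₀ d ch := by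
        unfold deficit
        have := Finset.sum_le_sum_of_subset_of_nonneg
          (f := fun a => wt (k₀ + a) * ((target (k₀ + a) - size ch (k₀ + a) : ℕ) : ℝ))
          (s := {l - k₀, d}) (t := Finset.range (d + 1)) (by
            intro i hi
            simp only [Finset.mem_insert, Finset.mem_singleton] at hi
            rw [Finset.mem_range]; omega)
          (fun _ _ _ => mul_nonneg (wt_pos _).le (Nat.cast_nonneg _))
        rw [Finset.sum_pair (by omega)] at this
        simpa only [show k₀ + (l - k₀) = l by omega] using this
      linarith
  · have h7 := le_segPot_last (k := k₀ + d + 1) (n := k₀ + d + 2) le_rfl hs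
    linarith

end Chain

end

/-! ### Amortized cost of rebalancing a single chain -/

section

namespace Chain

variable {K : Type u} {V : Type v}

/-! ## Segment rebalancing -/

/-- No segment is overfull or underfull. -/
def Tidy (ch : Chain K V) : Prop := ∀ j < ch.length, ¬ Overfull ch j ∧ ¬ Underfull ch j

/-- The state of a chain before iteration `k` of segment rebalancing. -/
structure Ready (skipped : ℕ → Bool) (k : ℕ) (ch : Chain K V) : Prop where
  notOver : ∀ j, j + 1 < k → ¬ Overfull ch j
  top : 0 < k → Overfull ch (k - 1) → k < ch.length
  run : ∀ j < k, j < ch.length → Underfull ch j →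
    ∀ i, j ≤ i → i < k → i < ch.length ∧ Underfull ch i
  rest : ∀ j, k ≤ j → j < ch.length → skipped j = true → ¬ Overfull ch j ∧ ¬ Underfull ch j

/-- The number of underfull segments before segment `k`. -/
def underCount (ch : Chain K V) (k : ℕ) : ℕ :=
  ((Finset.range k).filter (fun j => j < ch.length ∧ Underfull ch j)).card

/-- The work of segment rebalancing before iteration `k` that is not paid yet. -/
noncomputable def debt (ch : Chain K V) (k : ℕ) : ℝ :=
  (if 0 < k ∧ Overfull ch (k - 1) then
    8192 * (wt (k - 1) * ((size ch (k - 1) - target (k - 1) : ℕ) : ℝ)) else 0) +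
    4 * (underCount ch k : ℝ)

theorem overfull_congr {ch ch' : Chain K V} {j : ℕ} (h : size ch' j = size ch j) :
    Overfull ch' j ↔ Overfull ch j := by
  unfold Overfull; rw [h]

theorem underfull_congr {ch ch' : Chain K V} {j : ℕ} (hl : ch'.length = ch.length)
    (h : size ch' j = size ch j) : Underfull ch' j ↔ Underfull ch j := by
  unfold Underfull IsLast; rw [h, hl]

theorem not_underfull_of_overfull {ch : Chain K V} {j : ℕ} (h : Overfull ch j) :
    ¬ Underfull ch j := by
  intro h'; have := h'.2; unfold Overfull at h; omega

theorem wt_mul_exc_ge {ch : Chain K V} {k : ℕ} (h : Overfull ch k) :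
    2 ^ k ≤ wt k * ((size ch k - target k : ℕ) : ℝ) := by
  rw [← wt_mul_cap]
  refine mul_le_mul_of_nonneg_left ?_ (wt_pos k).le
  unfold Overfull at h
  exact_mod_cast (by omega)

theorem underCount_eq_zero {ch : Chain K V} {k : ℕ}
    (h : ∀ j < k, j < ch.length → ¬ Underfull ch j) : underCount ch k = 0 := by
  unfold underCount
  rw [Finset.card_eq_zero, Finset.filter_eq_empty_iff]
  intro j hj h'
  exact h j (Finset.mem_range.mp hj) h'.1 h'.2

theorem underCount_le {ch : Chain K V} {k k₀ : ℕ} (h : ∀ j < k₀, ¬ Underfull ch j) :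
    underCount ch k ≤ k - k₀ := by
  unfold underCount
  rw [← Nat.card_Ico]
  refine Finset.card_le_card fun j hj => ?_
  rw [Finset.mem_filter, Finset.mem_range] at hj
  rw [Finset.mem_Ico]
  exact ⟨not_lt.mp fun h' => h j h' hj.2.2, hj.1⟩

theorem underCount_mono (ch : Chain K V) {k k' : ℕ} (h : k ≤ k') :
    underCount ch k ≤ underCount ch k' := by
  unfold underCount
  exact Finset.card_le_card (Finset.filter_subset_filter _ (by simpa using h))

theorem underCount_succ {ch : Chain K V} {k : ℕ} (hk : k < ch.length) (h : Underfull ch k) :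
    underCount ch (k + 1) = underCount ch k + 1 := by
  unfold underCount
  rw [Finset.range_add_one, Finset.filter_insert, if_pos ⟨hk, h⟩, Finset.card_insert_of_notMem]
  simp

theorem flatten_fillUsing {k : ℕ} {ch : Chain K V} (hk : k < ch.length) :
    List.flatten (fillUsing k ch).val = List.flatten ch := by
  unfold fillUsing
  split
  · rfl
  · rename_i k₀ h
    have := (List.find?_range_eq_some.mp h).2.1
    exact flatten_fill _ _ _ (by have := List.mem_range.mp this; omega)

/-- The first two parts of an iteration of segment rebalancing. -/
theorem overflow_fill {skipped : ℕ → Bool} {k : ℕ} {ch : Chain K V} (hk : k < ch.length)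
    (hR : Ready skipped k ch) :
    ∀ ch₁ ch₂ : Chain K V, ch₁ = (overflowStep k ch).val → ch₂ = (fillStep k ch₁).val →
    ∀ c : ℕ, c = cost (overflowStep k ch).log + cost (fillStep k ch₁).log →
    List.flatten ch₂ = List.flatten ch ∧
    ((ch₂.length ≤ k ∧ 1 ≤ ch₂.length ∧ Tidy ch₂ ∧ k + 1 = ch.length ∧
        c + pot ch₂ + debt ch k + 40 * 2 ^ k + lastDef ch₂ ≤ pot ch) ∨
      (ch₂.length = ch.length ∧ (∀ j < k, ¬ Overfull ch₂ j) ∧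
        (∀ j < k, Underfull ch₂ j → ∀ i, j ≤ i → i ≤ k → Underfull ch₂ i) ∧
        (∀ j, k < j → size ch₂ j = size ch j) ∧
        c + pot ch₂ + debt ch k ≤ pot ch +
          (if Overfull ch₂ k then wt k * ((size ch₂ k - target k : ℕ) : ℝ) else 0) +
          4 * (underCount ch₂ k : ℝ))) := by
  intro ch₁ ch₂ e₁ e₂ c hc
  by_cases hO : 0 < k ∧ Overfull ch (k - 1)
  · -- the preceding segment is overfull
    obtain ⟨k', rfl⟩ : ∃ k', k = k' + 1 := ⟨k - 1, by omega⟩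
    have hO' : Overfull ch k' := hO.2
    have hov : overflowStep (k' + 1) ch = shiftIn ch k' (size ch k' - target k') := by
      unfold overflowStep; rw [if_pos hO]; rfl
    rw [hov] at e₁ hc
    set q := size ch k' - target k' with hq
    have hOs : target k' + cap k' < size ch k' := hO'
    have hs : ∀ j, size ch₁ j = if j = k' then target k' else if j = k' + 1 then
        q + size ch (k' + 1) else size ch j := by
      intro j
      rw [e₁, size_shiftIn _ _ _ _ hk (by omega), show size ch k' - q = target k' by omega]
    have hl : ch₁.length = ch.length := by rw [e₁, shiftIn_length]
    -- Underfull segments before k' + 1 form a run that reaches k', and k' is overfull.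
    have hnu : ∀ j < k' + 1, ¬ Underfull ch j := fun j hj hu =>
      not_underfull_of_overfull hO' (hR.run j hj (by omega) hu k' (by omega) (by omega)).2
    have hnu₁ : ∀ j < k' + 1, ¬ Underfull ch₁ j := by
      intro j hj hu
      by_cases hjk : j = k'
      · have := hu.2; rw [hjk, hs, if_pos rfl] at this; omega
      · exact hnu j hj ((underfull_congr hl (by rw [hs, if_neg hjk, if_neg (by omega)])).mp hu)
    have hfs : fillStep (k' + 1) ch₁ = Costed.pure ch₁ := by
      unfold fillStep; rw [if_neg]
      rintro ⟨_, h, _⟩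
      exact hnu₁ k' (by omega) h
    rw [hfs] at e₂ hc
    have e₂ : ch₂ = ch₁ := e₂
    subst e₂
    refine ⟨by rw [e₁, flatten_shiftIn _ _ _ hk], Or.inr ⟨hl, ?_, ?_, ?_, ?_⟩⟩
    · intro j hj h
      by_cases hjk : j = k'
      · unfold Overfull at h; rw [hjk, hs, if_pos rfl] at h; omega
      · exact hR.notOver j (by omega)
          ((overfull_congr (by rw [hs, if_neg hjk, if_neg (by omega)])).mp h)
    · intro j hj h; exact absurd h (hnu₁ j hj)
    · intro j hj; rw [hs, if_neg (by omega), if_neg (by omega)]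
    · have hcost : (c : ℝ) = ((Nat.log 2 (size ch k') : ℕ) : ℝ) + 1 +
          (((Nat.log 2 (q + size ch (k' + 1)) : ℕ) : ℝ) + 1) := by
        rw [hc]
        simp [shiftIn, Prim.bound, size]
      have hdebt : debt ch (k' + 1) = 8192 * (wt k' * (q : ℝ)) := by
        unfold debt
        rw [if_pos hO, underCount_eq_zero (fun j hj _ => hnu j hj)]
        simp [hq]
      have hpot := sum_range_sub_of_two (f := fun k => segPot k ch.length (size ch₂ k))
        (g := fun k => segPot k ch.length (size ch k)) (n := ch.length) (j := k') hk
        (fun i h1 h2 => by simp only [hs, if_neg h1, if_neg h2])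
      have hp2 : pot ch₂ = ∑ k ∈ Finset.range ch.length, segPot k ch.length (size ch₂ k) := by
        unfold pot; rw [hl]
      rw [← hp2, show ∑ i ∈ Finset.range ch.length, segPot i ch.length (size ch i) = pot ch from rfl,
        hs, if_pos rfl, segPot_target _ _ hk, hs, if_neg (by omega), if_pos rfl] at hpot
      -- The shift releases `32768 * wt k' * q`. At most half of it reappears as excess in segment
      -- k' + 1; 8192 parts settle the debt, and the rest pays for split, join and the flat term,
      -- because `wt k' * q ≥ 2 ^ k'`.
      have h1 : 32768 * (wt k' * q) ≤ segPot k' ch.length (size ch k') := by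
        unfold segPot
        rw [if_pos hk]
        have := wt_pos k'
        have : 0 ≤ 256 * wt k' * ((target k' - size ch k' : ℕ) : ℝ) := by positivity
        linarith
      have h2 := segPot_add_le (k' + 1) ch.length (size ch (k' + 1)) q
      rw [add_comm (size ch (k' + 1)) q] at h2
      have h3 : wt (k' + 1) * (q : ℝ) ≤ wt k' * q / 2 := by
        have := mul_le_mul_of_nonneg_right (wt_succ_le k') (Nat.cast_nonneg (α := ℝ) q)
        linarith
      have h4 := wt_mul_exc_ge hO'
      rw [← hq] at h4
      have h5 := log_le_wt k' (size ch k')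
      have h6 : wt k' * ((size ch k' - 3 * cap k' : ℕ) : ℝ) ≤ wt k' * q := by
        refine mul_le_mul_of_nonneg_left ?_ (wt_pos k').le
        have : target k' = 2 * cap k' := rfl
        exact_mod_cast (by omega)
      have h7 := log_le_wt (k' + 1) (q + size ch (k' + 1))
      -- If the receiving segment is not overfull, it has no items beyond 3 c. If it is overfull,
      -- this part of the cost of the join is deferred to the next iteration, whose debt includes
      -- it.
      have h8 : wt (k' + 1) * ((q + size ch (k' + 1) - 3 * cap (k' + 1) : ℕ) : ℝ) ≤
          if Overfull ch₂ (k' + 1) then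
            wt (k' + 1) * ((size ch₂ (k' + 1) - target (k' + 1) : ℕ) : ℝ) else 0 := by
        have ht : target (k' + 1) = 2 * cap (k' + 1) := rfl
        have hs1 : size ch₂ (k' + 1) = q + size ch (k' + 1) := by
          rw [hs, if_neg (by omega), if_pos rfl]
        split_ifs with h
        · refine mul_le_mul_of_nonneg_left ?_ (wt_pos _).le
          rw [hs1]
          exact_mod_cast (by omega)
        · unfold Overfull at h
          rw [Nat.sub_eq_zero_of_le (by omega)]; simp
      have h9 : (0 : ℝ) ≤ 4 * (underCount ch₂ (k' + 1) : ℝ) := by positivity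
      have hp : (2 : ℝ) ^ (k' + 1) = 2 * 2 ^ k' := by ring
      rw [hcost, hdebt, hpot]
      have : (0 : ℝ) < 2 ^ k' := by positivity
      linarith
  · have hov : overflowStep k ch = Costed.pure ch := by
      unfold overflowStep; rw [if_neg hO]
    rw [hov] at e₁ hc
    have e₁ : ch₁ = ch := e₁
    subst e₁
    have hover : ∀ j < k, ¬ Overfull ch₁ j := by
      intro j hj h
      by_cases hjk : j + 1 < k
      · exact hR.notOver j hjk h
      · exact hO ⟨by omega, by rwa [show k - 1 = j by omega]⟩
    have hdebt : debt ch₁ k = 4 * (underCount ch₁ k : ℝ) := by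
      unfold debt; rw [if_neg hO, zero_add]
    by_cases hF : 0 < k ∧ Underfull ch₁ (k - 1) ∧ (cap k ≤ 2 * size ch₁ k ∨ IsLast ch₁ k)
    · -- the preceding segment is filled
      have hfs : fillStep k ch₁ = fillUsing k ch₁ := by unfold fillStep; rw [if_pos hF]
      have hex : ∃ j, Underfull ch₁ j := ⟨_, hF.2.1⟩
      obtain ⟨k₀, hk₀, hmin⟩ : ∃ k₀, Underfull ch₁ k₀ ∧ ∀ j < k₀, ¬ Underfull ch₁ j := by
        classical
        exact ⟨Nat.find hex, Nat.find_spec hex, fun j hj => Nat.find_min hex hj⟩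
      have hk₀k : k₀ ≤ k - 1 := not_lt.mp fun h => hmin _ h hF.2.1
      obtain ⟨d, rfl⟩ : ∃ d, k = k₀ + d + 1 := ⟨k - 1 - k₀, by omega⟩
      have hrun : ∀ a, k₀ ≤ a → a ≤ k₀ + d → Underfull ch₁ a := fun a h1 h2 =>
        (hR.run k₀ (by omega) (by omega) hk₀ a h1 (by omega)).2
      rw [hfs, fillUsing_of_underfull (by omega) hk₀ hmin,
        show k₀ + d + 1 - 1 - k₀ = d by omega] at e₂ hc
      have e₂ : ch₂ = (fill k₀ d ch₁).val := e₂
      have hcf := cost_fill k₀ d ch₁ hk (prefixLow_of_run hrun)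
      have hcn : c ≤ (d + 2) + ((Nat.log 2 (size ch₁ (k₀ + d + 1)) + 1) + 20 * 2 ^ (k₀ + d)) := by
        rw [hc, show k₀ + d + 1 - k₀ = d + 1 by omega]
        simp [Prim.bound]; omega
      have hcr : (c : ℝ) ≤ (d + 2) + ((((Nat.log 2 (size ch₁ (k₀ + d + 1)) : ℕ) : ℝ) + 1) +
          20 * 2 ^ (k₀ + d)) := by exact_mod_cast hcn
      have hd1 : (d : ℝ) + 1 ≤ 2 ^ (k₀ + d) := by
        have h1 : d + 1 ≤ 2 ^ d := Nat.lt_two_pow_self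
        have h2 : 2 ^ d ≤ 2 ^ (k₀ + d) := Nat.pow_le_pow_right (by norm_num) (by omega)
        exact_mod_cast h1.trans h2
      have huc : (underCount ch₁ (k₀ + d + 1) : ℝ) ≤ d + 1 := by
        have := underCount_le (k := k₀ + d + 1) hmin
        exact_mod_cast (by omega : underCount ch₁ (k₀ + d + 1) ≤ d + 1)
      have hp : (2 : ℝ) ^ (k₀ + d + 1) = 2 * 2 ^ (k₀ + d) := by ring
      have hpos : (1 : ℝ) ≤ 2 ^ (k₀ + d) := one_le_pow₀ (by norm_num)
      have hneed := need_le k₀ d ch₁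
      refine ⟨by rw [e₂, flatten_fill _ _ _ hk], ?_⟩
      by_cases hE : need k₀ d ch₁ < size ch₁ (k₀ + d + 1) ∨
          (need k₀ d ch₁ ≤ size ch₁ (k₀ + d + 1) ∧ k₀ + d + 2 < ch₁.length)
      · right
        obtain ⟨hl, hs⟩ := fill_of_enough k₀ d ch₁ hk (prefixLow_of_run hrun) hE
        have hpot := pot_fill_of_enough hk hrun hE
        rw [← e₂] at hl hs hpot
        have htar : ∀ j, k₀ ≤ j → j < k₀ + d + 1 → size ch₂ j = target j := fun j h1 h2 => by
          rw [hs, if_pos (by omega)]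
        have hlow : ∀ j < k₀, size ch₂ j = size ch₁ j := fun j h1 => by
          rw [hs, if_neg (by omega), if_neg (by omega)]
        refine ⟨hl, ?_, ?_, ?_, ?_⟩
        · intro j hj h
          by_cases hjk : j < k₀
          · exact hover j hj ((overfull_congr (hlow j hjk)).mp h)
          · unfold Overfull at h; rw [htar j (by omega) hj] at h; omega
        · intro j hj h
          exfalso
          by_cases hjk : j < k₀
          · exact hmin j hjk ((underfull_congr hl (hlow j hjk)).mp h)
          · have := h.2; rw [htar j (by omega) hj] at this; omega
        · intro j hj; rw [hs, if_neg (by omega), if_neg (by omega)]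
        · have hsk : size ch₂ (k₀ + d + 1) = size ch₁ (k₀ + d + 1) - need k₀ d ch₁ := by
            rw [hs, if_neg (by omega), if_pos rfl]
          have h1 := log_le_wt (k₀ + d + 1) (size ch₁ (k₀ + d + 1))
          have h2 := wt_mul_need_le k₀ d ch₁
          -- Items of the source beyond 3 c either remain as excess, whose charge is deferred, or
          -- were among the `need` items moved out, whose charge the released deficit bears.
          have h3 : wt (k₀ + d + 1) * ((size ch₁ (k₀ + d + 1) - 3 * cap (k₀ + d + 1) : ℕ) : ℝ) ≤
              (if Overfull ch₂ (k₀ + d + 1) then wt (k₀ + d + 1) *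
                ((size ch₂ (k₀ + d + 1) - target (k₀ + d + 1) : ℕ) : ℝ) else 0) +
              wt (k₀ + d + 1) * (need k₀ d ch₁ : ℝ) := by
            have ht : target (k₀ + d + 1) = 2 * cap (k₀ + d + 1) := rfl
            split_ifs with h
            · rw [← mul_add]
              refine mul_le_mul_of_nonneg_left ?_ (wt_pos _).le
              exact_mod_cast (by omega)
            · unfold Overfull at h
              rw [zero_add]
              refine mul_le_mul_of_nonneg_left ?_ (wt_pos _).le
              exact_mod_cast (by omega)
          have h4 := (wt_mul_def_ge (hrun (k₀ + d) (by omega) le_rfl).2).trans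
            (deficit_ge ch₁ le_rfl)
          have h5 : (0 : ℝ) ≤ 4 * (underCount ch₂ (k₀ + d + 1) : ℝ) := by positivity
          rw [hdebt]
          linarith
      · left
        -- A source that is not last has at least c / 2 items by the condition of the fill step, and
        -- by `need_le` that suffices. Only the last segment can run out.
        have hlast : k₀ + d + 2 = ch₁.length := by
          by_contra hne
          apply hE
          right
          rcases hF.2.2 with h | h
          · exact ⟨by omega, by omega⟩
          · exact absurd h hne
        have hn : size ch₁ (k₀ + d + 1) ≤ need k₀ d ch₁ := by
          by_contra h; exact hE (Or.inl (by omega))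
        obtain ⟨a1, a2, a3, a4, a5, -⟩ :=
          fill_of_exhausted k₀ d ch₁ hlast (prefixLow_of_run hrun) hn
        have hpot := pot_fill_of_exhausted hlast hrun hn
        rw [← e₂] at a1 a2 a3 a4 a5 hpot
        refine ⟨a2, by omega, ?_, by omega, ?_⟩
        · intro j hj
          unfold Overfull Underfull IsLast
          by_cases hjk : j < k₀
          · have h1 := hover j (by omega)
            have h2 := hmin j hjk
            unfold Overfull at h1
            unfold Underfull IsLast at h2
            rw [a3 j hjk]; omega
          · by_cases hjl : j + 1 < ch₂.length
            · rw [a4 j (by omega) hjl]; omega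
            · rw [show ch₂.length - 1 = j by omega] at a5; omega
        · have h1 : ((Nat.log 2 (size ch₁ (k₀ + d + 1)) : ℕ) : ℝ) + 1 ≤ 5 * 2 ^ (k₀ + d + 1) := by
            exact_mod_cast log_four_cap (k := k₀ + d + 1) (by omega)
          rw [hdebt]
          linarith
    · have hfs : fillStep k ch₁ = Costed.pure ch₁ := by unfold fillStep; rw [if_neg hF]
      rw [hfs] at e₂ hc
      have e₂ : ch₂ = ch₁ := e₂
      subst e₂
      refine ⟨rfl, Or.inr ⟨rfl, hover, ?_, fun _ _ => rfl, ?_⟩⟩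
      · intro j hj h i hji hik
        have hr := hR.run j hj (by omega) h
        by_cases hi : i < k
        · exact (hr i hji hi).2
        · have hik : i = k := by omega
          subst hik
          have h1 := (hr (i - 1) (by omega) (by omega)).2
          -- Segment i - 1 is underfull and yet was not filled, so segment i is not last and has
          -- fewer than c(i) / 2 items: it is underfull too and continues the run.
          have h2 : ¬ (cap i ≤ 2 * size ch₂ i ∨ IsLast ch₂ i) := fun h => hF ⟨by omega, h1, h⟩
          push Not at h2
          refine ⟨h2.2, ?_⟩
          have : target i = 2 * cap i := rfl
          omega
      · have h1 : 0 ≤ if Overfull ch₂ k then wt k * ((size ch₂ k - target k : ℕ) : ℝ) else 0 := by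
          have := wt_pos k
          split_ifs <;> positivity
        rw [hdebt, hc]
        simp
        linarith

/-- The credit left after a change of the length of a chain from `n` to `n'`. -/
noncomputable def lengthCredit (n n' : ℕ) (x : ℝ) : ℝ :=
  if n < n' then 1024 * 2 ^ n' else if n' < n then 20 * 2 ^ n + x else 0

theorem lengthCredit_of_lt {n n' : ℕ} (h : n < n') (x : ℝ) :
    lengthCredit n n' x = 1024 * 2 ^ n' := if_pos h

theorem lengthCredit_of_gt {n n' : ℕ} (h : n' < n) (x : ℝ) :
    lengthCredit n n' x = 20 * 2 ^ n + x := by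
  unfold lengthCredit; rw [if_neg (by omega), if_pos h]

theorem lengthCredit_self (n : ℕ) (x : ℝ) : lengthCredit n n x = 0 := by
  simp [lengthCredit]

/-- The number of sections from `S[k]` on that are not skipped. -/
def unskipped (skipped : ℕ → Bool) (E k : ℕ) : ℕ :=
  ((Finset.range E).filter (fun j => k ≤ j ∧ skipped j = false)).card

theorem unskipped_antitone (skipped : ℕ → Bool) (E : ℕ) {k k' : ℕ} (h : k ≤ k') :
    unskipped skipped E k' ≤ unskipped skipped E k := by
  unfold unskipped
  refine Finset.card_le_card fun j hj => ?_
  rw [Finset.mem_filter] at *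
  exact ⟨hj.1, h.trans hj.2.1, hj.2.2⟩

theorem unskipped_succ {skipped : ℕ → Bool} {E k : ℕ} (hk : k < E) (h : skipped k = false) :
    unskipped skipped E (k + 1) + 1 ≤ unskipped skipped E k := by
  unfold unskipped
  have : insert k ((Finset.range E).filter (fun j => k + 1 ≤ j ∧ skipped j = false)) ⊆
      (Finset.range E).filter (fun j => k ≤ j ∧ skipped j = false) := by
    intro j hj
    rw [Finset.mem_insert, Finset.mem_filter] at hj
    rw [Finset.mem_filter, Finset.mem_range]
    rcases hj with rfl | hj
    · exact ⟨hk, le_rfl, h⟩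
    · exact ⟨Finset.mem_range.mp hj.1, by omega, hj.2.2⟩
  have h2 := Finset.card_le_card this
  rwa [Finset.card_insert_of_notMem (by simp)] at h2

/-- A run of underfull segments that reached the end would contain the last segment, which is never
underfull by definition. So no debt is left at the end. -/
theorem Ready.done {skipped : ℕ → Bool} {k : ℕ} {ch : Chain K V} (hR : Ready skipped k ch)
    (hk : ch.length ≤ k) : Tidy ch ∧ debt ch k = 0 := by
  have hu : ∀ j < k, j < ch.length → ¬ Underfull ch j := by
    intro j hj hjl hu
    have := hR.run j hj hjl hu (ch.length - 1) (by omega) (by omega)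
    exact this.2.1 (by unfold IsLast; omega)
  have ho : ∀ j < k, ¬ Overfull ch j := by
    intro j hj h
    by_cases hjk : j + 1 < k
    · exact hR.notOver j hjk h
    · have := hR.top (by omega) (by rwa [show k - 1 = j by omega]); omega
  refine ⟨fun j hj => ⟨ho j (by omega), hu j (by omega) hj⟩, ?_⟩
  unfold debt
  rw [if_neg, underCount_eq_zero hu]
  · simp
  · rintro ⟨h1, h2⟩; exact ho _ (by omega) h2

/-- Apart from its shifts, an iteration costs 2 units. At an overfull segment they are deferred to
the shift of the next iteration, at an underfull one to the fill that ends its run; at a balanced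
section that was executed they are charged to `unskipped`. A balanced skipped section ends its slab,
which can happen once per slab: hence the summands 2 and `if k < m then 2 else 0`. The number `M`
bounds both the length and the number of items, so `M < k + f` keeps the iteration bound from taking
effect. -/
theorem rebalanceSegments_spec {m : ℕ} {skipped : ℕ → Bool} {E : ℕ}
    (hs1 : ∀ k < m, skipped k = true → ∀ j, k ≤ j → j < m → skipped j = true)
    (hs2 : ∀ k, m ≤ k → skipped k = true → ∀ j, k ≤ j → skipped j = true)
    (hE : ∀ j, E ≤ j → skipped j = true) :
    ∀ (f k M : ℕ) (ch : Chain K V), ch.length ≤ M → (List.flatten ch).length ≤ M → M < k + f →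
      1 ≤ ch.length → Ready skipped k ch →
      ∀ r, r = rebalanceSegments m skipped f k ch →
      List.flatten r.val = List.flatten ch ∧ 1 ≤ r.val.length ∧ Tidy r.val ∧
      cost r.log + pot r.val + lengthCredit ch.length r.val.length (lastDef r.val) + debt ch k ≤
        pot ch + 2 + (if k < m then 2 else 0) + 2 * (unskipped skipped E k : ℝ) := by
  have done_of_balanced : ∀ (k : ℕ) (ch : Chain K V), 1 ≤ ch.length → Tidy ch → debt ch k = 0 →
      List.flatten ch = List.flatten ch ∧ 1 ≤ ch.length ∧ Tidy ch ∧
      cost [] + pot ch + lengthCredit ch.length ch.length (lastDef ch) + debt ch k ≤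
        pot ch + 2 + (if k < m then 2 else 0) + 2 * (unskipped skipped E k : ℝ) := by
    intro k ch h1 h2 h3
    refine ⟨rfl, h1, h2, ?_⟩
    rw [lengthCredit_self, h3]
    have : (0 : ℝ) ≤ 2 * (unskipped skipped E k : ℝ) := by positivity
    split_ifs <;> simp <;> linarith
  intro f
  induction f with
  | zero =>
    intro k M ch hM hN hf hl hR r hr
    obtain ⟨h1, h2⟩ := hR.done (by omega)
    subst hr
    exact done_of_balanced k ch hl h1 h2
  | succ f ih =>
    intro k M ch hM hN hf hl hR r hr
    by_cases hk : ch.length ≤ k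
    · obtain ⟨h1, h2⟩ := hR.done hk
      have : r = Costed.pure ch := by rw [hr, rebalanceSegments, if_pos hk]
      subst this
      exact done_of_balanced k ch hl h1 h2
    · obtain ⟨ch₁, e₁⟩ : ∃ ch₁, ch₁ = (overflowStep k ch).val := ⟨_, rfl⟩
      obtain ⟨ch₂, e₂⟩ : ∃ ch₂, ch₂ = (fillStep k ch₁).val := ⟨_, rfl⟩
      obtain ⟨c, hc⟩ : ∃ c, c = cost (overflowStep k ch).log + cost (fillStep k ch₁).log :=
        ⟨_, rfl⟩
      obtain ⟨ch₃, e₃⟩ : ∃ ch₃, ch₃ = growStep k ch₂ := ⟨_, rfl⟩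
      obtain ⟨r', hr'⟩ : ∃ r' : Costed (Chain K V), r' = if ch₃.length ≤ k then .pure ch₃
          else if ¬ Overfull ch₃ k ∧ ¬ Underfull ch₃ k ∧ skipped k = true then
            (if k < m then rebalanceSegments m skipped f m ch₃ else .pure ch₃)
          else rebalanceSegments m skipped f (k + 1) ch₃ := ⟨_, rfl⟩
      have hrv : r.val = r'.val := by
        rw [hr, hr', e₃, e₂, e₁, rebalanceSegments, if_neg hk]; rfl
      have hrc : (cost r.log : ℝ) = 2 + c + cost r'.log := by
        have : cost r.log = 2 + c + cost r'.log := by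
          rw [hr, hr', hc, e₃, e₂, e₁, rebalanceSegments, if_neg hk]
          simp [Prim.bound]; ring
        exact_mod_cast this
      rw [hrv, hrc]
      obtain ⟨hflat, hcase⟩ := overflow_fill (by omega) hR ch₁ ch₂ e₁ e₂ c hc
      have hne0 : (0 : ℝ) ≤ 2 * (unskipped skipped E k : ℝ) := by positivity
      rcases hcase with ⟨a1, a2, a3, a4, a5⟩ | ⟨a1, a2, a3, a4, a5⟩
      · have hg : ch₃ = ch₂ := by
          rw [e₃, growStep, if_neg]
          rintro ⟨_, h⟩; unfold IsLast at h; omega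
        rw [hg, if_pos a1] at hr'
        subst hr'
        refine ⟨hflat, a2, a3, ?_⟩
        simp only [Costed.pure_val, Costed.pure_log, cost_nil]
        -- The old length is k + 1, so the surplus 40 * 2^k is exactly the credit 20 * 2^(k+1).
        rw [lengthCredit_of_gt (by omega), ← a4, pow_succ]
        have : (0 : ℝ) ≤ if k < m then 2 else 0 := by split_ifs <;> norm_num
        push_cast
        linarith
      · by_cases hg : Overfull ch₂ k ∧ IsLast ch₂ k
        · have e3 : ch₃ = ch₂ ++ List.replicate 1 [] := by rw [e₃, growStep, if_pos hg]; rfl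
          have hsz : ∀ j, size ch₃ j = size ch₂ j := fun j => by rw [e3, size_append_nil]
          have hlast : k + 1 = ch₂.length := hg.2
          have hlen : ch₃.length = ch₂.length + 1 := by rw [e3]; simp
          have hflat3 : List.flatten ch₃ = List.flatten ch₂ := by rw [e3, flatten_append_nil]
          have hov : Overfull ch₃ k := (overfull_congr (hsz k)).mpr hg.1
          have hnu : ∀ j ≤ k, ¬ Underfull ch₃ j := by
            intro j hj hu
            by_cases hjk : j = k
            · subst hjk; exact not_underfull_of_overfull hov hu
            · have hu2 : Underfull ch₂ j := by
                refine ⟨by unfold IsLast; omega, ?_⟩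
                have := hu.2; rwa [hsz] at this
              exact not_underfull_of_overfull hg.1 (a3 j (by omega) hu2 k (by omega) le_rfl)
          rw [if_neg (by omega), if_neg (by tauto)] at hr'
          -- The new segment is empty and has no potential; segment k gives up the flat term and,
          -- being overfull, has no deficit term.
          have hpotle : pot ch₃ ≤ pot ch₂ := by
            unfold pot
            rw [hlen, Finset.sum_range_succ, ← hlast, Finset.sum_range_succ, Finset.sum_range_succ]
            have e1 : ∑ x ∈ Finset.range k, segPot x (k + 1 + 1) (size ch₃ x) =
                ∑ x ∈ Finset.range k, segPot x (k + 1) (size ch₂ x) := by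
              refine Finset.sum_congr rfl fun x hx => ?_
              have := Finset.mem_range.mp hx
              rw [hsz]; exact segPot_congr (by omega) (by omega)
            have e2 : size ch₃ (k + 1) = 0 := by
              rw [hsz]; exact size_of_length_le (by omega)
            have e3 : segPot k (k + 1 + 1) (size ch₃ k) ≤ segPot k (k + 1) (size ch₂ k) := by
              have h1 : target k + cap k < size ch₂ k := hg.1
              rw [hsz]
              unfold segPot
              rw [if_pos (by omega), if_neg (by omega), Nat.sub_eq_zero_of_le (by omega : target k ≤ _)]
              split_ifs <;> simp
            rw [e1, e2, segPot_zero_last _ _ (by omega)]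
            linarith
          have hR3 : Ready skipped (k + 1) ch₃ := by
            refine ⟨?_, ?_, ?_, ?_⟩
            · intro j hj h
              exact a2 j (by omega) ((overfull_congr (hsz j)).mp h)
            · intro _ _; omega
            · intro j hj _ hu; exact absurd hu (hnu j (by omega))
            · intro j hj hjl _
              have : size ch₃ j = 0 := by rw [hsz]; exact size_of_length_le (by omega)
              unfold Overfull Underfull IsLast
              omega
          have hN3 : (List.flatten ch₃).length ≤ M := by rw [hflat3, hflat]; exact hN
          -- The overfull segment alone has more than k + 2 items, which is the new length, so
          -- growth stays within the bound.
          have hM3 : ch₃.length ≤ M := by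
            have h1 : target k + cap k < size ch₂ k := hg.1
            have h2 := size_le_length_flatten ch₃ k
            rw [hsz] at h2
            have := lt_cap k
            omega
          obtain ⟨b1, b2, b3, b4⟩ := ih (k + 1) M ch₃ hM3 hN3 (by omega) (by omega) hR3 r' hr'
          refine ⟨by rw [b1, hflat3, hflat], b2, b3, ?_⟩
          have hdebt : debt ch₃ (k + 1) ≥ 8192 * (wt k * ((size ch₂ k - target k : ℕ) : ℝ)) := by
            unfold debt
            rw [if_pos ⟨by omega, hov⟩, Nat.add_sub_cancel, hsz]
            have : (0 : ℝ) ≤ 4 * (underCount ch₃ (k + 1) : ℝ) := by positivity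
            linarith
          have huc : underCount ch₂ k = 0 := underCount_eq_zero fun j hj _ hu =>
            not_underfull_of_overfull hg.1 (a3 j hj hu k (by omega) le_rfl)
          have hexc := wt_mul_exc_ge hg.1
          rw [if_pos hg.1, huc] at a5
          -- Growing to length k + 2 requires a credit of 1024 * 2^(k+2) = 4096 * 2^k, and at most
          -- this much more is needed if the chain shrinks again later. The debt term of the
          -- overfull segment, at least 8192 * 2^k, provides it.
          have hcr : lengthCredit ch.length r'.val.length (lastDef r'.val) ≤
              lengthCredit ch₃.length r'.val.length (lastDef r'.val) + 4096 * 2 ^ k := by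
            have h2 : (2 : ℝ) ^ (k + 2) = 4 * 2 ^ k := by ring
            have h3 : (2 : ℝ) ^ (k + 1) = 2 * 2 ^ k := by ring
            have h4 : (0 : ℝ) < 2 ^ k := by positivity
            have h5 := lastDef_nonneg r'.val
            rw [show ch₃.length = k + 2 by omega, show ch.length = k + 1 by omega]
            rcases lt_trichotomy r'.val.length (k + 2) with h6 | h6 | h6
            · rw [lengthCredit_of_gt h6, h2]
              rcases Nat.lt_or_ge r'.val.length (k + 1) with h7 | h7
              · rw [lengthCredit_of_gt h7, h3]; linarith
              · rw [show r'.val.length = k + 1 by omega, lengthCredit_self]; linarith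
            · rw [h6, lengthCredit_self, lengthCredit_of_lt (by omega), h2]; linarith
            · rw [lengthCredit_of_lt h6, lengthCredit_of_lt (by omega)]; linarith
          have h1 : (1 : ℝ) ≤ 2 ^ k := one_le_pow₀ (by norm_num)
          have h2 : (if k + 1 < m then (2 : ℝ) else 0) ≤ if k < m then 2 else 0 := by
            split_ifs <;> first | omega | norm_num
          have h3 : (unskipped skipped E (k + 1) : ℝ) ≤ unskipped skipped E k := by
            exact_mod_cast unskipped_antitone skipped E (by omega)
          push_cast at a5 ⊢
          linarith
        · have e3 : ch₃ = ch₂ := by rw [e₃, growStep, if_neg hg]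
          rw [e3, if_neg (by omega)] at hr'
          by_cases hsk : ¬ Overfull ch₂ k ∧ ¬ Underfull ch₂ k ∧ skipped k = true
          · rw [if_pos hsk] at hr'
            obtain ⟨s1, s2, s3⟩ := hsk
            have hnu : ∀ j ≤ k, ¬ Underfull ch₂ j := by
              intro j hj hu
              by_cases hjk : j = k
              · exact s2 (hjk ▸ hu)
              · exact s2 (a3 j (by omega) hu k (by omega) le_rfl)
            have hno : ∀ j ≤ k, ¬ Overfull ch₂ j := by
              intro j hj hu
              by_cases hjk : j = k
              · exact s1 (hjk ▸ hu)
              · exact a2 j (by omega) hu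
            have hrest : ∀ j, k < j → j < ch₂.length → skipped j = true →
                ¬ Overfull ch₂ j ∧ ¬ Underfull ch₂ j := by
              intro j hj hjl hsj
              have := hR.rest j hj.le (by omega) hsj
              rwa [overfull_congr (a4 j hj), underfull_congr a1 (a4 j hj)]
            have huc : underCount ch₂ k = 0 := underCount_eq_zero fun j hj _ => hnu j hj.le
            rw [if_neg s1, huc] at a5
            by_cases hkm : k < m
            · rw [if_pos hkm] at hr'
              -- The skipped sections of a slab form a final stretch of it, so beyond k everything
              -- up to m is balanced, and the jump to m incurs no debt.
              have hall : ∀ j < m, j < ch₂.length → ¬ Overfull ch₂ j ∧ ¬ Underfull ch₂ j := by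
                intro j hj hjl
                by_cases hjk : j ≤ k
                · exact ⟨hno j hjk, hnu j hjk⟩
                · exact hrest j (by omega) hjl (hs1 k hkm s3 j (by omega) hj)
              have hov : ∀ j < m, ¬ Overfull ch₂ j := by
                intro j hj h
                by_cases hjl : j < ch₂.length
                · exact (hall j hj hjl).1 h
                · unfold Overfull at h; rw [size_of_length_le (by omega)] at h; omega
              have hR3 : Ready skipped m ch₂ := by
                refine ⟨fun j hj => hov j (by omega), fun h1 h2 => absurd h2 (hov _ (by omega)),
                  fun j hj hjl hu => absurd hu (hall j hj hjl).2, fun j hj hjl hsj =>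
                    hrest j (by omega) hjl hsj⟩
              have hd0 : debt ch₂ m = 0 := by
                unfold debt
                rw [if_neg (by rintro ⟨h1, h2⟩; exact hov _ (by omega) h2),
                  underCount_eq_zero fun j hj hjl => (hall j hj hjl).2]
                simp
              obtain ⟨b1, b2, b3, b4⟩ := ih m M ch₂ (by omega) (by rw [hflat]; exact hN) (by omega)
                (by omega) hR3 r' hr'
              refine ⟨by rw [b1, hflat], b2, b3, ?_⟩
              rw [a1, hd0, if_neg (lt_irrefl _)] at b4
              have h3 : (unskipped skipped E m : ℝ) ≤ unskipped skipped E k := by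
                exact_mod_cast unskipped_antitone skipped E hkm.le
              rw [if_pos hkm]
              push_cast at a5 ⊢
              linarith
            · rw [if_neg hkm] at hr'
              subst hr'
              refine ⟨hflat, by simp only [Costed.pure_val]; omega, ?_, ?_⟩
              · intro j hj
                by_cases hjk : j ≤ k
                · exact ⟨hno j hjk, hnu j hjk⟩
                · exact hrest j (by omega) hj (hs2 k (by omega) s3 j (by omega))
              · simp only [Costed.pure_val, Costed.pure_log, cost_nil]
                rw [a1, lengthCredit_self, if_neg hkm]
                push_cast at a5 ⊢
                linarith
          · rw [if_neg hsk] at hr'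
            have hR3 : Ready skipped (k + 1) ch₂ := by
              refine ⟨fun j hj => a2 j (by omega), ?_, ?_, ?_⟩
              · intro _ h
                by_contra hlt
                exact hg ⟨h, by unfold IsLast; omega⟩
              · intro j hj hjl hu i hji hi
                by_cases hjk : j = k
                · have : i = j := by omega
                  subst this; exact ⟨hjl, hu⟩
                · exact ⟨by omega, a3 j (by omega) hu i hji (by omega)⟩
              · intro j hj hjl hsj
                have := hR.rest j (by omega) (by omega) hsj
                rwa [overfull_congr (a4 j (by omega)), underfull_congr a1 (a4 j (by omega))]
            obtain ⟨b1, b2, b3, b4⟩ := ih (k + 1) M ch₂ (by omega) (by rw [hflat]; exact hN)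
              (by omega) (by omega) hR3 r' hr'
            refine ⟨by rw [b1, hflat], b2, b3, ?_⟩
            rw [a1] at b4
            have h2 : (if k + 1 < m then (2 : ℝ) else 0) ≤ if k < m then 2 else 0 := by
              split_ifs <;> first | omega | norm_num
            have h3 : (unskipped skipped E (k + 1) : ℝ) ≤ unskipped skipped E k := by
              exact_mod_cast unskipped_antitone skipped E (by omega)
            have key : 2 + (if Overfull ch₂ k then wt k * ((size ch₂ k - target k : ℕ) : ℝ) else 0) +
                4 * (underCount ch₂ k : ℝ) + 2 * (unskipped skipped E (k + 1) : ℝ) ≤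
                debt ch₂ (k + 1) + 2 * (unskipped skipped E k : ℝ) := by
              have hmono : (underCount ch₂ k : ℝ) ≤ underCount ch₂ (k + 1) := by
                exact_mod_cast underCount_mono ch₂ (by omega)
              unfold debt
              rw [Nat.add_sub_cancel]
              by_cases ho : Overfull ch₂ k
              · rw [if_pos ho, if_pos ⟨by omega, ho⟩]
                have := wt_mul_exc_ge ho
                have h1 : (1 : ℝ) ≤ 2 ^ k := one_le_pow₀ (by norm_num)
                linarith
              · rw [if_neg ho, if_neg (by tauto)]
                by_cases hu : Underfull ch₂ k
                · rw [underCount_succ (by omega) hu]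
                  push_cast; linarith
                · have hsk' : skipped k = false := by
                    by_contra h
                    exact hsk ⟨ho, hu, by simpa using h⟩
                  have hkE : k < E := by
                    by_contra h
                    rw [hE k (by omega)] at hsk'; cases hsk'
                  have huc : underCount ch₂ k = 0 := underCount_eq_zero fun j hj _ h =>
                    hu (a3 j hj h k (by omega) le_rfl)
                  have h5 : (unskipped skipped E (k + 1) : ℝ) + 1 ≤ unskipped skipped E k := by
                    exact_mod_cast unskipped_succ hkE hsk'
                  have h6 : (0 : ℝ) ≤ 4 * (underCount ch₂ (k + 1) : ℝ) := by positivity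
                  rw [huc]; push_cast; linarith
            linarith

end Chain

end

/-! ### Transfers from the longer chain to the shorter one -/

section

theorem segPot_last_le_nonlast {k n n' s : ℕ} (h : n ≤ k + 1) (h' : k + 1 < n') :
    segPot k n s ≤ segPot k n' s + 128 * 2 ^ k := by
  have := wt_pos k
  have h1 : 0 ≤ 256 * wt k * ((target k - s : ℕ) : ℝ) := by positivity
  have h2 : (0 : ℝ) < 2 ^ k := by positivity
  unfold segPot
  rw [if_neg (show ¬ k + 1 < n by omega), if_pos h']
  split_ifs <;> linarith

theorem segPot_nonlast_le {k n n' s : ℕ} (h : n ≤ k + 1) (h' : k + 1 < n') :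
    segPot k n' s ≤ segPot k n s + 256 * wt k * ((target k - s : ℕ) : ℝ) := by
  have h2 : (0 : ℝ) < 2 ^ k := by positivity
  unfold segPot
  rw [if_neg (show ¬ k + 1 < n by omega), if_pos h']
  split_ifs <;> linarith

theorem wt_mul_target (k : ℕ) : wt k * target k = 2 * 2 ^ k := by
  have := wt_mul_cap k
  have h : (target k : ℝ) = 2 * cap k := by unfold target; push_cast; ring
  rw [h, ← this]; ring

theorem segPot_last_mono {k n s s' : ℕ} (h : n ≤ k + 1) (hs : s ≤ s') :
    segPot k n s ≤ segPot k n s' := by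
  have hw := wt_pos k
  have h1 : ((s - target k : ℕ) : ℝ) ≤ ((s' - target k : ℕ) : ℝ) := by
    exact_mod_cast (by omega : s - target k ≤ s' - target k)
  have h2 : (0 : ℝ) < 2 ^ k := by positivity
  unfold segPot
  rw [if_neg (show ¬ k + 1 < n by omega), if_neg (show ¬ k + 1 < n by omega)]
  have h3 := mul_le_mul_of_nonneg_left h1 hw.le
  split_ifs <;> first | omega | linarith

namespace Chain

variable {K : Type u} {V : Type v}

/-! ## Chain rebalancing -/

/-- Segment k - 1 becomes the last one and may acquire the flat term 128 * 2^(k-1). -/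
theorem pot_take_le {ch : Chain K V} {k : ℕ} (hk : ch.length = k + 1) (h1 : 1 ≤ k) :
    pot (List.take k ch) + segPot k (k + 1) (size ch k) ≤ pot ch + 64 * 2 ^ k := by
  obtain ⟨j, rfl⟩ : ∃ j, k = j + 1 := ⟨k - 1, by omega⟩
  have hl : (List.take (j + 1) ch).length = j + 1 := by rw [List.length_take]; omega
  unfold pot
  rw [hl, hk, Finset.sum_range_succ _ (j + 1), Finset.sum_range_succ, Finset.sum_range_succ]
  have e1 : ∑ x ∈ Finset.range j, segPot x (j + 1) (size (List.take (j + 1) ch) x) =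
      ∑ x ∈ Finset.range j, segPot x (j + 1 + 1) (size ch x) := by
    refine Finset.sum_congr rfl fun x hx => ?_
    have := Finset.mem_range.mp hx
    rw [size_take, if_pos (by omega)]
    exact segPot_congr (by omega) (by omega)
  have e2 := segPot_last_le_nonlast (k := j) (n := j + 1) (n' := j + 1 + 1) (s := size ch j)
    le_rfl (by omega)
  rw [e1, size_take, if_pos (by omega), pow_succ]
  linarith

theorem pot_set_nil {ch : Chain K V} {k : ℕ} (hk : ch.length = k + 1) :
    pot (List.set ch k []) + segPot k (k + 1) (size ch k) = pot ch := by
  unfold pot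
  rw [List.length_set, hk, Finset.sum_range_succ, Finset.sum_range_succ]
  have e1 : ∑ x ∈ Finset.range k, segPot x (k + 1) (size (List.set ch k []) x) =
      ∑ x ∈ Finset.range k, segPot x (k + 1) (size ch x) := by
    refine Finset.sum_congr rfl fun x hx => ?_
    have := Finset.mem_range.mp hx
    rw [size_set _ _ _ _ (by omega), if_neg (by omega)]
  rw [e1, size_set _ _ _ _ (by omega), if_pos rfl, List.length_nil, segPot_zero_last _ _ le_rfl]
  ring

theorem Tidy.take {ch : Chain K V} (h : Tidy ch) (k : ℕ) : Tidy (List.take k ch) := by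
  intro j hj
  rw [List.length_take] at hj
  have := h j (by omega)
  unfold Overfull Underfull IsLast at *
  rw [size_take, if_pos (by omega), List.length_take]
  omega

theorem Tidy.set_nil {ch : Chain K V} {k : ℕ} (h : Tidy ch) (hk : ch.length = k + 1) :
    Tidy (List.set ch k []) := by
  intro j hj
  rw [List.length_set] at hj
  have := h j (by omega)
  unfold Overfull Underfull IsLast at *
  rw [size_set _ _ _ _ (by omega), List.length_set]
  split_ifs with h1
  · simp only [List.length_nil]; omega
  · exact this

theorem tidy_congr {ch ch' : Chain K V} (hl : ch'.length = ch.length)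
    (h : ∀ j < ch.length, size ch' j = size ch j) (ht : Tidy ch) : Tidy ch' := by
  intro j hj
  rw [overfull_congr (h j (by omega)), underfull_congr hl (h j (by omega))]
  exact ht j (by omega)

theorem pot_congr {ch ch' : Chain K V} (hl : ch'.length = ch.length)
    (h : ∀ j < ch.length, size ch' j = size ch j) : pot ch' = pot ch := by
  unfold pot
  rw [hl]
  exact Finset.sum_congr rfl fun j hj => by rw [h j (Finset.mem_range.mp hj)]

theorem lastDef_congr {ch ch' : Chain K V} (hl : ch'.length = ch.length)
    (h : ∀ j, size ch' j = size ch j) : lastDef ch' = lastDef ch := by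
  unfold lastDef
  rw [hl, h]

theorem flatten_set_last {ch : Chain K V} {k : ℕ} (hk : ch.length = k + 1)
    (h : size ch k = 0) (s : Segment K V) :
    List.flatten (List.set ch k s) = List.flatten ch ++ s := by
  rcases List.eq_nil_or_concat ch with h' | ⟨i, a, h'⟩
  · subst h'; simp at hk
  · have h' : ch = i ++ [a] := by simpa using h'
    subst h'
    have hi : i.length = k := by simpa using hk
    subst hi
    have : a = [] := by simpa [size] using h
    subst this
    simp

/-- One transfer, from the last segment of the longer chain. -/
theorem transfer_spec {long short : Chain K V} (hlen : short.length < long.length)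
    (h1 : 1 ≤ short.length) (hL : Tidy long) (hS : Tidy short) {k : ℕ} (hk : long.length = k + 1)
    (r : Costed (Chain K V × Chain K V)) (hr : r = transfer long short) :
    List.flatten r.val.1 ++ (List.flatten r.val.2).reverse =
      List.flatten long ++ (List.flatten short).reverse ∧
    Tidy r.val.1 ∧ Tidy r.val.2 ∧ 1 ≤ r.val.2.length ∧
    ((r.val.1.length = k + 1 ∧ r.val.2.length = k + 1 ∧ cost r.log + pot r.val.1 + pot r.val.2 ≤
        pot long + pot short + lastDef short + 18 * 2 ^ k) ∨
      (r.val.1.length = k ∧ r.val.2.length ≤ k ∧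
        cost r.log + pot r.val.1 + pot r.val.2 + lastDef r.val.2 ≤
        pot long + pot short + lastDef short + 600 * 2 ^ k)) := by
  set a := long.getD k [] with ha
  have hLk := hL k (by omega)
  have hsa : size long k = a.length := rfl
  obtain ⟨p, hp⟩ : ∃ p, short.length = p + 1 := ⟨short.length - 1, by omega⟩
  obtain ⟨base, hbase⟩ : ∃ base, base = short ++ List.replicate (long.length - short.length) [] :=
    ⟨_, rfl⟩
  have hbl : base.length = k + 1 := by rw [hbase]; simp; omega
  have hbs : ∀ j, size base j = size short j := fun j => by rw [hbase, size_append_nil]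
  have hs0 : ∀ j, p < j → size short j = 0 := fun j hj => size_of_length_le (by omega)
  obtain ⟨ch₁, e₁⟩ : ∃ ch₁, ch₁ = List.set base k a.reverse := ⟨_, rfl⟩
  have hl₁ : ch₁.length = k + 1 := by rw [e₁, List.length_set, hbl]
  have hsz₁ : ∀ j, size ch₁ j = if j = k then a.length else size short j := fun j => by
    rw [e₁, size_set _ _ _ _ (by omega), List.length_reverse, hbs]
  have hfl₁ : List.flatten ch₁ = List.flatten short ++ a.reverse := by
    rw [e₁, flatten_set_last hbl (by rw [hbs]; exact hs0 k (by omega)), hbase, flatten_append_nil]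
  obtain ⟨ch₂, e₂⟩ : ∃ ch₂, ch₂ = (fillUsing k ch₁).val := ⟨_, rfl⟩
  have hfl₂ : List.flatten ch₂ = List.flatten ch₁ := by rw [e₂, flatten_fillUsing (by omega)]
  have hrv : r.val = if size ch₂ k = 0 then (List.take k long, List.take k ch₂)
      else (List.set long k [], ch₂) := by
    rw [hr, e₂, e₁, hbase, ha]
    unfold transfer
    simp only [Costed.tick_val, Costed.bind_val, hk, Nat.add_sub_cancel]
    split_ifs <;> rfl
  have hrc : cost r.log = (k + 1 - short.length + 1) + cost (fillUsing k ch₁).log := by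
    rw [hr, e₁, hbase, ha]
    unfold transfer
    simp only [Costed.tick_log, Costed.bind_log, hk, Nat.add_sub_cancel, cost_cons, cost_append]
    split_ifs <;> simp [Prim.bound]
  have hfll : List.flatten long = List.flatten (List.set long k []) ++ a := by
    have := flatten_set_last (ch := List.set long k []) (k := k) (by rw [List.length_set, hk])
      (by rw [size_set _ _ _ _ (by omega), if_pos rfl, List.length_nil]) a
    rw [← this, List.set_set, ha]
    congr 1
    rw [List.getD_eq_getElem _ _ (by omega), List.set_getElem_self]
  have hset : List.flatten (List.set long k []) = List.flatten (List.take k long) := by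
    rw [← flatten_take_of_last (ch := List.set long k []) (k := k) (by rw [List.length_set]; omega)
      (by rw [size_set _ _ _ _ (by omega), if_pos rfl, List.length_nil]), List.take_set_of_le le_rfl]
  have hpotL := pot_set_nil hk
  have hpotT := pot_take_le hk (by omega)
  have hlow : ∑ j ∈ Finset.range p, segPot j (k + 1) (size short j) +
      segPot p (p + 1) (size short p) = pot short := by
    unfold pot
    rw [hp, Finset.sum_range_succ]
    congr 1
    refine Finset.sum_congr rfl fun x hx => ?_
    have := Finset.mem_range.mp hx
    exact segPot_congr (by omega) (by omega)
  have hlast : ¬ (size short p + cap p < target p) →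
      segPot p (k + 1) (size short p) ≤ segPot p (p + 1) (size short p) + lastDef short := by
    intro h
    have := segPot_nonlast_le (k := p) (n := p + 1) (n' := k + 1) (s := size short p) le_rfl
      (by omega)
    unfold lastDef
    rw [hp, Nat.add_sub_cancel, if_pos (by omega)]
    exact this
  have hlow0 : ∑ j ∈ Finset.range p, segPot j (k + 1) (size short j) ≤ pot short := by
    have := segPot_nonneg p (p + 1) (size short p); linarith
  have hu : ∀ j < k, (Underfull ch₁ j ↔ size short j + cap j < target j) := by
    intro j hj
    unfold Underfull IsLast
    rw [hsz₁, if_neg (by omega), hl₁]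
    constructor
    · exact fun h => h.2
    · exact fun h => ⟨by omega, h⟩
  have hsu : ∀ j < p, ¬ (size short j + cap j < target j) := by
    intro j hj h
    exact (hS j (by omega)).2 ⟨by unfold IsLast; omega, h⟩
  have hso : ∀ j, size short j ≤ target j + cap j := by
    intro j
    by_cases hj : j < short.length
    · have := (hS j hj).1; unfold Overfull at this; omega
    · rw [size_of_length_le (by omega)]; omega
  have hoa : a.length ≤ target k + cap k := by
    have := hLk.1; unfold Overfull at this; omega
  have hct : ∀ j, cap j < target j := fun j => by
    have := cap_pos j; unfold target; omega
  have hk2 : k + 1 ≤ 2 ^ k := Nat.lt_two_pow_self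
  have hk2r : (k : ℝ) + 1 ≤ 2 ^ k := by exact_mod_cast hk2
  have hld := lastDef_nonneg short
  by_cases hN : ∀ j < k, ¬ Underfull ch₁ j
  -- A second appended segment before k would be empty and not last, hence underfull. So nothing to
  -- fill means that the short chain lacks just one segment.
  · have hkp : k = p + 1 := by
      by_contra hne
      refine hN (p + 1) (by omega) ((hu _ (by omega)).mpr ?_)
      rw [hs0 _ (by omega)]; have := hct (p + 1); omega
    rw [fillUsing_of_not_underfull hN] at e₂ hrc
    have e₂ : ch₂ = ch₁ := e₂
    subst e₂
    have hc : (cost r.log : ℝ) ≤ 18 * 2 ^ k := by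
      have : cost r.log = 2 := by rw [hrc]; simp; omega
      rw [this]
      have : (1 : ℝ) ≤ 2 ^ k := one_le_pow₀ (by norm_num)
      push_cast; linarith
    have hsk : size ch₂ k = a.length := by rw [hsz₁, if_pos rfl]
    have hnl : ¬ (size short p + cap p < target p) := fun h =>
      hN p (by omega) ((hu p (by omega)).mpr h)
    by_cases h0 : a.length = 0
    · rw [if_pos (by omega)] at hrv
      have hl : (List.take k ch₂).length = short.length := by rw [List.length_take]; omega
      have hs : ∀ j, size (List.take k ch₂) j = size short j := by
        intro j
        rw [size_take]
        split_ifs with h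
        · rw [hsz₁, if_neg (by omega)]
        · rw [hs0]; omega
      rw [hrv]
      refine ⟨?_, hL.take k, tidy_congr hl (fun j _ => hs j) hS, by simp only; omega,
        Or.inr ⟨?_, by simp only; omega, ?_⟩⟩
      · simp only
        rw [flatten_take_of_last (ch := ch₂) (k := k) (by omega) (by omega), hfl₁, hfll, hset]; simp
      · simp only [List.length_take]; omega
      · simp only
        rw [pot_congr hl (fun j _ => hs j), lastDef_congr hl hs]
        have := segPot_nonneg k (k + 1) (size long k)
        have : (0 : ℝ) < 2 ^ k := by positivity
        linarith
    · rw [if_neg (by omega)] at hrv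
      rw [hrv]
      refine ⟨?_, hL.set_nil hk, ?_, by simp only; omega, Or.inl ⟨?_, hl₁, ?_⟩⟩
      · simp only
        rw [hfl₁, hfll]; simp
      · intro j hj
        change j < ch₂.length at hj
        change ¬ Overfull ch₂ j ∧ ¬ Underfull ch₂ j
        have h1 : ¬ Overfull ch₂ j := by
          unfold Overfull; rw [hsz₁]
          split_ifs with h
          · subst h; omega
          · have := hso j; omega
        refine ⟨h1, ?_⟩
        by_cases hjk : j < k
        · exact hN j hjk
        · exact fun h => h.1 (by unfold IsLast; omega)
      · simp only [List.length_set]; omega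
      · simp only
        have hpc : pot ch₂ = ∑ j ∈ Finset.range p, segPot j (k + 1) (size short j) +
            segPot p (k + 1) (size short p) + segPot k (k + 1) (size long k) := by
          unfold pot
          rw [hl₁, Finset.sum_range_succ, hsk, hsa]
          congr 1
          rw [show Finset.range k = Finset.range (p + 1) by rw [hkp], Finset.sum_range_succ,
            hsz₁ p, if_neg (by omega)]
          congr 1
          refine Finset.sum_congr rfl fun x hx => ?_
          have := Finset.mem_range.mp hx
          rw [hsz₁, if_neg (by omega)]
        have := hlast hnl
        linarith
  · push Not at hN
    obtain ⟨k₀, ⟨hk₀k, hk₀⟩, hmin⟩ : ∃ k₀, (k₀ < k ∧ Underfull ch₁ k₀) ∧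
        ∀ j < k₀, ¬ (j < k ∧ Underfull ch₁ j) := by
      classical
      exact ⟨Nat.find hN, Nat.find_spec hN, fun j hj => Nat.find_min hN hj⟩
    have hmin' : ∀ j < k₀, ¬ Underfull ch₁ j := fun j hj h => hmin j hj ⟨by omega, h⟩
    -- Before its last segment p the short chain is balanced, and the appended segments are empty.
    -- So the run to be filled starts at p or at p + 1.
    have hk₀p : p ≤ k₀ := by
      by_contra h
      exact hsu k₀ (by omega) ((hu _ hk₀k).mp hk₀)
    have hk₀p' : k₀ ≤ p + 1 := by
      by_contra h
      refine hmin' (p + 1) (by omega) ((hu _ (by omega)).mpr ?_)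
      rw [hs0 _ (by omega)]; have := hct (p + 1); omega
    obtain ⟨d, rfl⟩ : ∃ d, k = k₀ + d + 1 := ⟨k - 1 - k₀, by omega⟩
    have hrun : ∀ b, k₀ ≤ b → b ≤ k₀ + d → Underfull ch₁ b := by
      intro b hb hb'
      by_cases hbk : b = k₀
      · rw [hbk]; exact hk₀
      · refine (hu b (by omega)).mpr ?_
        rw [hs0 b (by omega)]; have := hct b; omega
    rw [fillUsing_of_underfull (by omega) hk₀ hmin', show k₀ + d + 1 - 1 - k₀ = d by omega] at e₂ hrc
    have e₂ : ch₂ = (fill k₀ d ch₁).val := e₂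
    have hsk : size ch₁ (k₀ + d + 1) = a.length := by rw [hsz₁, if_pos rfl]
    -- The source contributes 5 * 2^k and the fill 10 * 2^k, with k = k₀ + d + 1; the counts of
    -- segments are below 3 * 2^k.
    have hc : (cost r.log : ℝ) ≤ 18 * 2 ^ (k₀ + d + 1) := by
      have h1 := cost_fill k₀ d ch₁ (by omega) (prefixLow_of_run hrun)
      have h2 := log_four_cap (k := k₀ + d + 1) (n := size ch₁ (k₀ + d + 1)) (by
        have : target (k₀ + d + 1) = 2 * cap (k₀ + d + 1) := rfl
        omega)
      have h3 : cost r.log ≤ 18 * 2 ^ (k₀ + d + 1) := by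
        rw [hrc]
        simp only [Costed.tick_log, cost_cons, Prim.bound]
        have : 2 ^ (k₀ + d + 1) = 2 * 2 ^ (k₀ + d) := by ring
        omega
      exact_mod_cast h3
    -- If the old last segment is outside the run, it now counts as an inner segment; the deficit
    -- term that it thereby acquires is `lastDef short`.
    have hlow1 : ∑ j ∈ Finset.range k₀, segPot j (k₀ + d + 1 + 1) (size ch₁ j) ≤
        pot short + lastDef short := by
      have e : ∑ j ∈ Finset.range k₀, segPot j (k₀ + d + 1 + 1) (size ch₁ j) =
          ∑ j ∈ Finset.range k₀, segPot j (k₀ + d + 1 + 1) (size short j) := by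
        refine Finset.sum_congr rfl fun x hx => ?_
        have := Finset.mem_range.mp hx
        rw [hsz₁, if_neg (by omega)]
      rw [e]
      by_cases hkp : k₀ = p
      · rw [hkp] at hlow0 ⊢; linarith
      · have hkp : k₀ = p + 1 := by omega
        have h1 := hlast (fun h => hmin' p (by omega) ((hu p (by omega)).mpr h))
        rw [show Finset.range k₀ = Finset.range (p + 1) by rw [hkp], Finset.sum_range_succ]
        linarith
    by_cases hE : need k₀ d ch₁ < size ch₁ (k₀ + d + 1)
    · obtain ⟨hl, hs⟩ := fill_of_enough k₀ d ch₁ (by omega) (prefixLow_of_run hrun) (Or.inl hE)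
      have hpot := pot_fill_eq (by omega) hrun (Or.inl hE)
      rw [← e₂] at hl hs hpot
      have hsk₂ : size ch₂ (k₀ + d + 1) = size ch₁ (k₀ + d + 1) - need k₀ d ch₁ := by
        rw [hs, if_neg (by omega), if_pos rfl]
      rw [if_neg (by omega)] at hrv
      rw [hrv]
      refine ⟨?_, hL.set_nil hk, ?_, by simp only; omega, Or.inl ⟨?_, by simp only; omega, ?_⟩⟩
      · simp only
        rw [hfl₂, hfl₁, hfll]; simp
      · intro j hj
        change j < ch₂.length at hj
        change ¬ Overfull ch₂ j ∧ ¬ Underfull ch₂ j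
        rw [hl, hl₁] at hj
        by_cases hj1 : j < k₀
        · have e1 : size ch₂ j = size ch₁ j := by rw [hs, if_neg (by omega), if_neg (by omega)]
          rw [overfull_congr e1, underfull_congr hl e1]
          refine ⟨?_, hmin' j hj1⟩
          unfold Overfull; rw [hsz₁, if_neg (by omega)]; have := hso j; omega
        · by_cases hj2 : j = k₀ + d + 1
          · subst hj2
            unfold Overfull Underfull IsLast
            rw [hsk₂]; omega
          · have e1 : size ch₂ j = target j := by rw [hs, if_pos (by omega)]
            unfold Overfull Underfull
            rw [e1]; omega
      · simp only [List.length_set]; omega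
      · simp only
        rw [hl₁, Nat.Ico_succ_singleton, Finset.sum_singleton, hsk₂] at hpot
        have h1 := segPot_last_mono (k := k₀ + d + 1) (n := k₀ + d + 1 + 1) le_rfl
          (by omega : size ch₁ (k₀ + d + 1) - need k₀ d ch₁ ≤ size long (k₀ + d + 1))
        linarith
    · have hE' : size ch₁ (k₀ + d + 1) ≤ need k₀ d ch₁ := by omega
      obtain ⟨a1, a2, a3, a4, a5, -⟩ :=
        fill_of_exhausted k₀ d ch₁ (by omega) (prefixLow_of_run hrun) hE'
      have hpot := pot_fill_of_exhausted (by omega) hrun hE'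
      rw [← e₂] at a1 a2 a3 a4 a5 hpot
      rw [if_pos (size_of_length_le (by omega)), List.take_of_length_le a2] at hrv
      rw [hrv]
      refine ⟨?_, hL.take _, ?_, by simp only; omega, Or.inr ⟨?_, a2, ?_⟩⟩
      · simp only
        rw [hfl₂, hfl₁, hfll, hset]; simp
      · intro j hj
        change j < ch₂.length at hj
        change ¬ Overfull ch₂ j ∧ ¬ Underfull ch₂ j
        by_cases hj1 : j < k₀
        · have h1 := hmin' j hj1
          unfold Overfull Underfull IsLast at *
          rw [hl₁] at h1
          rw [a3 j hj1]
          have h2 := hso j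
          have h3 := hsz₁ j
          rw [if_neg (by omega)] at h3
          omega
        · unfold Overfull Underfull IsLast
          by_cases hjl : j + 1 < ch₂.length
          · rw [a4 j (by omega) hjl]; omega
          · rw [show ch₂.length - 1 = j by omega] at a5; omega
      · simp only [List.length_take]; omega
      · simp only
        -- Each appended empty segment starts with the deficit term 256 * wt j * target j = 512 *
        -- 2^j, a geometric sum. The bound 600 * 2^k for the whole transfer matches the drop of the
        -- term `600 * 2 ^ length` when the longer chain loses a segment.
        have hsum : ∀ i, p < i → i ≤ k₀ + d + 1 →
            ∑ j ∈ Finset.range i, segPot j (k₀ + d + 1 + 1) (size short j) ≤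
              pot short + 512 * 2 ^ i := by
          intro i hi
          induction i, hi using Nat.le_induction with
          | base =>
            intro _
            have h1 := segPot_nonlast_le (k := p) (n := p + 1) (n' := k₀ + d + 1 + 1)
              (s := size short p) le_rfl (by omega)
            have h2 : 256 * wt p * ((target p - size short p : ℕ) : ℝ) ≤ 512 * 2 ^ p := by
              have h3 : ((target p - size short p : ℕ) : ℝ) ≤ target p := by
                exact_mod_cast Nat.sub_le _ _
              have := mul_le_mul_of_nonneg_left h3 (wt_pos p).le
              rw [wt_mul_target] at this
              linarith
            have h4 : (2 : ℝ) ^ (p + 1) = 2 * 2 ^ p := by ring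
            have : (0 : ℝ) < 2 ^ p := by positivity
            rw [Nat.succ_eq_add_one, Finset.sum_range_succ, h4]
            linarith
          | succ i hi ih =>
            intro hik
            have h1 := ih (by omega)
            have h2 : segPot i (k₀ + d + 1 + 1) (size short i) = 512 * 2 ^ i := by
              rw [hs0 i (by omega), segPot_of_le_target (by omega) (Nat.zero_le _), Nat.sub_zero,
                wt_mul_target]
              ring
            rw [Finset.sum_range_succ, h2, pow_succ]
            linarith
        have h1 := hsum (k₀ + d + 1) (by omega) le_rfl
        have hpc : pot ch₁ = ∑ j ∈ Finset.range (k₀ + d + 1),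
            segPot j (k₀ + d + 1 + 1) (size short j) +
            segPot (k₀ + d + 1) (k₀ + d + 1 + 1) (size long (k₀ + d + 1)) := by
          unfold pot
          rw [hl₁, Finset.sum_range_succ, hsk, hsa]
          congr 1
          refine Finset.sum_congr rfl fun x hx => ?_
          have := Finset.mem_range.mp hx
          rw [hsz₁, if_neg (by omega)]
        have : (0 : ℝ) < 2 ^ (k₀ + d + 1) := by positivity
        linarith

end Chain

end

/-! ### The potential of both chains, and the whole rebalancing phase -/

section

namespace FS1

variable {K : Type u} {V : Type v}

/-- All items, in increasing order. -/
def entries (S : FS1 K V) : List (K × V) := S.front.flatten ++ S.back.flatten.reverse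

open Chain

/-- The potential of the structure. -/
noncomputable def pot (S : FS1 K V) : ℝ :=
  S.front.pot + S.back.pot + 600 * 2 ^ max S.front.length S.back.length

/-- What chain rebalancing may use up, apart from the potential. -/
noncomputable def gap (S : FS1 K V) : ℝ :=
  if S.back.length < S.front.length then lastDef S.back + 20 * 2 ^ S.front.length
  else if S.front.length < S.back.length then lastDef S.front + 20 * 2 ^ S.back.length else 0

/-- Each transfer from a chain of length k + 1 ends with equal lengths or removes a section. In the
first case its cost of at most 18 * 2^k is covered by the gap, which includes 40 * 2^k. In the
second case the drop of `600 * 2 ^ length` pays for the transfer, and what remains of the gap,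
together with the `lastDef` obtained from the transfer, is the gap needed next. -/
theorem rebalanceChains_spec : ∀ (f : ℕ) (S : FS1 K V),
    S.front.length ≤ f → S.back.length ≤ f → 1 ≤ S.front.length → 1 ≤ S.back.length →
    Tidy S.front → Tidy S.back →
    ∀ r, r = rebalanceChains f S → r.val.entries = S.entries ∧
      r.val.front.length = r.val.back.length ∧ 1 ≤ r.val.front.length ∧
      Tidy r.val.front ∧ Tidy r.val.back ∧ cost r.log + r.val.pot ≤ S.pot + S.gap + 2 := by
  intro f
  induction f with
  | zero => intro S h1 _ h2; omega
  | succ f ih =>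
    -- The accounting common to both directions: one transfer from S to S', then the remaining
    -- iterations.
    have key : ∀ S S' : FS1 K V, ∀ k : ℕ, ∀ l : List Prim, S'.entries = S.entries →
        k ≤ f → 1 ≤ S'.front.length → 1 ≤ S'.back.length →
        Tidy S'.front → Tidy S'.back → max S.front.length S.back.length = k + 1 →
        (S'.front.length = k + 1 ∧ S'.back.length = k + 1 ∧
            cost l + S'.front.pot + S'.back.pot + 600 * 2 ^ (k + 1) + 2 ≤ S.pot + S.gap ∨
          max S'.front.length S'.back.length = k ∧ 1 ≤ k ∧ 
            cost l + S'.pot + S'.gap + 4 ≤ S.pot + S.gap + 2) →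
        ∀ r, r = (⟨(rebalanceChains f S').val,
            .linear 1 :: (l ++ (rebalanceChains f S').log)⟩ : Costed (FS1 K V)) →
          r.val.entries = S.entries ∧
          r.val.front.length = r.val.back.length ∧ 1 ≤ r.val.front.length ∧
          Tidy r.val.front ∧ Tidy r.val.back ∧ cost r.log + r.val.pot ≤ S.pot + S.gap + 2 := by
      intro S S' k l he hkf h1 h2 h3 h4 hk h r hr
      rcases h with ⟨e1, e2, h⟩ | ⟨e1, e2, h⟩
      -- With equal lengths the next call makes no transfer, whether or not iterations remain.
      · have hv : (rebalanceChains f S').val = S' ∧ cost (rebalanceChains f S').log ≤ 2 := by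
          cases f with
          | zero => exact ⟨rfl, by simp [rebalanceChains]⟩
          | succ f =>
            unfold rebalanceChains
            rw [if_neg (by omega), if_neg (by omega)]
            exact ⟨rfl, by simp [Prim.bound]⟩
        subst hr
        simp only [hv.1]
        refine ⟨he, by omega, by omega, h3, h4, ?_⟩
        have h5 : (cost (rebalanceChains f S').log : ℝ) ≤ 2 := by exact_mod_cast hv.2
        unfold pot at *
        rw [e1, e2, max_self]
        simp only [cost_cons, cost_append, Prim.bound]
        push_cast
        linarith
      · obtain ⟨a1, a2, a3, a4, a5, a6⟩ := ih S' (by omega) (by omega) h1 h2 h3 h4 _ rfl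
        subst hr
        refine ⟨a1.trans he, a2, a3, a4, a5, ?_⟩
        simp only [cost_cons, cost_append, Prim.bound]
        push_cast
        linarith
    intro S hf1 hb1 hf hb hF hB r hr
    unfold rebalanceChains at hr
    have hpos : ∀ k : ℕ, (1 : ℝ) ≤ 2 ^ k := fun k => one_le_pow₀ (by norm_num)
    split_ifs at hr with h1 h2
    · obtain ⟨k, hk⟩ : ∃ k, S.front.length = k + 1 := ⟨S.front.length - 1, by omega⟩
      obtain ⟨b1, b2, b3, b4, b5⟩ := transfer_spec h1 hb hF hB hk _ rfl
      have hp := hpos k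
      have hSg : S.gap = lastDef S.back + 40 * 2 ^ k := by
        rw [gap, if_pos h1, hk, pow_succ]; ring
      have hSp : S.pot = S.front.pot + S.back.pot + 1200 * 2 ^ k := by
        rw [pot, max_eq_left h1.le, hk, pow_succ]; ring
      refine key S ⟨(transfer S.front S.back).val.1, (transfer S.front S.back).val.2⟩ k
        (transfer S.front S.back).log b1 (by omega) ?_ b4 b2 b3 (by omega) ?_ r hr
      · rcases b5 with b5 | b5 <;> simp only <;> omega
      · rcases b5 with ⟨c1, c2, c3⟩ | ⟨c1, c2, c3⟩
        · refine Or.inl ⟨c1, c2, ?_⟩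
          simp only
          rw [hSg, hSp, pow_succ]; linarith
        · refine Or.inr ⟨by simp only; omega, by omega, ?_⟩
          have hg : FS1.gap ⟨(transfer S.front S.back).val.1, (transfer S.front S.back).val.2⟩ ≤
              lastDef (transfer S.front S.back).val.2 + 20 * 2 ^ k := by
            have := lastDef_nonneg (transfer S.front S.back).val.2
            unfold gap
            simp only
            rw [if_neg (by omega : ¬ (transfer S.front S.back).val.1.length <
              (transfer S.front S.back).val.2.length), c1]
            split_ifs <;> linarith
          rw [hSg, hSp, pot]
          simp only
          rw [max_eq_left (by omega), c1]
          linarith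
    · obtain ⟨k, hk⟩ : ∃ k, S.back.length = k + 1 := ⟨S.back.length - 1, by omega⟩
      obtain ⟨b1, b2, b3, b4, b5⟩ := transfer_spec h2 hf hB hF hk _ rfl
      have hp := hpos k
      have hSg : S.gap = lastDef S.front + 40 * 2 ^ k := by
        rw [gap, if_neg h1, if_pos h2, hk, pow_succ]; ring
      have hSp : S.pot = S.front.pot + S.back.pot + 1200 * 2 ^ k := by
        rw [pot, max_eq_right h2.le, hk, pow_succ]; ring
      -- `transfer_spec` lists the items from the end of the longer chain. Here that is the back, so
      -- both lists have to be reversed.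
      have b1' := congrArg List.reverse b1
      rw [List.reverse_append, List.reverse_append, List.reverse_reverse,
        List.reverse_reverse] at b1'
      refine key S ⟨(transfer S.back S.front).val.2, (transfer S.back S.front).val.1⟩ k
        (transfer S.back S.front).log b1' (by omega) b4 ?_ b3 b2 (by omega) ?_ r hr
      · rcases b5 with b5 | b5 <;> simp only <;> omega
      · rcases b5 with ⟨c1, c2, c3⟩ | ⟨c1, c2, c3⟩
        · refine Or.inl ⟨c2, c1, ?_⟩
          simp only
          rw [hSg, hSp, pow_succ]; linarith
        · refine Or.inr ⟨by simp only; omega, by omega, ?_⟩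
          have hg : FS1.gap ⟨(transfer S.back S.front).val.2, (transfer S.back S.front).val.1⟩ ≤
              lastDef (transfer S.back S.front).val.2 + 20 * 2 ^ k := by
            have := lastDef_nonneg (transfer S.back S.front).val.2
            unfold gap
            simp only
            rw [if_neg (by omega : ¬ (transfer S.back S.front).val.1.length <
              (transfer S.back S.front).val.2.length), c1]
            split_ifs <;> linarith
          rw [hSg, hSp, pot]
          simp only
          rw [max_eq_right (by omega), c1]
          linarith
    · subst hr
      refine ⟨rfl, by simp only [Costed.tick_val, Costed.pure_val]; omega, hf, hF, hB, ?_⟩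
      have : S.gap = 0 := by rw [gap, if_neg h1, if_neg h2]
      rw [this]
      simp [Prim.bound]
      linarith

/-- The rebalancing phase restores the balance and is paid for by the potential. -/
theorem rebalance_spec {m : ℕ} {skipped : ℕ → Bool} {E n : ℕ}
    (hs1 : ∀ k < m, skipped k = true → ∀ j, k ≤ j → j < m → skipped j = true)
    (hs2 : ∀ k, m ≤ k → skipped k = true → ∀ j, k ≤ j → skipped j = true)
    (hE : ∀ j, E ≤ j → skipped j = true) {S : FS1 K V} (hf : S.front.length = n)
    (hb : S.back.length = n) (hn : 1 ≤ n) (hF : Ready skipped 0 S.front)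
    (hB : Ready skipped 0 S.back) (r : Costed (FS1 K V)) (hr : r = S.rebalance m skipped) :
    r.val.entries = S.entries ∧
      r.val.front.length = r.val.back.length ∧ 1 ≤ r.val.front.length ∧
      Tidy r.val.front ∧ Tidy r.val.back ∧
      cost r.log + r.val.pot ≤ S.pot + 10 + 4 * (unskipped skipped E 0 : ℝ) := by
  obtain ⟨f1, f2, f3, f4⟩ := rebalanceSegments_spec hs1 hs2 hE
    (S.front.length + S.front.flatten.length + 1) 0 (S.front.length + S.front.flatten.length)
    S.front (by omega) (by omega) (by omega) (by omega) hF _ rfl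
  obtain ⟨g1, g2, g3, g4⟩ := rebalanceSegments_spec hs1 hs2 hE
    (S.back.length + S.back.flatten.length + 1) 0 (S.back.length + S.back.flatten.length)
    S.back (by omega) (by omega) (by omega) (by omega) hB _ rfl
  obtain ⟨F, eF⟩ : ∃ F, F = S.front.rebalance m skipped := ⟨_, rfl⟩
  obtain ⟨B, eB⟩ : ∃ B, B = S.back.rebalance m skipped := ⟨_, rfl⟩
  unfold Chain.rebalance at eF eB
  rw [← eF] at f1 f2 f3 f4
  rw [← eB] at g1 g2 g3 g4
  obtain ⟨a1, a2, a3, a4, a5, a6⟩ := rebalanceChains_spec (max F.val.length B.val.length + 1)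
    ⟨F.val, B.val⟩ (by simp only; omega) (by simp only; omega) f2 g2 f3 g3 _ rfl
  have hr' : r = ⟨(rebalanceChains (max F.val.length B.val.length + 1) ⟨F.val, B.val⟩).val,
      F.log ++ (B.log ++
        (rebalanceChains (max F.val.length B.val.length + 1) ⟨F.val, B.val⟩).log)⟩ := by
    rw [hr, eF, eB]; rfl
  subst hr'
  refine ⟨?_, a2, a3, a4, a5, ?_⟩
  · rw [a1]; unfold entries; rw [f1, g1]
  simp only [cost_append]
  have hm : (if 0 < m then (2 : ℝ) else 0) ≤ 2 := by split_ifs <;> norm_num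
  have d1 : 0 ≤ debt S.front 0 := by
    unfold debt; rw [if_neg (fun h => lt_irrefl 0 h.1)]; positivity
  have d2 : 0 ≤ debt S.back 0 := by
    unfold debt; rw [if_neg (fun h => lt_irrefl 0 h.1)]; positivity
  have hpow : ∀ {a b : ℕ}, a ≤ b → (2 : ℝ) ^ a ≤ 2 ^ b := fun h =>
    pow_le_pow_right₀ (by norm_num) h
  have hpos : ∀ k : ℕ, (0 : ℝ) < 2 ^ k := fun k => by positivity
  have l1 := lastDef_nonneg F.val
  have l2 := lastDef_nonneg B.val
  -- If the longer chain has grown, its credit 1024 * 2^length exceeds 600 + 20 + 256 times that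
  -- power. Otherwise its length is at most n, a shorter chain has shrunk, and the credit `20 * 2 ^
  -- n + lastDef` of that chain is precisely what the gap requires.
  have hgap : FS1.gap ⟨F.val, B.val⟩ + 600 * 2 ^ max F.val.length B.val.length ≤
      600 * 2 ^ n + lengthCredit n F.val.length (lastDef F.val) +
        lengthCredit n B.val.length (lastDef B.val) := by
    have cr : ∀ (k : ℕ) (x : ℝ), 0 ≤ x → 0 ≤ lengthCredit n k x := by
      intro k x hx; unfold lengthCredit; split_ifs <;> positivity
    have c1 := cr F.val.length _ l1
    have c2 := cr B.val.length _ l2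
    have u1 := (lastDef_le F.val).trans (mul_le_mul_of_nonneg_left (hpow (Nat.sub_le _ _)) (by norm_num))
    have u2 := (lastDef_le B.val).trans (mul_le_mul_of_nonneg_left (hpow (Nat.sub_le _ _)) (by norm_num))
    unfold gap
    simp only
    rcases lt_trichotomy B.val.length F.val.length with h | h | h
    · rw [if_pos h, max_eq_left h.le]
      have := hpow h.le
      rcases Nat.lt_or_ge n F.val.length with h' | h'
      · rw [lengthCredit_of_lt h'] at *
        have := hpos n
        linarith
      · rw [lengthCredit_of_gt (by omega : B.val.length < n)] at *
        have := hpow h'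
        linarith
    · rw [if_neg (by omega), if_neg (by omega), max_eq_left h.le]
      rcases Nat.lt_or_ge n F.val.length with h' | h'
      · rw [lengthCredit_of_lt h'] at *
        have := hpos n
        have := hpos F.val.length
        linarith
      · have := hpow h'
        linarith
    · rw [if_neg (by omega), if_pos h, max_eq_right h.le]
      have := hpow h.le
      rcases Nat.lt_or_ge n B.val.length with h' | h'
      · rw [lengthCredit_of_lt h'] at *
        have := hpos n
        linarith
      · rw [lengthCredit_of_gt (by omega : F.val.length < n)] at *
        have := hpow h'
        linarith
  have hSp : S.pot = S.front.pot + S.back.pot + 600 * 2 ^ n := by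
    rw [pot, hf, hb, max_self]
  rw [hf] at f4
  rw [hb] at g4
  have hFp : FS1.pot ⟨F.val, B.val⟩ = F.val.pot + B.val.pot +
    600 * 2 ^ max F.val.length B.val.length := rfl
  push_cast
  linarith

end FS1

end

/-! ### Order from either end, entries of segments, and simulation of calls by group-operations -/

section

variable {N : Type w} {K : Type u} {V : Type v}

/-! ## Sides -/

namespace Side

/-- The opposite end. -/
def other : Side → Side
  | front => back
  | back => front

variable [LinearOrder K]

/-- The strict order in which one meets the items when walking inward from an end. -/
def lt (i : Side) (x y : K) : Prop := ¬ i.le y x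

theorem front_lt {x y : K} : front.lt x y ↔ x < y := by simp [lt, le]

theorem back_lt {x y : K} : back.lt x y ↔ y < x := by simp [lt, le]

theorem le_trans {i : Side} {x y z : K} (h : i.le x y) (h' : i.le y z) : i.le x z := by
  cases i
  · exact _root_.le_trans h h'
  · exact _root_.le_trans h' h

theorem lt_trans {i : Side} {x y z : K} (h : i.lt x y) (h' : i.lt y z) : i.lt x z := by
  cases i <;> simp only [front_lt, back_lt] at * <;> order

theorem lt_of_le_of_lt {i : Side} {x y z : K} (h : i.le x y) (h' : i.lt y z) : i.lt x z := by
  cases i <;> simp only [front_lt, back_lt, le] at * <;> order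

theorem ne_of_lt {i : Side} {x y : K} (h : i.lt x y) : x ≠ y := by
  rintro rfl
  exact h (by cases i <;> exact le_rfl)

theorem lt_of_le_of_ne {i : Side} {x y : K} (h : i.le x y) (h' : x ≠ y) : i.lt x y := by
  cases i <;> simp only [front_lt, back_lt, le] at * <;> order

end Side

/-! ## Entries of segments -/

namespace Segment

variable [LinearOrder K]

@[simp] theorem entry_nil (x : K) : entry ([] : Segment K V) x = none := rfl

theorem entry_cons (e : K × V) (s : Segment K V) (x : K) :
    entry (e :: s) x = if e.1 = x then some e.2 else entry s x := by
  unfold entry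
  rw [List.find?_cons]
  by_cases h : e.1 = x <;> simp [h]

theorem entry_append (s s' : Segment K V) (x : K) :
    entry (s ++ s') x = (entry s x).or (entry s' x) := by
  induction s with
  | nil => simp
  | cons e s ih =>
    rw [List.cons_append, entry_cons, entry_cons, ih]
    split_ifs <;> simp

theorem entry_of_forall_ne {s : Segment K V} {x : K} (h : ∀ e ∈ s, e.1 ≠ x) : entry s x = none := by
  induction s with
  | nil => rfl
  | cons e s ih =>
    rw [entry_cons, if_neg (h e (by simp)), ih fun e he => h e (by simp [he])]

theorem entry_isSome_iff {s : Segment K V} {x : K} : (entry s x).isSome ↔ ∃ e ∈ s, e.1 = x := by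
  induction s with
  | nil => simp
  | cons e s ih =>
    rw [entry_cons]
    by_cases h : e.1 = x <;> simp [h, ih]

/-- The keys in a segment of chain `i` are met in order. -/
def SortedBy (i : Side) (s : Segment K V) : Prop := s.Pairwise (fun e e' => i.lt e.1 e'.1)

theorem entry_reverse {i : Side} {s : Segment K V} (hs : SortedBy i s) (x : K) :
    entry s.reverse x = entry s x := by
  induction s with
  | nil => rfl
  | cons e s ih =>
    rw [SortedBy, List.pairwise_cons] at hs
    rw [List.reverse_cons, entry_append, entry_cons, entry_cons, ih hs.2]
    split_ifs with h
    · rw [entry_of_forall_ne fun e' he' h' => Side.ne_of_lt (hs.1 e' he') (h.trans h'.symm)]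
      simp
    · simp

theorem entry_filter_ne (s : Segment K V) (x y : K) :
    entry (s.filter (fun e => decide (e.1 ≠ x))) y = if y = x then none else entry s y := by
  induction s with
  | nil => simp
  | cons e s ih =>
    by_cases h : e.1 = x
    · rw [List.filter_cons_of_neg (by simp [h]), ih, entry_cons]
      split_ifs with h1 h2
      · rfl
      · exact absurd (h2.symm.trans h) h1
      · rfl
    · rw [List.filter_cons_of_pos (by simp [h]), entry_cons, ih, entry_cons]
      split_ifs with h1 h2 h2
      · exact absurd (h1.trans h2) h
      · rfl
      · rfl
      · rfl

theorem entry_orderedInsert (r : K × V → K × V → Prop) [DecidableRel r] {s : Segment K V} {x : K}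
    (h : ∀ e ∈ s, e.1 ≠ x) (a : V) (y : K) :
    entry (s.orderedInsert r (x, a)) y = if y = x then some a else entry s y := by
  induction s with
  | nil =>
    rw [List.orderedInsert_nil, entry_cons]
    by_cases hy : x = y
    · rw [if_pos hy, if_pos hy.symm]
    · rw [if_neg hy, if_neg (fun h => hy h.symm)]
  | cons e s ih =>
    rw [List.orderedInsert_cons]
    split_ifs with h1 h2 h2
    · rw [entry_cons, if_pos h2.symm]
    · rw [entry_cons, if_neg (fun h => h2 h.symm)]
    · rw [entry_cons, ih fun e he => h e (by simp [he]), if_pos h2, if_neg]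
      rw [h2]; exact h e (by simp)
    · rw [entry_cons, ih fun e he => h e (by simp [he]), if_neg h2, entry_cons]

theorem entry_setEntry (i : Side) (s : Segment K V) (x : K) (o : Option V) (y : K) :
    entry (setEntry i s x o) y = if y = x then o else entry s y := by
  cases o with
  | none => exact entry_filter_ne s x y
  | some a =>
    rw [setEntry, entry_orderedInsert _ (fun e he => by simpa using (List.mem_filter.mp he).2),
      entry_filter_ne]
    split_ifs <;> rfl

theorem mem_setEntry {i : Side} {s : Segment K V} {x : K} {o : Option V} {e : K × V}
    (h : e ∈ setEntry i s x o) : e.1 = x ∨ e ∈ s := by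
  cases o with
  | none => exact Or.inr (List.mem_filter.mp h).1
  | some a =>
    rw [setEntry, List.mem_orderedInsert] at h
    rcases h with rfl | h
    · exact Or.inl rfl
    · exact Or.inr (List.mem_filter.mp h).1

theorem sortedBy_setEntry {i : Side} {s : Segment K V} (hs : SortedBy i s) (x : K)
    (o : Option V) : SortedBy i (setEntry i s x o) := by
  cases o with
  | none => exact hs.filter _
  | some a =>
    have hf : SortedBy i (s.filter (fun e => decide (e.1 ≠ x))) := hs.filter _
    have hx : ∀ e ∈ s.filter (fun e => decide (e.1 ≠ x)), e.1 ≠ x :=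
      fun e he => by simpa using (List.mem_filter.mp he).2
    rw [setEntry]
    generalize s.filter (fun e => decide (e.1 ≠ x)) = t at hf hx
    clear hs
    induction t with
    | nil => simp [SortedBy]
    | cons e t ih =>
      have hex : e.1 ≠ x := hx e (by simp)
      unfold SortedBy at *
      rw [List.orderedInsert_cons]
      rw [List.pairwise_cons] at hf
      split_ifs with h1
      · rw [List.pairwise_cons]
        have h2 : i.lt x e.1 := Side.lt_of_le_of_ne h1 hex.symm
        refine ⟨fun e' he' => ?_, List.pairwise_cons.mpr hf⟩
        rcases List.mem_cons.mp he' with rfl | he'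
        · exact h2
        · exact Side.lt_trans h2 (hf.1 e' he')
      · rw [List.pairwise_cons]
        refine ⟨fun e' he' => ?_, ih hf.2 fun e he => hx e (by simp [he])⟩
        rcases (List.mem_orderedInsert _).mp he' with rfl | he'
        · exact h1
        · exact hf.1 e' he'

theorem length_filter_ne {i : Side} {s : Segment K V} (hs : SortedBy i s) (x : K) :
    (s.filter (fun e => decide (e.1 ≠ x))).length + (if (entry s x).isSome then 1 else 0) =
      s.length := by
  induction s with
  | nil => simp
  | cons e s ih =>
    rw [SortedBy, List.pairwise_cons] at hs
    have ih := ih hs.2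
    rw [entry_cons]
    by_cases h : e.1 = x
    · rw [List.filter_cons_of_neg (by simp [h]), if_pos h]
      rw [entry_of_forall_ne fun e' he' h' => Side.ne_of_lt (hs.1 e' he') (h.trans h'.symm)] at ih
      simp at ih ⊢
      omega
    · rw [List.filter_cons_of_pos (by simp [h]), if_neg h, List.length_cons, List.length_cons]
      omega

theorem length_setEntry {i : Side} {s : Segment K V} (hs : SortedBy i s) (x : K) (o : Option V) :
    (setEntry i s x o).length + (if (entry s x).isSome then 1 else 0) =
      s.length + (if o.isSome then 1 else 0) := by
  have h := length_filter_ne hs x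
  cases o with
  | none => simpa [setEntry] using h
  | some a =>
    rw [setEntry, List.orderedInsert_length]
    simp only [Option.isSome_some, if_true]
    omega

theorem reaches_iff {i : Side} {s : Segment K V} {x : K} :
    reaches i s x = true ↔ ∃ e ∈ s, i.le x e.1 := by
  simp [reaches]

end Segment

/-! ## Sequences of calls -/

section Calls

/-- The map after performing a sequence of calls. -/
def applyCalls [DecidableEq K] (M : K → Option V) (C : List (Call N K V)) : K → Option V :=
  C.foldl (fun M c => c.2.perform M) M

variable [DecidableEq K]

@[simp] theorem applyCalls_nil (M : K → Option V) : applyCalls M ([] : List (Call N K V)) = M := rfl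

@[simp] theorem applyCalls_cons (M : K → Option V) (c : Call N K V) (C : List (Call N K V)) :
    applyCalls M (c :: C) = applyCalls (c.2.perform M) C := rfl

theorem applyCalls_append (M : K → Option V) (C C' : List (Call N K V)) :
    applyCalls M (C ++ C') = applyCalls (applyCalls M C) C' := List.foldl_append

theorem seqResults_append (M : K → Option V) (C C' : List (Call N K V)) :
    seqResults M (C ++ C') = seqResults M C ++ seqResults (applyCalls M C) C' := by
  induction C generalizing M with
  | nil => rfl
  | cons c C ih => simp [seqResults, ih]

theorem perform_of_ne (M : K → Option V) (o : MapOp K V) {y : K} (h : o.item ≠ y) :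
    o.perform M y = M y := by
  unfold MapOp.perform
  rw [Function.update_of_ne h.symm]

theorem perform_item (M : K → Option V) (o : MapOp K V) :
    o.perform M o.item = o.effect (M o.item) := by
  unfold MapOp.perform
  rw [Function.update_self]

theorem applyCalls_of_forall_ne (M : K → Option V) {C : List (Call N K V)} {y : K}
    (h : ∀ c ∈ C, c.2.item ≠ y) : applyCalls M C y = M y := by
  induction C generalizing M with
  | nil => rfl
  | cons c C ih =>
    rw [applyCalls_cons, ih _ fun c hc => h c (by simp [hc]), perform_of_ne _ _ (h c (by simp))]

-- Among operations of one type a later one overrides an earlier one, or neither changes anything.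
-- This is why a group-operation may act through its last member alone.
omit [DecidableEq K] in
theorem effect_effect {o o' : MapOp K V} (h : o.accessType = o'.accessType) (e : Option V) :
    o'.effect (o.effect e) = o'.effect e := by
  cases e <;> cases o <;> cases o' <;> simp [MapOp.accessType, MapOp.effect] at *

theorem memberResults_eq (M : K → Option V) {x : K} {C : List (Call N K V)}
    (h : ∀ c ∈ C, c.2.item = x) : memberResults (M x) C = seqResults M C := by
  induction C generalizing M with
  | nil => rfl
  | cons c C ih =>
    have hc := h c (by simp)
    rw [memberResults, seqResults, hc, ← ih _ fun c hc => h c (by simp [hc])]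
    rw [← hc, perform_item]

end Calls

namespace Group

variable [LinearOrder K]

/-- The members of a group-operation have its type and item. -/
structure Valid (g : Group N K V) : Prop where
  nonempty : g.ops ≠ []
  type : ∀ c ∈ g.ops, c.2.accessType = g.accessType
  item : ∀ c ∈ g.ops, c.2.item = g.item

theorem Valid.effect_eq {g : Group N K V} (hg : g.Valid) (M : K → Option V) :
    g.effect (M g.item) = applyCalls M g.ops g.item := by
  have key : ∀ (C : List (Call N K V)) (M : K → Option V), (∀ c ∈ C, c.2.accessType = g.accessType) →
      (∀ c ∈ C, c.2.item = g.item) → applyCalls M C g.item =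
        match C.getLast? with
        | none => M g.item
        | some c => c.2.effect (M g.item) := by
    intro C
    induction C with
    | nil => intros; rfl
    | cons c C ih =>
      intro M h1 h2
      rw [applyCalls_cons, ih _ (fun c hc => h1 c (by simp [hc])) (fun c hc => h2 c (by simp [hc]))]
      have hc := h2 c (by simp)
      have e : c.2.perform M g.item = c.2.effect (M g.item) := by rw [← hc, perform_item]
      cases C with
      | nil => simpa using e
      | cons c' C' =>
        rw [List.getLast?_cons_cons, List.getLast?_eq_some_getLast (by simp)]
        simp only [e]
        exact effect_effect ((h1 c (by simp)).trans
          (h1 _ (List.mem_cons_of_mem _ (List.getLast_mem _))).symm) _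
  rw [key g.ops M hg.type hg.item]
  rfl

omit [LinearOrder K] in
/-- Whether the item is present after the operation, by access type. -/
theorem Valid.effect_isSome {g : Group N K V} (hg : g.Valid) (e : Option V) :
    (g.accessType ≤ 1 ∧ (g.effect e).isSome = e.isSome) ∨
      (g.accessType = 2 ∧ (g.effect e).isSome = true) ∨
      (g.accessType = 3 ∧ (g.effect e).isSome = false) := by
  unfold effect
  rw [List.getLast?_eq_some_getLast hg.nonempty]
  simp only
  rw [← hg.type _ (List.getLast_mem hg.nonempty)]
  cases (g.ops.getLast hg.nonempty).2 <;> simp [MapOp.effect, MapOp.accessType]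

end Group

section Perform

variable [LinearOrder K]

/-- The predicate `X` marks the items for which this segment alone decides the map: there the groups
act like their calls one by one, and elsewhere nothing changes. The clauses on types express that
only deletions lose items and only insertions add them. -/
theorem performGroups_spec (i : Side) (X : K → Prop) :
    ∀ (G : List (Group N K V)) (s : Segment K V) (M : K → Option V), (∀ g ∈ G, g.Valid) →
      (∀ g ∈ G, X g.item) → (∀ x, X x → s.entry x = M x) → s.SortedBy i →
      ∀ r, r = performGroups i s G → r.1.SortedBy i ∧
        r.2 = seqResults M (G.flatMap Group.ops) ∧
        (∀ x, X x → r.1.entry x = applyCalls M (G.flatMap Group.ops) x) ∧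
        (∀ x, ¬ X x → r.1.entry x = s.entry x ∧ applyCalls M (G.flatMap Group.ops) x = M x) ∧
        (∀ e ∈ r.1, e ∈ s ∨ ∃ g ∈ G, e.1 = g.item) ∧
        ((∀ g ∈ G, g.accessType ≠ 3) →
          (∀ e ∈ s, ∃ e' ∈ r.1, e'.1 = e.1) ∧ s.length ≤ r.1.length) ∧
        ((∀ g ∈ G, g.accessType ≠ 2) → r.1.length ≤ s.length) ∧
        r.1.length ≤ s.length + G.length ∧ s.length ≤ r.1.length + G.length := by
  intro G
  induction G with
  | nil =>
    intro s M _ _ h hs r hr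
    subst hr
    refine ⟨hs, rfl, h, fun x _ => ⟨rfl, rfl⟩, fun e he => Or.inl he,
      fun _ => ⟨fun e he => ⟨e, he, rfl⟩, le_rfl⟩, fun _ => le_rfl, by simp [performGroups],
      by simp [performGroups]⟩
  | cons g G ih =>
    intro s M hv hX h hs r hr
    have hg := hv g (by simp)
    have hgX := hX g (by simp)
    obtain ⟨s', e'⟩ : ∃ s', s' = s.setEntry i g.item (g.effect (s.entry g.item)) := ⟨_, rfl⟩
    have hs' : s'.SortedBy i := by rw [e']; exact Segment.sortedBy_setEntry hs _ _
    have hM : ∀ y, y ≠ g.item → applyCalls M g.ops y = M y := fun y hy =>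
      applyCalls_of_forall_ne _ fun c hc => by rw [hg.item c hc]; exact hy.symm
    have hen : ∀ y, s'.entry y = if y = g.item then applyCalls M g.ops g.item else s.entry y := by
      intro y
      rw [e', Segment.entry_setEntry, h _ hgX, hg.effect_eq]
    obtain ⟨a1, a2, a3, a4, a5, a6, a7, a8, a9⟩ := ih s' (applyCalls M g.ops)
      (fun g hg => hv g (by simp [hg])) (fun g hg => hX g (by simp [hg]))
      (fun x hx => by
        rw [hen]
        split_ifs with h1
        · rw [h1]
        · rw [h x hx, hM x h1]) hs' _ rfl
    have hr' : r = ((performGroups i s' G).1,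
        memberResults (s.entry g.item) g.ops ++ (performGroups i s' G).2) := by rw [hr, e']; rfl
    subst hr'
    have hlen := Segment.length_setEntry hs g.item (g.effect (s.entry g.item))
    rw [← e'] at hlen
    have heff := hg.effect_isSome (s.entry g.item)
    refine ⟨a1, ?_, ?_, ?_, ?_, ?_, ?_, ?_, ?_⟩
    · simp only
      rw [a2, h _ hgX, memberResults_eq M hg.item, List.flatMap_cons, seqResults_append]
    · intro x hx
      rw [List.flatMap_cons, applyCalls_append]
      exact a3 x hx
    · intro x hx
      have hxg : x ≠ g.item := fun hh => hx (hh ▸ hgX)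
      rw [List.flatMap_cons, applyCalls_append, (a4 x hx).2, hM x hxg]
      refine ⟨?_, rfl⟩
      rw [(a4 x hx).1, hen, if_neg hxg]
    · intro e he
      rcases a5 e he with h1 | ⟨g', hg', h1⟩
      · rw [e'] at h1
        rcases Segment.mem_setEntry h1 with h1 | h1
        · exact Or.inr ⟨g, by simp, h1⟩
        · exact Or.inl h1
      · exact Or.inr ⟨g', by simp [hg'], h1⟩
    · intro h3
      obtain ⟨b1, b2⟩ := a6 fun g hg => h3 g (by simp [hg])
      have h4 := h3 g (by simp)
      have hmono : (s.entry g.item).isSome = true → (g.effect (s.entry g.item)).isSome = true := by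
        intro hh
        rcases heff with hh' | hh' | hh'
        · rw [hh'.2, hh]
        · exact hh'.2
        · exact absurd hh'.1 h4
      refine ⟨fun e he => ?_, ?_⟩
      · have h5 : (s'.entry e.1).isSome := by
          rw [e', Segment.entry_setEntry]
          split_ifs with h6
          · exact hmono (Segment.entry_isSome_iff.mpr ⟨e, he, h6⟩)
          · exact Segment.entry_isSome_iff.mpr ⟨e, he, rfl⟩
        obtain ⟨e₁, h6, h7⟩ := Segment.entry_isSome_iff.mp h5
        obtain ⟨e₂, h8, h9⟩ := b1 e₁ h6
        exact ⟨e₂, h8, h9.trans h7⟩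
      · simp only
        refine le_trans ?_ b2
        split_ifs at hlen <;> first | omega | simp_all
    · intro h2
      have b1 := a7 fun g hg => h2 g (by simp [hg])
      have h4 := h2 g (by simp)
      simp only
      refine b1.trans ?_
      rcases heff with hh' | hh' | hh'
      · rw [hh'.2] at hlen; omega
      · exact absurd hh'.1 h4
      · rw [hh'.2] at hlen; simp at hlen; omega
    · simp only [List.length_cons]
      split_ifs at hlen <;> omega
    · simp only [List.length_cons]
      split_ifs at hlen <;> omega

end Perform

end

/-! ### The structure as an ordered map, and the section in which an item fits -/

section

variable {N : Type w} {K : Type u} {V : Type v}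

/-! ## The items of the structure -/

namespace FS1

/-- The items before `S_i[k]`, from the end inward. -/
def outer (S : FS1 K V) (i : Side) (k : ℕ) : List (K × V) := ((S.chain i).take k).flatten

/-- The items after `S_i[k]`, from the end inward. -/
def inner (S : FS1 K V) (i : Side) (k : ℕ) : List (K × V) :=
  ((S.chain i).drop (k + 1)).flatten ++ (S.chain i.other).flatten.reverse

/-- All items, from the end of chain `i` inward. -/
def inward (S : FS1 K V) (i : Side) : List (K × V) :=
  (S.chain i).flatten ++ (S.chain i.other).flatten.reverse

/-- Replace the segment `S_i[k]`. -/
def setSeg (S : FS1 K V) (i : Side) (k : ℕ) (t : Segment K V) : FS1 K V :=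
  S.setChain i ((S.chain i).set k t)

@[simp] theorem chain_setChain (S : FS1 K V) (i : Side) (ch : Chain K V) :
    (S.setChain i ch).chain i = ch := by cases i <;> rfl

@[simp] theorem chain_setChain_other (S : FS1 K V) (i : Side) (ch : Chain K V) :
    (S.setChain i ch).chain i.other = S.chain i.other := by cases i <;> rfl

@[simp] theorem chain_setSeg (S : FS1 K V) (i : Side) (k : ℕ) (t : Segment K V) :
    (S.setSeg i k t).chain i = (S.chain i).set k t := chain_setChain _ _ _

@[simp] theorem chain_setSeg_other (S : FS1 K V) (i : Side) (k : ℕ) (t : Segment K V) :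
    (S.setSeg i k t).chain i.other = S.chain i.other := chain_setChain_other _ _ _

theorem setSeg_setSeg (S : FS1 K V) (i : Side) (k : ℕ) (t t' : Segment K V) :
    (S.setSeg i k t).setSeg i k t' = S.setSeg i k t' := by
  cases i <;> simp [setSeg, setChain, chain]

theorem seg_eq_getElem {S : FS1 K V} {i : Side} {k : ℕ} (hk : k < (S.chain i).length) :
    S.seg i k = (S.chain i)[k] := List.getD_eq_getElem _ _ hk

theorem inward_eq {S : FS1 K V} {i : Side} {k : ℕ} (hk : k < (S.chain i).length) :
    S.inward i = S.outer i k ++ (S.seg i k ++ S.inner i k) := by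
  unfold inward outer inner
  rw [seg_eq_getElem hk]
  conv_lhs => rw [← List.take_append_drop k (S.chain i), List.drop_eq_getElem_cons hk]
  simp only [List.flatten_append, List.flatten_cons, List.append_assoc]

@[simp] theorem outer_setSeg (S : FS1 K V) (i : Side) (k : ℕ) (t : Segment K V) :
    (S.setSeg i k t).outer i k = S.outer i k := by
  unfold outer
  rw [chain_setSeg, List.take_set_of_le le_rfl]

@[simp] theorem inner_setSeg (S : FS1 K V) (i : Side) (k : ℕ) (t : Segment K V) :
    (S.setSeg i k t).inner i k = S.inner i k := by
  unfold inner
  rw [chain_setSeg, chain_setSeg_other, List.drop_set_of_lt (by omega)]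

theorem seg_setSeg (S : FS1 K V) (i : Side) {k : ℕ} (hk : k < (S.chain i).length)
    (t : Segment K V) (j : ℕ) : (S.setSeg i k t).seg i j = if j = k then t else S.seg i j := by
  unfold seg
  rw [chain_setSeg]
  split_ifs with h
  · subst h; rw [List.getD_eq_getElem _ _ (by simpa using hk)]; simp
  · rw [List.getD_eq_getElem?_getD, List.getElem?_set_ne (by omega), List.getD_eq_getElem?_getD]

theorem seg_setSeg_other (S : FS1 K V) (i : Side) (k : ℕ) (t : Segment K V) (j : ℕ) :
    (S.setSeg i k t).seg i.other j = S.seg i.other j := by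
  unfold seg
  rw [chain_setSeg_other]

/-- Both chains have length `n`. -/
def HasLength (S : FS1 K V) (n : ℕ) : Prop := ∀ i, (S.chain i).length = n

theorem HasLength.sections_eq {S : FS1 K V} {n : ℕ} (h : S.HasLength n) : S.sections = n :=
  h .front

theorem HasLength.setSeg {S : FS1 K V} {n : ℕ} (h : S.HasLength n) (i : Side) (k : ℕ)
    (t : Segment K V) : (S.setSeg i k t).HasLength n := by
  intro j
  rw [← h j]
  cases i <;> cases j <;> simp [FS1.setSeg, setChain, chain]

theorem outer_succ {S : FS1 K V} {i : Side} {k : ℕ} (hk : k < (S.chain i).length) :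
    S.outer i (k + 1) = S.outer i k ++ S.seg i k := by
  unfold outer
  rw [seg_eq_getElem hk, List.take_succ_eq_append_getElem hk]
  simp only [List.flatten_append, List.flatten_cons, List.flatten_nil, List.append_nil]

section Order

variable [LinearOrder K]

/-- The items are stored in order. -/
def Sorted (S : FS1 K V) : Prop := Segment.SortedBy .front S.entries

/-- The contents of the structure as a map. -/
def toMap (S : FS1 K V) : K → Option V := Segment.entry S.entries

omit [LinearOrder K] in
theorem inward_back (S : FS1 K V) : S.inward .back = S.entries.reverse := by
  simp [inward, entries, chain, Side.other]

theorem Sorted.inward {S : FS1 K V} (h : S.Sorted) (i : Side) :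
    Segment.SortedBy i (S.inward i) := by
  cases i
  · exact h
  · rw [inward_back, Segment.SortedBy, List.pairwise_reverse]
    refine h.imp fun h => ?_
    rw [Side.back_lt]; exact Side.front_lt.mp h

theorem sorted_of_inward {S : FS1 K V} {i : Side} (h : Segment.SortedBy i (S.inward i)) :
    S.Sorted := by
  cases i
  · exact h
  · rw [inward_back, Segment.SortedBy, List.pairwise_reverse] at h
    refine h.imp fun h => ?_
    rw [Side.front_lt]; exact Side.back_lt.mp h

theorem Sorted.entry_inward {S : FS1 K V} (h : S.Sorted) (i : Side) (x : K) :
    Segment.entry (S.inward i) x = S.toMap x := by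
  cases i
  · rfl
  · rw [inward_back, Segment.entry_reverse h]; rfl

/-- `x` lies after the items before `S_i[k]` and before the items after it. -/
def Between (S : FS1 K V) (i : Side) (k : ℕ) (x : K) : Prop :=
  (∀ e ∈ S.outer i k, i.lt e.1 x) ∧ ∀ e ∈ S.inner i k, i.lt x e.1

theorem Sorted.between_of_mem {S : FS1 K V} (h : S.Sorted) {i : Side} {k : ℕ}
    (hk : k < (S.chain i).length) {e : K × V} (he : e ∈ S.seg i k) : S.Between i k e.1 := by
  have h1 := h.inward i
  rw [inward_eq hk, Segment.SortedBy, List.pairwise_append, List.pairwise_append] at h1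
  exact ⟨fun e' he' => h1.2.2 e' he' e (by simp [he]), fun e' he' => h1.2.1.2.2 e he e' he'⟩

theorem Sorted.entry_seg {S : FS1 K V} (h : S.Sorted) {i : Side} {k : ℕ}
    (hk : k < (S.chain i).length) {x : K} (hx : S.Between i k x) :
    (S.seg i k).entry x = S.toMap x := by
  rw [← h.entry_inward i, inward_eq hk, Segment.entry_append, Segment.entry_append,
    Segment.entry_of_forall_ne fun e he => Side.ne_of_lt (hx.1 e he),
    Segment.entry_of_forall_ne (s := S.inner i k) fun e he => (Side.ne_of_lt (hx.2 e he)).symm]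
  simp

theorem Sorted.setSeg {S : FS1 K V} (h : S.Sorted) {i : Side} {k : ℕ}
    (hk : k < (S.chain i).length) {t : Segment K V} (ht : t.SortedBy i)
    (hb : ∀ e ∈ t, S.Between i k e.1) : (S.setSeg i k t).Sorted := by
  refine sorted_of_inward (i := i) ?_
  have hk' : k < ((S.setSeg i k t).chain i).length := by simpa using hk
  rw [inward_eq hk', outer_setSeg, inner_setSeg, seg_setSeg _ _ hk, if_pos rfl]
  have h1 := h.inward i
  rw [inward_eq hk] at h1
  unfold Segment.SortedBy at *
  rw [List.pairwise_append, List.pairwise_append] at h1 ⊢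
  refine ⟨h1.1, ⟨ht, h1.2.1.2.1, fun e he e' he' => (hb e he).2 e' he'⟩, fun e he e' he' => ?_⟩
  rcases List.mem_append.mp he' with he' | he'
  · exact (hb e' he').1 e he
  · exact h1.2.2 e he e' (by simp [he'])

/-- An item between the neighbours can be stored in this segment only. For any other item it
suffices that the old and the new segment agree on it. -/
theorem toMap_setSeg {S : FS1 K V} {i : Side} {k : ℕ}
    (hk : k < (S.chain i).length) {t : Segment K V} (h : S.Sorted)
    (h' : (S.setSeg i k t).Sorted) (x : K) :
    (S.Between i k x → (S.setSeg i k t).toMap x = t.entry x) ∧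
      (t.entry x = (S.seg i k).entry x → (S.setSeg i k t).toMap x = S.toMap x) := by
  have hk' : k < ((S.setSeg i k t).chain i).length := by simpa using hk
  constructor
  · intro hx
    rw [← h'.entry_seg (i := i) (k := k) hk', seg_setSeg _ _ hk, if_pos rfl]
    unfold Between
    rwa [outer_setSeg, inner_setSeg]
  · intro hx
    rw [← h.entry_inward i, ← h'.entry_inward i, inward_eq hk', inward_eq hk, outer_setSeg,
      inner_setSeg, seg_setSeg _ _ hk, if_pos rfl]
    simp only [Segment.entry_append, hx]

/-- The part of `fitsSeg` that does not depend on the segment itself. -/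
def fitsLast (S : FS1 K V) (k : ℕ) (x : K) : Side → Bool
  | .front => decide (k + 1 = S.sections) && !(S.seg .back k).reaches .back x
  | .back => false

theorem fitsSeg_iff {S : FS1 K V} {k : ℕ} {x : K} {i : Side} :
    S.fitsSeg k x i = true ↔ (∃ e ∈ S.seg i k, i.le x e.1) ∨ S.fitsLast k x i = true := by
  rw [← Segment.reaches_iff]
  cases i <;> simp [fitsSeg, fitsLast]

theorem fitsLast_mono {S : FS1 K V} {k : ℕ} {x y : K} {i : Side} (h : i.le x y)
    (hy : S.fitsLast k y i = true) : S.fitsLast k x i = true := by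
  cases i
  · simp only [fitsLast, Segment.reaches, Bool.and_eq_true, decide_eq_true_eq, Bool.not_eq_true',
      List.any_eq_false] at *
    refine ⟨hy.1, fun e he hx => hy.2 e he ?_⟩
    exact Side.le_trans (i := .back) (y := x) h hx
  · exact absurd hy (by simp [fitsLast])

theorem fitsSeg_mono {S : FS1 K V} {k : ℕ} {x y : K} {i : Side} (h : i.le x y)
    (hy : S.fitsSeg k y i = true) : S.fitsSeg k x i = true := by
  rw [fitsSeg_iff] at *
  rcases hy with ⟨e, he, hy⟩ | hy
  · exact Or.inl ⟨e, he, Side.le_trans h hy⟩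
  · exact Or.inr (fitsLast_mono h hy)

theorem fitsSeg_of_mem {S : FS1 K V} {k : ℕ} {i : Side} {e : K × V} (he : e ∈ S.seg i k) :
    S.fitsSeg k e.1 i = true :=
  fitsSeg_iff.mpr (Or.inl ⟨e, he, by cases i <;> exact le_rfl⟩)

/-- Either x does not lie beyond some item of the segment, or it lies between the two last segments.
In the latter case the inner items are those of the back chain: its outer segments are treated by
`hx`, its last one by not reaching x. -/
theorem between_of_fitsSeg {S : FS1 K V} (h : S.Sorted) {n : ℕ} (hn : S.HasLength n) {i : Side}
    {k : ℕ} (hk : k < n) {x : K} (hx : ∀ j : Side, ∀ e ∈ S.outer j k, j.lt e.1 x)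
    (hf : S.fitsSeg k x i = true) : S.Between i k x := by
  have hk' : k < (S.chain i).length := by rw [hn]; exact hk
  refine ⟨hx i, ?_⟩
  rcases fitsSeg_iff.mp hf with ⟨e, he, hxe⟩ | hf
  · exact fun e' he' => Side.lt_of_le_of_lt hxe ((h.between_of_mem hk' he).2 e' he')
  · cases i
    · simp only [fitsLast, Segment.reaches, Bool.and_eq_true, decide_eq_true_eq,
        Bool.not_eq_true', List.any_eq_false, hn.sections_eq] at hf
      intro e he
      unfold inner at he
      have h1 : (S.chain .front).drop (k + 1) = [] := by
        rw [List.drop_eq_nil_iff, hn]; omega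
      rw [h1, List.flatten_nil, List.nil_append, List.mem_reverse] at he
      have h2 : (S.chain Side.front.other).flatten = S.outer .back (k + 1) := by
        unfold outer
        rw [List.take_of_length_le (by rw [hn]; omega)]; rfl
      rw [h2, outer_succ (by rw [hn]; omega), List.mem_append] at he
      rcases he with he | he
      · have := hx .back e he
        rw [Side.back_lt] at this
        rwa [Side.front_lt]
      · have := hf.2 e he
        rw [Side.front_lt]
        simpa [Side.le] using this
    · exact absurd hf (by simp [fitsLast])

/-- The index of the section in which `x` fits. -/
noncomputable def fitIdx (S : FS1 K V) (x : K) : ℕ := sInf {k | S.fitsSection k x = true}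

theorem fitsSection_last {S : FS1 K V} {n : ℕ} (hn : S.HasLength (n + 1)) (x : K) :
    S.fitsSection n x = true := by
  unfold fitsSection fitsSeg
  rw [hn.sections_eq]
  cases (S.seg .back n).reaches .back x <;> simp

theorem fitsSection_fitIdx {S : FS1 K V} {n : ℕ} (hn : S.HasLength n) (h1 : 1 ≤ n) (x : K) :
    S.fitsSection (S.fitIdx x) x = true := by
  obtain ⟨n, rfl⟩ : ∃ k, n = k + 1 := ⟨n - 1, by omega⟩
  exact Nat.sInf_mem (s := {k | S.fitsSection k x = true}) ⟨n, fitsSection_last hn x⟩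

theorem fitIdx_lt {S : FS1 K V} {n : ℕ} (hn : S.HasLength n) (h1 : 1 ≤ n) (x : K) :
    S.fitIdx x < n := by
  obtain ⟨n, rfl⟩ : ∃ k, n = k + 1 := ⟨n - 1, by omega⟩
  have : S.fitIdx x ≤ n := Nat.sInf_le (fitsSection_last hn x)
  omega

theorem not_fitsSection_of_lt {S : FS1 K V} {k : ℕ} {x : K} (h : k < S.fitIdx x) :
    S.fitsSection k x = false := by
  have := Nat.notMem_of_lt_sInf h
  simpa using this

theorem lt_fitIdx {S : FS1 K V} {n : ℕ} (hn : S.HasLength n) (h1 : 1 ≤ n) {k : ℕ} {x : K}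
    (h : k ≤ S.fitIdx x) (hf : S.fitsSection k x = false) : k + 1 ≤ S.fitIdx x := by
  rcases h.lt_or_eq with h | h
  · exact h
  · rw [h, fitsSection_fitIdx hn h1] at hf
    exact absurd hf (by simp)

end Order

end FS1

end

/-! ### Simulation and cost of the four access types on one segment -/

section

variable {N : Type w} {K : Type u} {V : Type v}

/-! ## Executing a batch on a segment -/

theorem flatMap_filter_range_perm {α : Type*} (f : α → ℕ) (l : List α) (n : ℕ) :
    ((List.range n).flatMap fun a => l.filter (fun x => decide (f x = a))).Perm
      (l.filter (fun x => decide (f x < n))) := by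
  induction n with
  | zero => simp
  | succ n ih =>
    rw [List.range_succ, List.flatMap_append, List.flatMap_singleton]
    refine (ih.append_right _).trans ?_
    have h1 : l.filter (fun x => decide (f x < n)) =
        (l.filter (fun x => decide (f x < n + 1))).filter (fun x => decide (f x < n)) := by
      rw [List.filter_filter]
      refine List.filter_congr fun x _ => ?_
      rw [← Bool.decide_and, decide_eq_decide]; omega
    have h2 : l.filter (fun x => decide (f x = n)) =
        (l.filter (fun x => decide (f x < n + 1))).filter (fun x => !decide (f x < n)) := by
      rw [List.filter_filter]
      refine List.filter_congr fun x _ => ?_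
      rw [← decide_not, ← Bool.decide_and, decide_eq_decide]; omega
    rw [h1, h2]
    exact List.filter_append_perm _ _

/-- Accessing `d` items in a map that has grown by `e` items. -/
theorem mul_log_le (d e : ℕ) : d * Nat.log 2 e ≤ d * Nat.log 2 d + e + d := by
  rcases Nat.eq_zero_or_pos e with rfl | he
  · simp
  rcases Nat.lt_or_ge (Nat.log 2 d + 1) (Nat.log 2 e) with h | h
  · obtain ⟨t, ht⟩ : ∃ t, Nat.log 2 e = Nat.log 2 d + 1 + t := ⟨_, (Nat.add_sub_of_le h.le).symm⟩
    have h1 : 2 ^ Nat.log 2 e ≤ e := Nat.pow_log_le_self 2 (by omega)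
    have h2 : d < 2 ^ (Nat.log 2 d + 1) := Nat.lt_pow_succ_log_self (by norm_num) d
    have h3 : t < 2 ^ t := Nat.lt_two_pow_self
    rw [ht, pow_add] at h1
    rw [ht]
    -- If log e exceeds log d + 1 by t, then d * t ≤ 2^(log d + 1) * 2^t ≤ e, so the part of the
    -- logarithm beyond log d costs at most e in total.
    have h4 : d * t ≤ 2 ^ (Nat.log 2 d + 1) * 2 ^ t := Nat.mul_le_mul h2.le h3.le
    nlinarith
  · have := Nat.mul_le_mul_left d h
    nlinarith

/-- For e ≤ c(k) the logarithm is O(2^k), and beyond that it is log e up to a constant. So d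
accesses to a segment swollen by e items exceed the usual 2^k each and the e insertions only by a
term d log d. -/
theorem mul_log_cap_add_le (d e k : ℕ) :
    d * (Nat.log 2 (3 * cap k + e) + 1) ≤
      5 * 2 ^ k * d + d * (Nat.log 2 d + 1) + e + 3 * d := by
  rcases Nat.lt_or_ge (cap k) e with h | h
  · have h1 : Nat.log 2 (3 * cap k + e) ≤ Nat.log 2 e + 2 := by
      have h3 : Nat.log 2 (e * 2 * 2) = Nat.log 2 e + 2 := by
        rw [Nat.log_mul_base (by norm_num) (by omega), Nat.log_mul_base (by norm_num) (by omega)]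
      rw [← h3]
      exact Nat.log_mono_right (by omega)
    have h2 := mul_log_le d e
    have h3 := Nat.mul_le_mul_left d h1
    nlinarith [Nat.zero_le (5 * 2 ^ k * d)]
  · have h1 := log_four_cap (k := k) (n := 3 * cap k + e) (by omega)
    have h3 := Nat.mul_le_mul_left d h1
    nlinarith [Nat.zero_le (d * (Nat.log 2 d + 1))]

theorem log_cap_add_le (k e : ℕ) : Nat.log 2 (3 * cap k + e) + 1 ≤ 5 * 2 ^ k + e := by
  have h1 := log_cap_add k e
  have h2 : (1 : ℝ) ≤ cap k := by exact_mod_cast cap_pos k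
  have h3 : (e : ℝ) / cap k ≤ e := div_le_self (by positivity) h2
  have : ((Nat.log 2 (3 * cap k + e) + 1 : ℕ) : ℝ) ≤ ((5 * 2 ^ k + e : ℕ) : ℝ) := by
    push_cast; linarith
  exact_mod_cast this

section Exec

variable [LinearOrder K]

/-- The group-operations of type `a` on items that satisfy `F`. -/
def cutOf (F : K → Bool) (a : ℕ) (G : List (Group N K V)) : List (Group N K V) :=
  (G.filter (fun g => F g.item)).filter (fun g => decide (g.accessType = a))

/-- The group-operations other than those of types below `a` on items that satisfy `F`. -/
def restOf (F : K → Bool) (a : ℕ) (G : List (Group N K V)) : List (Group N K V) :=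
  G.filter (fun g => decide (¬ (g.accessType < a ∧ F g.item = true)))

/-- The calls on items that satisfy `F` with types below `a`, by type. -/
def callsBelow (F : K → Bool) (a : ℕ) (G : List (Group N K V)) : List (Call N K V) :=
  ((List.range a).flatMap fun b => cutOf F b G).flatMap Group.ops

/-- `F` describes what fits before the first access to this segment. Searches, updates and
insertions keep every stored item present and add only items that satisfy `F`, so `F` stays valid;
deletions may invalidate it, but they are the last type. -/
theorem execType_spec {E : ExecState N K V} {n k : ℕ} {i : Side} (a : ℕ) {F : K → Bool}
    (hS : E.str.Sorted) (hn : E.str.HasLength n) (hk : k < n)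
    (hF : ∀ x, E.str.fitsSeg k x i = F x) {G : List (Group N K V)} (hG : E.batch = restOf F a G)
    (hv : ∀ g ∈ G, g.Valid)
    (ho : ∀ g ∈ G, ∀ j : Side, ∀ e ∈ E.str.outer j k, j.lt e.1 g.item) :
    ∃ t, (execType k i a E).val = ⟨E.str.setSeg i k t, restOf F (a + 1) G, E.results ++
        seqResults E.str.toMap ((cutOf F a G).flatMap Group.ops)⟩ ∧
      (E.str.setSeg i k t).Sorted ∧ (E.str.setSeg i k t).toMap =
        applyCalls E.str.toMap ((cutOf F a G).flatMap Group.ops) ∧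
      (∀ e ∈ t, F e.1 = true) ∧
      (a ≠ 3 → ∀ x, (E.str.setSeg i k t).fitsSeg k x i = F x) ∧
      t.length ≤ (E.str.seg i k).length + (cutOf F a G).length ∧
      (E.str.seg i k).length ≤ t.length + (cutOf F a G).length ∧
      (a ≠ 2 → t.length ≤ (E.str.seg i k).length) ∧
      cost (execType k i a E).log ≤ (Nat.log 2 (E.str.seg i k).length + 1) +
        (Nat.log 2 (E.str.seg i.other k).length + 1) + (G.length + 1) +
        ((cutOf F a G).length * (Nat.log 2 (E.str.seg i k).length + 1) + 1) +
        (((cutOf F a G).map fun g => g.ops.length).sum + 1) := by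
  have hcut : (E.batch.filter (fun g => decide (g.accessType = a))).filter
      (fun g => E.str.fitsSeg k g.item i) = cutOf F a G := by
    rw [hG, cutOf, restOf, List.filter_filter, List.filter_filter, List.filter_filter]
    refine List.filter_congr fun g _ => ?_
    rw [hF]
    cases F g.item <;> simp
    omega
  have hrest : E.batch.filter
      (fun g => decide (¬ (g.accessType = a ∧ E.str.fitsSeg k g.item i = true))) =
      restOf F (a + 1) G := by
    rw [hG, restOf, restOf, List.filter_filter]
    refine List.filter_congr fun g _ => ?_
    rw [hF, ← Bool.decide_and, decide_eq_decide]
    cases F g.item <;> simp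
    omega
  have hk' : k < (E.str.chain i).length := by rw [hn]; exact hk
  have hmem : ∀ g ∈ cutOf F a G, g ∈ G ∧ F g.item = true ∧ g.accessType = a := by
    intro g hg
    rw [cutOf, List.mem_filter, List.mem_filter] at hg
    exact ⟨hg.1.1, hg.1.2, by simpa using hg.2⟩
  have hbet : ∀ g ∈ cutOf F a G, E.str.Between i k g.item := fun g hg =>
    FS1.between_of_fitsSeg hS hn hk (ho g (hmem g hg).1) ((hF _).trans (hmem g hg).2.1)
  have hs : (E.str.seg i k).SortedBy i := by
    have := hS.inward i
    rw [FS1.inward_eq hk', Segment.SortedBy, List.pairwise_append, List.pairwise_append] at this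
    exact this.2.1.1
  obtain ⟨t, ht⟩ : ∃ t, t = (performGroups i (E.str.seg i k) (cutOf F a G)).1 := ⟨_, rfl⟩
  obtain ⟨p1, p2, p3, p4, p5, p6, p7, p8, p9⟩ := performGroups_spec i (E.str.Between i k)
    (cutOf F a G) (E.str.seg i k) E.str.toMap (fun g hg => hv g (hmem g hg).1) hbet
    (fun x hx => hS.entry_seg hk' hx) hs _ rfl
  rw [← ht] at p1 p3 p4 p5 p6 p7 p8 p9
  have hbt : ∀ e ∈ t, E.str.Between i k e.1 := by
    intro e he
    rcases p5 e he with h | ⟨g, hg, h⟩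
    · exact hS.between_of_mem hk' h
    · rw [h]; exact hbet g hg
  have hS' := hS.setSeg hk' p1 hbt
  have hFt : ∀ e ∈ t, F e.1 = true := by
    intro e he
    rcases p5 e he with h | ⟨g, hg, h⟩
    · rw [← hF]; exact FS1.fitsSeg_of_mem h
    · rw [h]; exact (hmem g hg).2.1
  refine ⟨t, ?_, hS', ?_, hFt, ?_, p8, p9, ?_, ?_⟩
  · rw [← hcut] at ht p2
    rw [← hrest, ← hcut, ← p2, ht]
    rfl
  · funext x
    have := FS1.toMap_setSeg hk' hS hS' x
    by_cases hx : E.str.Between i k x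
    · rw [this.1 hx, p3 x hx]
    · rw [this.2 (p4 x hx).1, (p4 x hx).2]
  · intro h3 x
    have hl : (E.str.setSeg i k t).fitsLast k x i = E.str.fitsLast k x i := by
      cases i
      · unfold FS1.fitsLast
        simp only
        rw [(hn.setSeg _ _ _).sections_eq, hn.sections_eq]
        congr 1
      · rfl
    rw [Bool.eq_iff_iff, FS1.fitsSeg_iff, hl, FS1.seg_setSeg _ _ hk', if_pos rfl]
    constructor
    · rintro (⟨e, he, hx⟩ | h)
      · rw [← hF]
        exact FS1.fitsSeg_mono hx ((hF _).trans (hFt e he))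
      · rw [← hF, FS1.fitsSeg_iff]
        exact Or.inr h
    · intro h
      rw [← hF, FS1.fitsSeg_iff] at h
      rcases h with ⟨e, he, hx⟩ | h
      · obtain ⟨e', he', h'⟩ := (p6 fun g hg => by rw [(hmem g hg).2.2]; exact h3).1 e he
        exact Or.inl ⟨e', he', by rw [h']; exact hx⟩
      · exact Or.inr h
  · exact fun h2 => p7 fun g hg => by rw [(hmem g hg).2.2]; exact h2
  · have hb : (E.batch.filter (fun g => decide (g.accessType = a))).length ≤ G.length := by
      rw [hG]
      exact (List.length_filter_le _ _).trans (List.length_filter_le _ _)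
    have hlog : Nat.log 2 (E.batch.filter (fun g => decide (g.accessType = a))).length ≤
        G.length := (Nat.log_le_self _ _).trans hb
    unfold execType
    simp only [Costed.tick_log, Costed.pure_log, cost_cons, cost_nil, Prim.bound, hcut]
    cases i <;> simp only [Side.other] <;> omega

/-- Execute the batch on the segment `S_i[k]`, for the access types below `a`. -/
def execTypes (k : ℕ) (i : Side) : ℕ → ExecState N K V → Costed (ExecState N K V)
  | 0, E => .pure E
  | a + 1, E => (execTypes k i a E).bind (execType k i a)

theorem execSegment_eq (k : ℕ) (i : Side) (E : ExecState N K V) :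
    execSegment k i E = execTypes k i 4 E := by
  simp [execSegment, execTypes, Costed.bind, Costed.pure]

/-- The cost of an access depends on the size beforehand, so up to and including the insertions the
segment counts as having at most 3 c(k) items. Only the deletions can meet a segment enlarged by up
to `B` items, which is where the term d log d comes from. -/
theorem execTypes_spec {E : ExecState N K V} {n k : ℕ} {i : Side} {F : K → Bool}
    (hS : E.str.Sorted) (hn : E.str.HasLength n) (hk : k < n)
    (hF : ∀ x, E.str.fitsSeg k x i = F x) (hv : ∀ g ∈ E.batch, g.Valid)
    (ho : ∀ g ∈ E.batch, ∀ j : Side, ∀ e ∈ E.str.outer j k, j.lt e.1 g.item) {B : ℕ}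
    (hi : (E.str.seg i k).length ≤ 3 * cap k)
    (hi' : (E.str.seg i.other k).length ≤ 3 * cap k + B) (hB : E.batch.length ≤ B) :
    ∀ a ≤ 4, ∃ t, (execTypes k i a E).val = ⟨E.str.setSeg i k t, restOf F a E.batch, E.results ++
        seqResults E.str.toMap (callsBelow F a E.batch)⟩ ∧
      (E.str.setSeg i k t).Sorted ∧ (E.str.setSeg i k t).toMap =
        applyCalls E.str.toMap (callsBelow F a E.batch) ∧
      (∀ e ∈ t, F e.1 = true) ∧
      (a ≤ 3 → ∀ x, (E.str.setSeg i k t).fitsSeg k x i = F x) ∧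
      t.length ≤ (E.str.seg i k).length +
        ((List.range a).flatMap fun b => cutOf F b E.batch).length ∧
      (E.str.seg i k).length ≤ t.length +
        ((List.range a).flatMap fun b => cutOf F b E.batch).length ∧
      (a ≤ 2 → t.length ≤ (E.str.seg i k).length) ∧
      cost (execTypes k i a E).log ≤ a * (10 * 2 ^ k + 4 * B + 3) +
        (5 * 2 ^ k + 3) * ((List.range a).flatMap fun b => cutOf F b E.batch).length +
        (callsBelow F a E.batch).length + (if a = 4 then
          (cutOf F 3 E.batch).length * (Nat.log 2 (cutOf F 3 E.batch).length + 1) else 0) := by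
  have hcB : ∀ a, ((List.range a).flatMap fun b => cutOf F b E.batch).length ≤ B := by
    intro a
    refine ((flatMap_filter_range_perm Group.accessType
      (E.batch.filter (fun g => F g.item)) a).length_eq).trans_le ?_
    exact ((List.length_filter_le _ _).trans (List.length_filter_le _ _)).trans hB
  have hk' : k < (E.str.chain i).length := by rw [hn]; exact hk
  intro a
  induction a with
  | zero =>
    intro _
    have hset : E.str.setSeg i k (E.str.seg i k) = E.str := by
      unfold FS1.setSeg
      rw [FS1.seg_eq_getElem hk', List.set_getElem_self]
      cases i <;> rfl
    have hr : restOf F 0 E.batch = E.batch := by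
      rw [restOf, List.filter_eq_self]; simp
    refine ⟨E.str.seg i k, ?_, ?_, ?_, ?_, ?_, ?_, ?_, ?_, ?_⟩
    · simp [execTypes, hset, hr, callsBelow, seqResults]
    · rw [hset]; exact hS
    · rw [hset]; rfl
    · intro e he; rw [← hF]; exact FS1.fitsSeg_of_mem he
    · rw [hset]; exact fun _ => hF
    all_goals simp [execTypes]
  | succ a ih =>
    intro ha
    obtain ⟨t, e1, e2, e3, -, e5, e6, e7, e8, e9⟩ := ih (by omega)
    have hseg : (E.str.setSeg i k t).seg i k = t := by rw [FS1.seg_setSeg _ _ hk', if_pos rfl]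
    obtain ⟨t', f1, f2, f3, f4, f5, f6, f7, f8, f9⟩ := execType_spec
      (E := (execTypes k i a E).val) (n := n) (k := k) (i := i) a (F := F) (G := E.batch)
      (by rw [e1]; exact e2) (by rw [e1]; exact hn.setSeg _ _ _) hk
      (by rw [e1]; exact e5 (by omega)) (by rw [e1]) hv (by
        rw [e1]
        intro g hg j e he
        refine ho g hg j e ?_
        cases i <;> cases j
        · simpa using he
        · exact he
        · exact he
        · simpa using he)
    have hl : ((List.range (a + 1)).flatMap fun b => cutOf F b E.batch) =
        ((List.range a).flatMap fun b => cutOf F b E.batch) ++ cutOf F a E.batch := by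
      rw [List.range_succ, List.flatMap_append, List.flatMap_singleton]
    have hQ : callsBelow F (a + 1) E.batch =
        callsBelow F a E.batch ++ (cutOf F a E.batch).flatMap Group.ops := by
      unfold callsBelow
      rw [hl, List.flatMap_append]
    have hB' := hcB (a + 1)
    rw [hl, List.length_append] at hB'
    rw [hQ, hl]
    simp only [e1, FS1.setSeg_setSeg, hseg, FS1.seg_setSeg_other] at f1 f2 f3 f4 f5 f6 f7 f8 f9
    have hL : (callsBelow F a E.batch ++ (cutOf F a E.batch).flatMap Group.ops).length =
        (callsBelow F a E.batch).length + ((cutOf F a E.batch).map fun g => g.ops.length).sum := by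
      rw [List.length_append, List.length_flatMap]
    rw [hL, List.length_append]
    refine ⟨t', ?_, f2, ?_, f4, fun h => f5 (by omega), by omega, by omega, ?_, ?_⟩
    · simp only [execTypes, Costed.bind_val, e1]
      rw [f1, seqResults_append, e3, List.append_assoc]
    · rw [f3, e3, applyCalls_append]
    · intro h
      exact (f8 (by omega)).trans (e8 (by omega))
    · have h0 : cost (execTypes k i (a + 1) E).log =
          cost (execTypes k i a E).log + cost (execType k i a (execTypes k i a E).val).log := by
        simp [execTypes]
      rw [h0, e1]
      have g1 : Nat.log 2 t.length + 1 ≤ 5 * 2 ^ k + B :=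
        (Nat.add_le_add_right (Nat.log_mono_right (by omega)) 1).trans (log_cap_add_le k B)
      have g2 : Nat.log 2 (E.str.seg i.other k).length + 1 ≤ 5 * 2 ^ k + B :=
        (Nat.add_le_add_right (Nat.log_mono_right hi') 1).trans (log_cap_add_le k B)
      set c := (cutOf F a E.batch).length with hc
      set cs := ((List.range a).flatMap fun b => cutOf F b E.batch).length with hcs
      have e9' : (a + 1) * (10 * 2 ^ k + 4 * B + 3) =
        a * (10 * 2 ^ k + 4 * B + 3) + (10 * 2 ^ k + 4 * B + 3) := by ring
      have e10 : (5 * 2 ^ k + 3) * (cs + c) = (5 * 2 ^ k + 3) * cs + (5 * 2 ^ k + 3) * c := by ring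
      rw [if_neg (by omega)] at e9
      by_cases h3 : a = 3
      -- This is the deletion step, on the enlarged segment.
      · have g3 : c * (Nat.log 2 t.length + 1) ≤
            5 * 2 ^ k * c + c * (Nat.log 2 c + 1) + B + 3 * c := by
          refine le_trans (Nat.mul_le_mul_left c ?_) (mul_log_cap_add_le c B k)
          exact Nat.add_le_add_right (Nat.log_mono_right (by omega)) 1
        rw [if_pos (by omega)]
        subst h3
        rw [← hc]
        rw [e9', e10]
        have : (5 * 2 ^ k + 3) * c = 5 * 2 ^ k * c + 3 * c := by ring
        omega
      · have g3 : c * (Nat.log 2 t.length + 1) ≤ c * (5 * 2 ^ k) :=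
          Nat.mul_le_mul_left c (log_four_cap (by have := e8 (by omega); omega))
        rw [if_neg (by omega), e9', e10]
        have : (5 * 2 ^ k + 3) * c = c * (5 * 2 ^ k) + 3 * c := by ring
        omega

end Exec

end

/-! ### Executing a batch along the sections of a slab -/

section

variable {N : Type w} {K : Type u} {V : Type v}

theorem FS1.HasLength.front {S : FS1 K V} {n : ℕ} (h : S.HasLength n) : S.front.length = n :=
  h .front

theorem FS1.HasLength.back {S : FS1 K V} {n : ℕ} (h : S.HasLength n) : S.back.length = n :=
  h .back

theorem Chain.pot_set_le {ch : Chain K V} {k q : ℕ} {t : Segment K V} (hk : k < ch.length)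
    (h1 : t.length ≤ Chain.size ch k + q) (h2 : Chain.size ch k ≤ t.length + q) :
    Chain.pot (List.set ch k t) ≤ Chain.pot ch + 33152 * 2 ^ k * q := by
  unfold Chain.pot
  rw [List.length_set, ← Finset.add_sum_erase _ _ (Finset.mem_range.mpr hk),
    ← Finset.add_sum_erase (Finset.range ch.length) (fun j => segPot j ch.length (Chain.size ch j))
      (Finset.mem_range.mpr hk)]
  have h3 := segPot_lipschitz k ch.length (Chain.size ch k) t.length q h2 h1
  have h4 : ∑ j ∈ (Finset.range ch.length).erase k,
      segPot j ch.length (Chain.size (List.set ch k t) j) =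
      ∑ j ∈ (Finset.range ch.length).erase k, segPot j ch.length (Chain.size ch j) := by
    refine Finset.sum_congr rfl fun j hj => ?_
    rw [Chain.size_set _ _ _ _ hk, if_neg (Finset.ne_of_mem_erase hj)]
  rw [h4, Chain.size_set _ _ _ _ hk, if_pos rfl]
  linarith

theorem FS1.pot_setSeg_le {S : FS1 K V} {i : Side} {k q : ℕ} {t : Segment K V}
    (hk : k < (S.chain i).length) (h1 : t.length ≤ (S.seg i k).length + q)
    (h2 : (S.seg i k).length ≤ t.length + q) :
    (S.setSeg i k t).pot ≤ S.pot + 33152 * 2 ^ k * q := by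
  have := Chain.pot_set_le hk h1 h2
  unfold pot
  cases i <;> simp only [setSeg, setChain, chain, List.length_set] at * <;> linarith

section Exec

variable [LinearOrder K]

/-- The number of group-operations of type `a`. -/
def typeCount (a : ℕ) (G : List (Group N K V)) : ℕ :=
  (G.filter (fun g => decide (g.accessType = a))).length

omit [LinearOrder K] in
theorem typeCount_eq (F : K → Bool) (a : ℕ) (G : List (Group N K V)) :
    typeCount a G = (cutOf F a G).length + typeCount a (G.filter (fun g => !F g.item)) := by
  induction G with
  | nil => rfl
  | cons g G ih =>
    unfold typeCount cutOf at *
    cases h : F g.item <;> by_cases ha : g.accessType = a <;> simp [h, ha] at * <;> omega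

/-- Calls on the same item occur by increasing type. -/
def TypeOrdered (Q : List (Call N K V)) : Prop :=
  Q.Pairwise (fun c d => c.2.item = d.2.item → c.2.accessType ≤ d.2.accessType)

omit [LinearOrder K] in
theorem MapOp.accessType_le (o : MapOp K V) : o.accessType ≤ 3 := by
  cases o <;> simp [MapOp.accessType]

omit [LinearOrder K] in
theorem Group.Valid.type_le {g : Group N K V} (hg : g.Valid) : g.accessType ≤ 3 := by
  obtain ⟨c, hc⟩ := List.exists_mem_of_ne_nil _ hg.nonempty
  rw [← hg.type c hc]
  exact c.2.accessType_le

omit [LinearOrder K] in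
theorem callsBelow_perm (F : K → Bool) {G : List (Group N K V)} (hv : ∀ g ∈ G, g.Valid) :
    ((List.range 4).flatMap fun b => cutOf F b G).Perm (G.filter (fun g => F g.item)) := by
  refine (flatMap_filter_range_perm Group.accessType (G.filter (fun g => F g.item)) 4).trans ?_
  rw [List.filter_eq_self.mpr]
  intro g hg
  have := (hv g (List.mem_filter.mp hg).1).type_le
  simp; omega

omit [LinearOrder K] in
theorem callsBelow_typeOrdered (F : K → Bool) {G : List (Group N K V)} (hv : ∀ g ∈ G, g.Valid)
    (a : ℕ) : (callsBelow F a G).Pairwise (fun c d => c.2.accessType ≤ d.2.accessType) ∧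
      ∀ c ∈ callsBelow F a G, c.2.accessType < a := by
  induction a with
  | zero => simp [callsBelow]
  | succ a ih =>
    have hQ : callsBelow F (a + 1) G =
        callsBelow F a G ++ (cutOf F a G).flatMap Group.ops := by
      unfold callsBelow
      rw [List.range_succ, List.flatMap_append, List.flatMap_singleton, List.flatMap_append]
    have hc : ∀ c ∈ (cutOf F a G).flatMap Group.ops, c.2.accessType = a := by
      intro c hc
      obtain ⟨g, hg, hc⟩ := List.mem_flatMap.mp hc
      rw [cutOf, List.mem_filter, List.mem_filter] at hg
      rw [(hv g hg.1.1).type c hc]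
      simpa using hg.2
    rw [hQ]
    constructor
    · rw [List.pairwise_append]
      refine ⟨ih.1, List.pairwise_of_forall_mem_list fun c h d h' => ?_, fun c h d h' => ?_⟩
      · rw [hc c h, hc d h']
      · rw [hc d h']; exact (ih.2 c h).le
    · intro c h
      rcases List.mem_append.mp h with h | h
      · have := ih.2 c h; omega
      · rw [hc c h]; omega

/-- The deletions performed here are counted by the drop of `typeCount 3`, and `Λ` bounds their
logarithm uniformly, so these terms telescope along the slab. The coefficient of the other accesses
is 33152 for the potential plus 5 + 3 for the work. -/
theorem execSegment_spec {E : ExecState N K V} {n k : ℕ} (i : Side) {F : K → Bool}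
    (hS : E.str.Sorted) (hn : E.str.HasLength n) (hk : k < n)
    (hF : ∀ x, E.str.fitsSeg k x i = F x) (hv : ∀ g ∈ E.batch, g.Valid)
    (ho : ∀ g ∈ E.batch, ∀ j : Side, ∀ e ∈ E.str.outer j k, j.lt e.1 g.item) {B Λ : ℕ}
    (hi : (E.str.seg i k).length ≤ 3 * cap k)
    (hi' : (E.str.seg i.other k).length ≤ 3 * cap k + B) (hB : E.batch.length ≤ B)
    (hΛ : Nat.log 2 (typeCount 3 E.batch) + 1 ≤ Λ) :
    ∃ t Q, (execSegment k i E).val =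
        ⟨E.str.setSeg i k t, E.batch.filter (fun g => !F g.item),
          E.results ++ seqResults E.str.toMap Q⟩ ∧
      (E.str.setSeg i k t).Sorted ∧ (E.str.setSeg i k t).toMap = applyCalls E.str.toMap Q ∧
      Q.Perm ((E.batch.filter (fun g => F g.item)).flatMap Group.ops) ∧ TypeOrdered Q ∧
      (∀ e ∈ t, F e.1 = true) ∧
      t.length ≤ (E.str.seg i k).length + (E.batch.filter (fun g => F g.item)).length ∧
      cost (execSegment k i E).log + (E.str.setSeg i k t).pot ≤ E.str.pot +
        4 * (10 * 2 ^ k + 4 * B + 3) +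
        33160 * 2 ^ k * (E.batch.filter (fun g => F g.item)).length + Q.length +
        ((typeCount 3 E.batch : ℝ) - typeCount 3 (E.batch.filter (fun g => !F g.item))) * Λ := by
  obtain ⟨t, e1, e2, e3, e4, -, e6, e7, -, e9⟩ :=
    execTypes_spec hS hn hk hF hv ho hi hi' hB 4 le_rfl
  have hp := callsBelow_perm F hv
  have hrest : restOf F 4 E.batch = E.batch.filter (fun g => !F g.item) := by
    refine List.filter_congr fun g hg => ?_
    have := (hv g hg).type_le
    cases F g.item <;> simp; omega
  rw [hp.length_eq] at e6 e7 e9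
  have hto : TypeOrdered (callsBelow F 4 E.batch) := by
    unfold TypeOrdered
    refine List.Pairwise.imp ?_ (callsBelow_typeOrdered F hv 4).1
    intro c d h _
    exact h
  refine ⟨t, callsBelow F 4 E.batch, ?_, e2, e3, hp.flatMap_right _, hto, e4, e6, ?_⟩
  · rw [execSegment_eq, e1, hrest]
  · have h1 := FS1.pot_setSeg_le (by rw [hn]; exact hk) e6 e7
    rw [← execSegment_eq, if_pos rfl] at e9
    have h2 := typeCount_eq F 3 E.batch
    have h3 : (cutOf F 3 E.batch).length * (Nat.log 2 (cutOf F 3 E.batch).length + 1) ≤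
        (cutOf F 3 E.batch).length * Λ :=
      Nat.mul_le_mul_left _ ((Nat.add_le_add_right (Nat.log_mono_right (by omega)) 1).trans hΛ)
    set p := (E.batch.filter (fun g => F g.item)).length
    have h4 : cost (execSegment k i E).log ≤ 4 * (10 * 2 ^ k + 4 * B + 3) + (5 * 2 ^ k + 3) * p +
      (callsBelow F 4 E.batch).length + (cutOf F 3 E.batch).length * Λ := by omega
    have h5 : (cost (execSegment k i E).log : ℝ) ≤ 4 * (10 * 2 ^ k + 4 * B + 3) +
      (5 * 2 ^ k + 3) * p + (callsBelow F 4 E.batch).length + (cutOf F 3 E.batch).length * Λ := by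
      exact_mod_cast h4
    have h6 : ((typeCount 3 E.batch : ℝ) - typeCount 3 (E.batch.filter (fun g => !F g.item))) =
        (cutOf F 3 E.batch).length := by rw [h2]; push_cast; ring
    rw [h6]
    have h7 : (p : ℝ) ≤ 2 ^ k * p := le_mul_of_one_le_left (by positivity)
      (one_le_pow₀ (by norm_num))
    linarith

/-- The state of the execution phase when it arrives at section `S[k]`. -/
structure ExecInv (S : FS1 K V) (n k : ℕ) (E : ExecState N K V) : Prop where
  sorted : E.str.Sorted
  hasLength : E.str.HasLength n
  seg_eq : ∀ i j, k ≤ j → E.str.seg i j = S.seg i j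
  outer_lt : ∀ x, k ≤ S.fitIdx x → ∀ i : Side, ∀ e ∈ E.str.outer i k, i.lt e.1 x
  valid : ∀ g ∈ E.batch, g.Valid
  le_fitIdx : ∀ g ∈ E.batch, k ≤ S.fitIdx g.item

theorem not_fitsSeg_of_lt {S : FS1 K V} {k : ℕ} {x : K} (h : k < S.fitIdx x) (i : Side) :
    S.fitsSeg k x i = false := by
  have := FS1.not_fitsSection_of_lt h
  rw [FS1.fitsSection, Bool.or_eq_false_iff] at this
  cases i
  · exact this.1
  · exact this.2

theorem lt_of_fitsSeg {S : FS1 K V} {k : ℕ} {x y : K} {i : Side} (h : k < S.fitIdx x)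
    (hy : S.fitsSeg k y i = true) : i.lt y x := by
  intro hle
  have := FS1.fitsSeg_mono hle hy
  rw [not_fitsSeg_of_lt h] at this
  exact absurd this (by simp)

/-- For an empty batch the sections passed over are unchanged, and items that fit further inside lie
inward of everything stored in them. -/
theorem ExecInv.advance {S : FS1 K V} {n k : ℕ} {E : ExecState N K V} (h : ExecInv S n k E)
    (hE : E.batch = []) (d : ℕ) (hd : k + d ≤ n) : ExecInv S n (k + d) E := by
  induction d with
  | zero => exact h
  | succ d ih =>
    have ih := ih (by omega)
    refine ⟨ih.sorted, ih.hasLength, fun i j hj => ih.seg_eq i j (by omega), ?_, ih.valid, ?_⟩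
    · intro x hx i e he
      rw [← add_assoc, FS1.outer_succ (by rw [ih.hasLength]; omega), List.mem_append] at he
      rcases he with he | he
      · exact ih.outer_lt x (by omega) i e he
      · rw [ih.seg_eq i _ le_rfl] at he
        exact lt_of_fitsSeg (by omega) (FS1.fitsSeg_of_mem he)
    · simp [hE]

theorem execSection_spec {S : FS1 K V} {E : ExecState N K V} {n k : ℕ} (hSn : S.HasLength n)
    (hk : k < n) (h : ExecInv S n k E) (hs : ∀ i, (S.seg i k).length ≤ 3 * cap k) {Λ : ℕ}
    (hΛ : Nat.log 2 (typeCount 3 E.batch) + 1 ≤ Λ) (hne : E.batch ≠ [])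
    (r : Costed (ExecState N K V))
    (hr : r = (execSegment k .front E).bind fun E => execSegment k .back E) :
    ∃ Q, ExecInv S n (k + 1) r.val ∧
      r.val.batch = E.batch.filter (fun g => !S.fitsSection k g.item) ∧
      r.val.results = E.results ++ seqResults E.str.toMap Q ∧
      r.val.str.toMap = applyCalls E.str.toMap Q ∧
      Q.Perm ((E.batch.filter (fun g => S.fitsSection k g.item)).flatMap Group.ops) ∧
      TypeOrdered Q ∧ (∀ i j, j ≠ k → r.val.str.seg i j = E.str.seg i j) ∧
      cost r.log + r.val.str.pot ≤ E.str.pot + 33300 * 2 ^ k * E.batch.length + Q.length +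
        ((typeCount 3 E.batch : ℝ) - typeCount 3 r.val.batch) * Λ := by
  -- In the last section, fitting in the front segment also depends on the back segment. The front
  -- is treated first, while the back segment is still the original one; fitting in the back segment
  -- depends on that segment only.
  have hf1 : ∀ x, E.str.fitsSeg k x .front = S.fitsSeg k x .front := by
    intro x
    unfold FS1.fitsSeg
    simp only
    rw [h.seg_eq _ _ le_rfl, h.seg_eq _ _ le_rfl, h.hasLength.sections_eq, hSn.sections_eq]
  obtain ⟨t, Q, a1, a2, a3, a4, a5, a6, a7, a8⟩ := execSegment_spec (B := E.batch.length) .front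
    h.sorted h.hasLength hk hf1 h.valid (fun g hg => h.outer_lt _ (h.le_fitIdx g hg))
    (by rw [h.seg_eq _ _ le_rfl]; exact hs _)
    (by rw [h.seg_eq _ _ le_rfl]; exact (hs _).trans (by omega)) le_rfl hΛ
  obtain ⟨E₁, hE₁⟩ : ∃ E₁, E₁ = (execSegment k .front E).val := ⟨_, rfl⟩
  rw [← hE₁] at a1
  have hkc : ∀ i, k < (E.str.chain i).length := fun i => by rw [h.hasLength]; exact hk
  have hn₁ : E₁.str.HasLength n := by rw [a1]; exact h.hasLength.setSeg _ _ _
  have hsegb : ∀ j, E₁.str.seg .back j = E.str.seg .back j := by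
    intro j; rw [a1]; rfl
  have hsegf : ∀ j, E₁.str.seg .front j = if j = k then t else E.str.seg .front j := by
    intro j; rw [a1]; exact FS1.seg_setSeg E.str .front (hkc _) t j
  have houtf : E₁.str.outer .front k = E.str.outer .front k := by rw [a1]; simp
  have houtb : ∀ j, E₁.str.outer .back j = E.str.outer .back j := by intro j; rw [a1]; rfl
  have hf2 : ∀ x, E₁.str.fitsSeg k x .back = S.fitsSeg k x .back := by
    intro x
    unfold FS1.fitsSeg
    simp only
    rw [hsegb, h.seg_eq _ _ le_rfl]
  have hb₁ : E₁.batch = E.batch.filter (fun g => !S.fitsSeg k g.item .front) := by rw [a1]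
  have hsub : ∀ g ∈ E₁.batch, g ∈ E.batch := by
    intro g hg; rw [hb₁] at hg; exact (List.mem_filter.mp hg).1
  have hbl : E₁.batch.length ≤ E.batch.length := by rw [hb₁]; exact List.length_filter_le _ _
  have hfl : (E.batch.filter (fun g => S.fitsSeg k g.item .front)).length ≤ E.batch.length :=
    List.length_filter_le _ _
  have ho₁ : ∀ x, k ≤ S.fitIdx x → ∀ j : Side, ∀ e ∈ E₁.str.outer j k, j.lt e.1 x := by
    intro x hx j e he
    cases j
    · rw [houtf] at he; exact h.outer_lt x hx _ e he
    · rw [houtb] at he; exact h.outer_lt x hx _ e he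
  have htc : typeCount 3 E₁.batch ≤ typeCount 3 E.batch := by
    rw [hb₁, typeCount_eq (fun x => S.fitsSeg k x .front) 3 E.batch]; omega
  obtain ⟨t', Q', b1, b2, b3, b4, b5, b6, b7, b8⟩ := execSegment_spec (E := E₁)
    (B := E.batch.length) .back
    (by rw [a1]; exact a2) hn₁ hk hf2 (fun g hg => h.valid g (hsub g hg))
    (fun g hg => ho₁ _ (h.le_fitIdx g (hsub g hg)))
    (by rw [hsegb, h.seg_eq _ _ le_rfl]; exact hs _)
    (by
      change (E₁.str.seg .front k).length ≤ _
      rw [hsegf, if_pos rfl]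
      have := hs .front
      rw [h.seg_eq _ _ le_rfl] at a7
      omega) hbl
    ((Nat.add_le_add_right (Nat.log_mono_right htc) 1).trans hΛ)
  have hrv : r.val = (execSegment k .back E₁).val := by rw [hr, hE₁]; rfl
  have hrl : cost r.log =
      cost (execSegment k .front E).log + cost (execSegment k .back E₁).log := by
    rw [hr, hE₁]; simp
  rw [← hrv] at b1
  have hkc₁ : ∀ i, k < (E₁.str.chain i).length := fun i => by rw [hn₁]; exact hk
  have hbr : r.val.batch = E.batch.filter (fun g => !S.fitsSection k g.item) := by
    rw [b1]
    simp only
    rw [hb₁, List.filter_filter]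
    refine List.filter_congr fun g _ => ?_
    unfold FS1.fitsSection
    cases S.fitsSeg k g.item .front <;> cases S.fitsSeg k g.item .back <;> rfl
  have hmap₁ : E₁.str.toMap = applyCalls E.str.toMap Q := by rw [a1]; exact a3
  have hseg : ∀ i j, r.val.str.seg i j =
      if j = k then (match i with | .front => t | .back => t') else E.str.seg i j := by
    intro i j
    rw [b1]
    cases i
    · change E₁.str.seg .front j = _
      rw [hsegf]
    · simp only
      rw [FS1.seg_setSeg _ _ (hkc₁ _), hsegb]
  have hnr : r.val.str.HasLength n := by rw [b1]; exact hn₁.setSeg _ _ _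
  have houtr : ∀ i, r.val.str.outer i k = E.str.outer i k := by
    intro i
    rw [b1]
    cases i
    · rw [← houtf]; rfl
    · simp only [FS1.outer_setSeg]; exact houtb k
  refine ⟨Q ++ Q', ⟨by rw [b1]; exact b2, hnr, ?_, ?_, ?_, ?_⟩, hbr, ?_, ?_, ?_, ?_, ?_, ?_⟩
  · intro i j hj
    rw [hseg, if_neg (by omega), h.seg_eq i j (by omega)]
  · intro x hx i e he
    rw [FS1.outer_succ (by rw [hnr]; exact hk), List.mem_append, houtr, hseg, if_pos rfl] at he
    rcases he with he | he
    · exact h.outer_lt x (by omega) i e he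
    · refine lt_of_fitsSeg (S := S) (k := k) (by omega) ?_
      cases i
      · exact a6 e he
      · exact b6 e he
  · intro g hg
    rw [hbr] at hg
    exact h.valid g (List.mem_filter.mp hg).1
  · intro g hg
    rw [hbr, List.mem_filter] at hg
    exact FS1.lt_fitIdx hSn (by omega) (h.le_fitIdx g hg.1) (by simpa using hg.2)
  · rw [b1]
    simp only
    rw [hmap₁, seqResults_append, a1, List.append_assoc]
  · rw [b1, applyCalls_append]
    simp only
    rw [b3, hmap₁]
  · refine (a4.append b4).trans ?_
    rw [← List.flatMap_append]
    refine List.Perm.flatMap_right _ ?_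
    rw [hb₁]
    have h1 : E.batch.filter (fun g => S.fitsSeg k g.item .front) =
        (E.batch.filter (fun g => S.fitsSection k g.item)).filter
          (fun g => S.fitsSeg k g.item .front) := by
      rw [List.filter_filter]
      refine List.filter_congr fun g _ => ?_
      unfold FS1.fitsSection
      cases S.fitsSeg k g.item .front <;> simp
    have h2 : (E.batch.filter (fun g => !S.fitsSeg k g.item .front)).filter
        (fun g => S.fitsSeg k g.item .back) =
        (E.batch.filter (fun g => S.fitsSection k g.item)).filter
          (fun g => !S.fitsSeg k g.item .front) := by
      rw [List.filter_filter, List.filter_filter]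
      refine List.filter_congr fun g _ => ?_
      unfold FS1.fitsSection
      cases S.fitsSeg k g.item .front <;> simp
    rw [h1, h2]
    exact List.filter_append_perm _ _
  · unfold TypeOrdered
    rw [List.pairwise_append]
    refine ⟨a5, b5, fun c hc d hd hcd => ?_⟩
    -- Items of `Q` fit in the front segment, and those of `Q'` were left over because they do not.
    exfalso
    obtain ⟨g, hg, hc⟩ := List.mem_flatMap.mp (a4.mem_iff.mp hc)
    obtain ⟨g', hg', hd⟩ := List.mem_flatMap.mp (b4.mem_iff.mp hd)
    rw [hb₁] at hg'
    rw [List.mem_filter] at hg hg'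
    rw [List.mem_filter] at hg'
    have h1 := (h.valid g hg.1).item c hc
    have h2 := (h.valid g' hg'.1.1).item d hd
    have h3 := hg'.1.2
    rw [← h2, ← hcd, h1, hg.2] at h3
    exact absurd h3 (by simp)
  · intro i j hj
    rw [hseg, if_neg hj]
  · have hpot : r.val.str.pot = (E₁.str.setSeg .back k t').pot := by rw [b1]
    have hpot₁ : E₁.str.pot = (E.str.setSeg .front k t).pot := by rw [a1]
    have hb₂ : E₁.batch.filter (fun g => !S.fitsSeg k g.item .back) = r.val.batch := by rw [b1]
    have hlen : (E.batch.filter (fun g => S.fitsSeg k g.item .front)).length +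
        (E₁.batch.filter (fun g => S.fitsSeg k g.item .back)).length ≤ E.batch.length := by
      have h1 := List.length_filter_le (fun g => S.fitsSeg k g.item .back) E₁.batch
      have h2 := List.length_eq_length_filter_add (l := E.batch)
        (fun g => S.fitsSeg k g.item .front)
      rw [hb₁] at h1 ⊢
      omega
    have hlen' : ((E.batch.filter (fun g => S.fitsSeg k g.item .front)).length : ℝ) +
        (E₁.batch.filter (fun g => S.fitsSeg k g.item .back)).length ≤ E.batch.length := by
      exact_mod_cast hlen
    -- A nonempty batch absorbs the fixed costs of the two segments: 2 * 4 * (10 + 4 + 3) = 136, and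
    -- 33160 + 136 ≤ 33300.
    have hone : (1 : ℝ) ≤ E.batch.length := by
      exact_mod_cast List.length_pos_iff.mpr hne
    have htwo : (1 : ℝ) ≤ 2 ^ k := one_le_pow₀ (by norm_num)
    rw [hb₂, ← hpot, hpot₁] at b8
    rw [← hb₁] at a8
    rw [hrl, List.length_append]
    have h1 : (2 : ℝ) ^ k * ((E.batch.filter (fun g => S.fitsSeg k g.item .front)).length +
        (E₁.batch.filter (fun g => S.fitsSeg k g.item .back)).length) ≤
          2 ^ k * E.batch.length := mul_le_mul_of_nonneg_left hlen' (zero_le_one.trans htwo)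
    have h2 : (2 : ℝ) ^ k ≤ 2 ^ k * E.batch.length := le_mul_of_one_le_right (zero_le_one.trans htwo) hone
    have h3 : (E.batch.length : ℝ) ≤ 2 ^ k * E.batch.length :=
      le_mul_of_one_le_left (Nat.cast_nonneg _) htwo
    push_cast
    linarith

/-! ## Executing a batch on a slab -/

/-- What a group-operation can still spend when the execution phase arrives at section `S[k]`. -/
noncomputable def credit (S : FS1 K V) (k : ℕ) (g : Group N K V) : ℕ :=
  g.ops.length * (2 ^ (S.fitIdx g.item + 1) - 2 ^ k)

/-- The difference 2^(fitIdx + 1) - 2^k is the sum of 2^j over the sections k ≤ j ≤ fitIdx that an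
operation still visits. Passing section k therefore releases at least 2^k per group, and at least
one unit per call that is returned there. -/
theorem credit_sum_step {S : FS1 K V} {k : ℕ} (G : List (Group N K V))
    (hv : ∀ g ∈ G, g.Valid) (hk : ∀ g ∈ G, k ≤ S.fitIdx g.item) {F : K → Bool}
    (hF : ∀ g ∈ G, F g.item = false → k + 1 ≤ S.fitIdx g.item) :
    2 ^ k * G.length + ((G.filter (fun g => !F g.item)).map (credit S (k + 1))).sum ≤
      (G.map (credit S k)).sum ∧
    ((G.filter (fun g => F g.item)).flatMap Group.ops).length +
      ((G.filter (fun g => !F g.item)).map (credit S (k + 1))).sum ≤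
      (G.map (credit S k)).sum := by
  induction G with
  | nil => simp
  | cons g G ih =>
    obtain ⟨i1, i2⟩ := ih (fun g hg => hv g (by simp [hg])) (fun g hg => hk g (by simp [hg]))
      (fun g hg => hF g (by simp [hg]))
    have h1 : 1 ≤ g.ops.length := List.length_pos_iff.mpr (hv g (by simp)).nonempty
    have h2 := hk g (by simp)
    have h3 : 2 ^ (k + 1) ≤ 2 ^ (S.fitIdx g.item + 1) := Nat.pow_le_pow_right (by norm_num) (by omega)
    have h4 : 2 ^ (k + 1) = 2 * 2 ^ k := by ring
    have h5 : 1 ≤ 2 ^ k := Nat.one_le_two_pow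
    rw [List.map_cons, List.sum_cons, List.length_cons]
    cases hf : F g.item
    · rw [List.filter_cons_of_pos (by simp [hf]), List.filter_cons_of_neg (by simp [hf]),
        List.map_cons, List.sum_cons]
      have h6 : credit S (k + 1) g + 2 ^ k ≤ credit S k g := by
        have h7 := hF g (by simp) hf
        unfold credit
        obtain ⟨d, hd⟩ : ∃ d, 2 ^ (S.fitIdx g.item + 1) = 2 ^ (k + 1) + d :=
          ⟨_, (Nat.add_sub_of_le h3).symm⟩
        rw [hd, show 2 ^ (k + 1) + d - 2 ^ (k + 1) = d by omega,
          show 2 ^ (k + 1) + d - 2 ^ k = 2 ^ k + d by omega]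
        nlinarith
      constructor
      · rw [mul_add, mul_one]; omega
      · omega
    · rw [List.filter_cons_of_neg (by simp [hf]), List.filter_cons_of_pos (by simp [hf]),
        List.flatMap_cons, List.length_append]
      have h6 : g.ops.length * 2 ^ k ≤ credit S k g := Nat.mul_le_mul_left _ (by omega)
      have h7 : 2 ^ k ≤ g.ops.length * 2 ^ k := Nat.le_mul_of_pos_left _ h1
      have h8 : g.ops.length ≤ g.ops.length * 2 ^ k := Nat.le_mul_of_pos_right _ (by omega)
      constructor
      · rw [mul_add, mul_one]; omega
      · omega

/-- The credits pay for the work and the potential, and, as every executed section uses up at least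
one unit, they also bound the number of sections that are not skipped. Calls on one item are all
treated in one section, so their order by type is kept. -/
theorem execSlab_spec {S : FS1 K V} {n Λ : ℕ} (hSn : S.HasLength n)
    (hs : ∀ i k, (S.seg i k).length ≤ 3 * cap k) :
    ∀ (d k : ℕ) (E : ExecState N K V), ExecInv S n k E → k + d ≤ n →
      (∀ g ∈ E.batch, S.fitIdx g.item < k + d) →
      Nat.log 2 (typeCount 3 E.batch) + 1 ≤ Λ →
      ∀ r, r = execSlab d k E → ∃ Q, ExecInv S n (k + d) r.val.1 ∧ r.val.1.batch = [] ∧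
        r.val.1.results = E.results ++ seqResults E.str.toMap Q ∧
        r.val.1.str.toMap = applyCalls E.str.toMap Q ∧
        Q.Perm (E.batch.flatMap Group.ops) ∧ TypeOrdered Q ∧
        k ≤ r.val.2 ∧ r.val.2 ≤ k + d ∧ r.val.2 ≤ k + (E.batch.map (credit S k)).sum ∧
        (∀ i j, (j < k ∨ r.val.2 ≤ j) → r.val.1.str.seg i j = E.str.seg i j) ∧
        cost r.log + r.val.1.str.pot ≤ E.str.pot + 33305 * (E.batch.map (credit S k)).sum +
          (typeCount 3 E.batch : ℝ) * Λ := by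
  intro d
  induction d with
  | zero =>
    intro k E h hd hk hΛ r hr
    have hE : E.batch = [] := by
      rw [List.eq_nil_iff_forall_not_mem]
      intro g hg
      have := hk g hg
      have := h.le_fitIdx g hg
      omega
    subst hr
    refine ⟨[], h, hE, by simp [execSlab, seqResults], by simp [execSlab], by simp [hE],
      List.Pairwise.nil, le_rfl, le_rfl, by simp [execSlab], fun i j _ => rfl, ?_⟩
    simp [execSlab, hE, typeCount]
  | succ d ih =>
    intro k E h hd hk hΛ r hr
    unfold execSlab at hr
    by_cases hE : E.batch = []
    · rw [if_pos (by simp [hE])] at hr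
      subst hr
      refine ⟨[], h.advance hE _ hd, hE, by simp [seqResults], by simp, by simp [hE],
        List.Pairwise.nil, le_rfl, by simp, by simp, fun i j _ => rfl, ?_⟩
      simp [hE, typeCount]
    · rw [if_neg (by simpa using hE)] at hr
      obtain ⟨s, hs'⟩ : ∃ s, s = (execSegment k .front E).bind fun E => execSegment k .back E :=
        ⟨_, rfl⟩
      obtain ⟨Q, a1, a2, a3, a4, a5, a6, a7, a8⟩ :=
        execSection_spec hSn (by omega) h (fun i => hs i k) hΛ hE s hs'
      have htc : typeCount 3 s.val.batch ≤ typeCount 3 E.batch := by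
        rw [a2, typeCount_eq (fun x => S.fitsSection k x) 3 E.batch]; omega
      obtain ⟨Q', b1, b2, b3, b4, b5, b6, b7, b8, b9, b10, b11⟩ := ih (k + 1) s.val a1 (by omega)
        (fun g hg => by
          rw [a2] at hg
          have := hk g (List.mem_filter.mp hg).1
          omega)
        ((Nat.add_le_add_right (Nat.log_mono_right htc) 1).trans hΛ) _ rfl
      have hrv : r.val = (execSlab d (k + 1) s.val).val := by rw [hr, hs']; rfl
      have hrl : cost r.log = (Nat.log 2 E.batch.length + 1) + cost s.log +
          cost (execSlab d (k + 1) s.val).log := by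
        rw [hr, hs']; simp [Prim.bound]; ring
      obtain ⟨c1, c2⟩ := credit_sum_step (S := S) (k := k) E.batch h.valid h.le_fitIdx
        (F := fun x => S.fitsSection k x)
        (fun g hg hf => FS1.lt_fitIdx hSn (by omega) (h.le_fitIdx g hg) hf)
      rw [← a2] at c1 c2
      have hone : 1 ≤ E.batch.length := List.length_pos_iff.mpr hE
      have h2k : 1 ≤ 2 ^ k := Nat.one_le_two_pow
      have h2l : E.batch.length ≤ 2 ^ k * E.batch.length := Nat.le_mul_of_pos_left _ (by omega)
      rw [hrv]
      refine ⟨Q ++ Q', by rw [show k + (d + 1) = k + 1 + d by ring]; exact b1, b2, ?_, ?_, ?_, ?_,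
        by omega, by omega, by omega, ?_, ?_⟩
      · rw [b3, a3, a4, seqResults_append, List.append_assoc]
      · rw [b4, a4, applyCalls_append]
      · refine (a5.append b5).trans ?_
        rw [← List.flatMap_append, a2]
        exact (List.filter_append_perm _ _).flatMap_right _
      · unfold TypeOrdered
        rw [List.pairwise_append]
        refine ⟨a6, b6, fun c hc d hd hcd => ?_⟩
        exfalso
        obtain ⟨g, hg, hc⟩ := List.mem_flatMap.mp (a5.mem_iff.mp hc)
        obtain ⟨g', hg', hd⟩ := List.mem_flatMap.mp (b5.mem_iff.mp hd)
        rw [a2] at hg'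
        rw [List.mem_filter] at hg hg'
        have h1 := (h.valid g hg.1).item c hc
        have h2 := (h.valid g' hg'.1).item d hd
        have h3 := hg'.2
        rw [← h2, ← hcd, h1, hg.2] at h3
        exact absurd h3 (by simp)
      · intro i j hj
        rw [b10 i j (by omega), a7 i j (by omega)]
      · have hlog : Nat.log 2 E.batch.length ≤ E.batch.length := Nat.log_le_self _ _
        have d1 : (cost r.log : ℝ) = (Nat.log 2 E.batch.length + 1) + cost s.log +
          cost (execSlab d (k + 1) s.val).log := by exact_mod_cast hrl
        have d2 : (Nat.log 2 E.batch.length : ℝ) + 1 ≤ 2 * (2 ^ k * E.batch.length) := by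
          have : Nat.log 2 E.batch.length + 1 ≤ 2 * (2 ^ k * E.batch.length) := by omega
          exact_mod_cast this
        have d3 : (2 : ℝ) ^ k * E.batch.length + (s.val.batch.map (credit S (k + 1))).sum ≤
          (E.batch.map (credit S k)).sum := by exact_mod_cast c1
        have d4 : (Q.length : ℝ) + (s.val.batch.map (credit S (k + 1))).sum ≤
          (E.batch.map (credit S k)).sum := by
          rw [a5.length_eq]; exact_mod_cast c2
        have d5 : (0 : ℝ) ≤ (s.val.batch.map (credit S (k + 1))).sum := Nat.cast_nonneg _
        have d6 : (0 : ℝ) ≤ (2 : ℝ) ^ k * E.batch.length := by positivity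
        rw [d1]
        linarith

end Exec

end

/-! ### Tags and cost of the preliminary phase -/

section

variable {N : Type w} {K : Type u} {V : Type v} [LinearOrder K]

/-! ## The preliminary phase -/

/-- The tag of a call after the sections before `S[k]` were searched. -/
noncomputable def tagUpTo (S : FS1 K V) (k : ℕ) (c : Call N K V) : Tag :=
  if S.fitIdx c.2.item < k then
    if ((S.seg .front (S.fitIdx c.2.item)).entry c.2.item).isSome ∨
        ((S.seg .back (S.fitIdx c.2.item)).entry c.2.item).isSome then .found else .absent
  else .pending

theorem tagUpTo_eq_pending {S : FS1 K V} {k : ℕ} {c : Call N K V} :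
    tagUpTo S k c = .pending ↔ k ≤ S.fitIdx c.2.item := by
  unfold tagUpTo
  split_ifs with h h' <;> simp <;> omega

theorem tagSection_map {S : FS1 K V} {n : ℕ} (hn : S.HasLength n) (h1 : 1 ≤ n) (k : ℕ)
    (B : List (Call N K V)) :
    tagSection S k (B.map fun c => (c, tagUpTo S k c)) = B.map fun c => (c, tagUpTo S (k + 1) c) := by
  unfold tagSection
  rw [List.map_map]
  refine List.map_congr_left fun c _ => ?_
  simp only [Function.comp_apply, tagUpTo_eq_pending]
  by_cases h : k ≤ S.fitIdx c.2.item
  · by_cases hf : S.fitsSection k c.2.item = true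
    · have hk : S.fitIdx c.2.item = k := le_antisymm (Nat.sInf_le hf) h
      rw [if_pos ⟨h, hf⟩]
      unfold tagUpTo
      rw [hk, if_pos (show k < k + 1 by omega)]
    · have hk := FS1.lt_fitIdx hn h1 h (by simpa using hf)
      rw [if_neg (fun h => hf h.2), tagUpTo_eq_pending.mpr h, tagUpTo_eq_pending.mpr hk]
  · rw [if_neg (fun h' => h h'.1)]
    unfold tagUpTo
    rw [if_pos (show S.fitIdx c.2.item < k by omega),
      if_pos (show S.fitIdx c.2.item < k + 1 by omega)]

-- The counterpart of `credit_sum_step` for single calls: each pending call pays 2^k in section k.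
omit [LinearOrder K] in
theorem sum_pow_sub_step (f : Call N K V → ℕ) (k : ℕ) (B : List (Call N K V)) :
    2 ^ k * (B.filter (fun c => decide (k ≤ f c))).length +
      (B.map fun c => 2 ^ (f c + 1) - 2 ^ (k + 1)).sum ≤ (B.map fun c => 2 ^ (f c + 1) - 2 ^ k).sum := by
  induction B with
  | nil => simp
  | cons c B ih =>
    have h4 : 2 ^ (k + 1) = 2 * 2 ^ k := by ring
    rw [List.map_cons, List.map_cons, List.sum_cons, List.sum_cons]
    by_cases h : k ≤ f c
    · have h3 : 2 ^ (k + 1) ≤ 2 ^ (f c + 1) := Nat.pow_le_pow_right (by norm_num) (by omega)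
      rw [List.filter_cons_of_pos (by simpa using h), List.length_cons, mul_add, mul_one]
      omega
    · rw [List.filter_cons_of_neg (by simpa using h)]
      omega

/-- The two searches cost at most 5 * 2^k per pending operation each. The remaining fixed and linear
costs are at most four units per pending operation, as there is at least one; this gives the factor
14. -/
theorem preliminary_spec {S : FS1 K V} {n : ℕ} (hn : S.HasLength n) (h1 : 1 ≤ n)
    (hs : ∀ i k, (S.seg i k).length ≤ 3 * cap k) (B : List (Call N K V)) (d k : ℕ) :
    (preliminary S d k (B.map fun c => (c, tagUpTo S k c))).val =
        B.map (fun c => (c, tagUpTo S (k + d) c)) ∧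
      cost (preliminary S d k (B.map fun c => (c, tagUpTo S k c))).log ≤
        14 * (B.map fun c => 2 ^ (S.fitIdx c.2.item + 1) - 2 ^ k).sum := by
  induction d generalizing k with
  | zero => exact ⟨rfl, by simp [preliminary]⟩
  | succ d ih =>
    have hp : (pendingOps (B.map fun c => (c, tagUpTo S k c))).length =
        (B.filter (fun c => decide (k ≤ S.fitIdx c.2.item))).length := by
      unfold pendingOps
      rw [List.filter_map, List.length_map]
      congr 1
      refine List.filter_congr fun c _ => ?_
      simp only [Function.comp_apply, tagUpTo_eq_pending]
    unfold preliminary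
    rw [hp, tagSection_map hn h1]
    by_cases h : (B.filter (fun c => decide (k ≤ S.fitIdx c.2.item))).length = 0 ∨ S.sections ≤ k
    · rw [if_pos h]
      refine ⟨?_, by simp⟩
      have hlt : ∀ c ∈ B, S.fitIdx c.2.item < k := by
        intro c hc
        rcases h with h | h
        · rw [List.length_eq_zero_iff, List.filter_eq_nil_iff] at h
          simpa using h c hc
        · rw [hn.sections_eq] at h
          exact (FS1.fitIdx_lt hn h1 _).trans_le h
      refine List.map_congr_left fun c hc => ?_
      have := hlt c hc
      unfold tagUpTo
      rw [if_pos this, if_pos (show S.fitIdx c.2.item < k + (d + 1) by omega)]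
    · rw [if_neg h]
      obtain ⟨i1, i2⟩ := ih (k + 1)
      refine ⟨?_, ?_⟩
      · simp only [Costed.tick_val]
        rw [i1, show k + 1 + d = k + (d + 1) by ring]
      · simp only [Costed.tick_log, cost_cons, Prim.bound]
        have h2 := sum_pow_sub_step (fun c => S.fitIdx c.2.item) k B
        set p := (B.filter (fun c => decide (k ≤ S.fitIdx c.2.item))).length
        have hl : ∀ i, p * (Nat.log 2 (S.seg i k).length + 1) ≤ 5 * (2 ^ k * p) := fun i => by
          have := Nat.mul_le_mul_left p (log_four_cap (k := k) (n := (S.seg i k).length)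
            ((hs i k).trans (by omega)))
          linarith
        have h3 := hl .front
        have h4 := hl .back
        have h5 : p ≤ 2 ^ k * p := Nat.le_mul_of_pos_left _ (by positivity)
        omega

theorem toMap_isSome_iff {S : FS1 K V} {n : ℕ} (hn : S.HasLength n) (h1 : 1 ≤ n)
    (hS : S.Sorted) (x : K) : (((S.seg .front (S.fitIdx x)).entry x).isSome ∨
      ((S.seg .back (S.fitIdx x)).entry x).isSome) ↔ (S.toMap x).isSome := by
  have hk : ∀ i, S.fitIdx x < (S.chain i).length := fun i => by
    rw [hn]; exact FS1.fitIdx_lt hn h1 x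
  -- An execution with an empty batch, on a dummy type of nodes. Advancing its invariant shows that
  -- all items of earlier sections lie outward of x.
  have h0 : ExecInv S n 0 (⟨S, [], []⟩ : ExecState PUnit.{1} K V) :=
    ⟨hS, hn, fun _ _ _ => rfl, by simp [FS1.outer], by simp, by simp⟩
  have h := (h0.advance rfl (S.fitIdx x) (by have := FS1.fitIdx_lt hn h1 x; omega)).outer_lt x
    (by omega)
  simp only [zero_add] at h
  have key : ∀ i, ((S.seg i (S.fitIdx x)).entry x).isSome → (S.toMap x).isSome := by
    intro i hi
    obtain ⟨e, he, rfl⟩ := Segment.entry_isSome_iff.mp hi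
    rwa [← hS.entry_seg (hk i) (hS.between_of_mem (hk i) he)]
  constructor
  · rintro (h | h)
    · exact key _ h
    · exact key _ h
  · intro hx
    have hf := FS1.fitsSection_fitIdx hn h1 x
    rw [FS1.fitsSection, Bool.or_eq_true] at hf
    rcases hf with hf | hf
    · left
      rwa [hS.entry_seg (hk _) (FS1.between_of_fitsSeg hS hn (FS1.fitIdx_lt hn h1 x) h hf)]
    · right
      rwa [hS.entry_seg (hk _) (FS1.between_of_fitsSeg hS hn (FS1.fitIdx_lt hn h1 x) h hf)]

/-- The outcome of the preliminary phase. -/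
theorem tagBatch_spec {S : FS1 K V} {n : ℕ} (hn : S.HasLength n) (h1 : 1 ≤ n) (hS : S.Sorted)
    (hs : ∀ i k, (S.seg i k).length ≤ 3 * cap k) (B : List (Call N K V)) (m : ℕ)
    (hm : m = slabSize B.length) :
    ineffectual (tagBatch S B).val = B.filter (fun c => decide
        (S.fitIdx c.2.item < m ∧ S.toMap c.2.item = none ∧ c.2.accessType ≠ 2)) ∧
      effectual (tagBatch S B).val = B.filter (fun c => decide
        (S.fitIdx c.2.item < m ∧ (S.toMap c.2.item ≠ none ∨ c.2.accessType = 2))) ∧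
      residual (tagBatch S B).val = B.filter (fun c => decide (m ≤ S.fitIdx c.2.item)) ∧
      cost (tagBatch S B).log ≤ 28 * (B.map fun c => 2 ^ S.fitIdx c.2.item).sum := by
  have h0 : B.map (fun c => (c, Tag.pending)) = B.map (fun c => (c, tagUpTo S 0 c)) :=
    List.map_congr_left fun c _ => by rw [tagUpTo_eq_pending.mpr (Nat.zero_le _)]
  obtain ⟨p1, p2⟩ := preliminary_spec hn h1 hs B (slabSize B.length) 0
  have hT : (tagBatch S B).val = B.map (fun c => (c, tagUpTo S m c)) := by
    rw [tagBatch, h0, p1, zero_add, hm]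
  have ht : ∀ c : Call N K V, tagUpTo S m c =
      if S.fitIdx c.2.item < m then
        if (S.toMap c.2.item).isSome then .found else .absent else .pending := by
    intro c
    unfold tagUpTo
    simp only [toMap_isSome_iff hn h1 hS]
  have hfm : ∀ p : Call N K V × Tag → Bool,
      ((B.map (fun c => (c, tagUpTo S m c))).filter p).map Prod.fst =
        B.filter (fun c => p (c, tagUpTo S m c)) := by
    intro p
    rw [List.filter_map, List.map_map]
    exact (List.map_congr_left fun c _ => rfl).trans (List.map_id _)
  refine ⟨?_, ?_, ?_, ?_⟩
  · unfold ineffectual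
    rw [hT, hfm]
    refine List.filter_congr fun c _ => ?_
    rw [ht, decide_eq_decide]
    by_cases h1 : S.fitIdx c.2.item < m <;> cases h2 : S.toMap c.2.item <;> simp [h1]
  · unfold effectual
    rw [hT, hfm]
    refine List.filter_congr fun c _ => ?_
    rw [ht, decide_eq_decide]
    by_cases h1 : S.fitIdx c.2.item < m <;> cases h2 : S.toMap c.2.item <;> simp [h1]
  · unfold residual
    rw [hT, hfm]
    refine List.filter_congr fun c _ => ?_
    rw [decide_eq_decide]
    exact tagUpTo_eq_pending
  · rw [tagBatch, h0]
    refine p2.trans ?_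
    rw [show 28 = 14 * 2 by norm_num, mul_assoc, ← List.sum_map_mul_left (r := 2)]
    refine Nat.mul_le_mul_left _ (List.sum_le_sum fun c _ => ?_)
    rw [pow_succ]; omega

end

/-! ### Height-balanced trees and merge-sort with combination of equal keys -/

section

variable {N : Type w} {K : Type u} {V : Type v}

/-! ## Balanced trees -/

namespace BTree

variable {α : Type w}

/-- The number of nodes of height at least `j`. -/
def nodesAbove (j : ℕ) : BTree α → ℕ
  | leaf _ => if j = 0 then 1 else 0
  | node l r => l.nodesAbove j + r.nodesAbove j + if j ≤ max l.height r.height + 1 then 1 else 0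

theorem nodesAbove_eq_zero {j : ℕ} : ∀ {T : BTree α}, T.height < j → T.nodesAbove j = 0
  | leaf _, h => by
    simp only [height] at h
    simp only [nodesAbove]; rw [if_neg (by omega)]
  | node l r, h => by
    simp only [height] at h
    simp only [nodesAbove]
    rw [nodesAbove_eq_zero (T := l) (by omega), nodesAbove_eq_zero (T := r) (by omega),
      if_neg (by omega)]

/-- Below a node of height h there are children of heights h - 1 and at least h - 2, so two more
levels double the number of leaves. The exponent that is rounded up carries the induction, through
the shorter child. -/
theorem Balanced.two_pow_height_le : ∀ {T : BTree α}, T.Balanced →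
    2 ^ (T.height / 2) ≤ T.leaves.length ∧ 2 ^ ((T.height + 1) / 2) ≤ T.leaves.length + 1 - 1
  | leaf _, _ => by simp [height, leaves]
  | node l r, h => by
    obtain ⟨h1, h2, h3, h4⟩ := h
    obtain ⟨a1, a2⟩ := h3.two_pow_height_le
    obtain ⟨b1, b2⟩ := h4.two_pow_height_le
    simp only [height, leaves, List.length_append]
    rw [Nat.add_sub_cancel] at *
    have key : 2 ^ ((max l.height r.height + 1 + 1) / 2) ≤ l.leaves.length + r.leaves.length := by
      rw [show (max l.height r.height + 1 + 1) / 2 = max l.height r.height / 2 + 1 by omega,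
        pow_succ]
      rcases le_total l.height r.height with h | h
      · rw [max_eq_right h]
        have : 2 ^ (r.height / 2) ≤ 2 ^ ((l.height + 1) / 2) :=
          Nat.pow_le_pow_right (by norm_num) (by omega)
        omega
      · rw [max_eq_left h]
        have : 2 ^ (l.height / 2) ≤ 2 ^ ((r.height + 1) / 2) :=
          Nat.pow_le_pow_right (by norm_num) (by omega)
        omega
    refine ⟨le_trans (Nat.pow_le_pow_right (by norm_num) (by omega)) key, key⟩

/-- The summand 2 makes the induction close: if both children reach height j, then a + b + 1 + 2 ≤
(a + 2) + (b + 2). Otherwise, by balance, a child that reaches height j has height exactly j, and at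
most two nodes count. -/
theorem Balanced.nodesAbove_le {j : ℕ} : ∀ {T : BTree α}, T.Balanced → j ≤ T.height →
    (T.nodesAbove j + 2) * 2 ^ (j / 2) ≤ 4 * T.leaves.length
  | leaf _, _, hj => by
    simp only [height] at hj
    obtain rfl : j = 0 := by omega
    simp [nodesAbove, leaves]
  | node l r, h, hj => by
    have hb := h.two_pow_height_le.1
    obtain ⟨h1, h2, h3, h4⟩ := h
    have hp : 2 ^ (j / 2) ≤ 2 ^ ((node l r).height / 2) :=
      Nat.pow_le_pow_right (by norm_num) (by omega)
    have exact_height : ∀ {T : BTree α}, T.height = j → T.nodesAbove j ≤ 1 := by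
      intro T hT
      cases T with
      | leaf a => simp only [nodesAbove]; split_ifs <;> omega
      | node l r =>
        simp only [height] at hT
        simp only [nodesAbove]
        rw [nodesAbove_eq_zero (T := l) (by omega), nodesAbove_eq_zero (T := r) (by omega)]
        split_ifs <;> omega
    have small : (node l r).nodesAbove j ≤ 2 →
        ((node l r).nodesAbove j + 2) * 2 ^ (j / 2) ≤ 4 * (node l r).leaves.length := fun h =>
      Nat.mul_le_mul (by omega) (hp.trans hb)
    simp only [height] at hj
    by_cases hl : j ≤ l.height <;> by_cases hr : j ≤ r.height
    · have a := h3.nodesAbove_le hl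
      have b := h4.nodesAbove_le hr
      simp only [nodesAbove, leaves, List.length_append]
      have : (l.nodesAbove j + r.nodesAbove j +
          (if j ≤ max l.height r.height + 1 then 1 else 0) + 2) * 2 ^ (j / 2) ≤
          (l.nodesAbove j + 2 + (r.nodesAbove j + 2)) * 2 ^ (j / 2) := by
        refine Nat.mul_le_mul_right _ ?_
        split_ifs <;> omega
      have e := add_mul (l.nodesAbove j + 2) (r.nodesAbove j + 2) (2 ^ (j / 2))
      omega
    · refine small ?_
      have := exact_height (T := l) (by omega)
      simp only [nodesAbove]
      rw [nodesAbove_eq_zero (T := r) (by omega)]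
      split_ifs <;> omega
    · refine small ?_
      have := exact_height (T := r) (by omega)
      simp only [nodesAbove]
      rw [nodesAbove_eq_zero (T := l) (by omega)]
      split_ifs <;> omega
    · refine small ?_
      simp only [nodesAbove]
      rw [nodesAbove_eq_zero (T := l) (by omega), nodesAbove_eq_zero (T := r) (by omega)]
      split_ifs <;> omega

theorem Balanced.nodesAbove_mul_le {T : BTree α} (h : T.Balanced) (j : ℕ) :
    T.nodesAbove j * 2 ^ (j / 2) ≤ 4 * T.leaves.length := by
  rcases Nat.lt_or_ge T.height j with hj | hj
  · simp [nodesAbove_eq_zero hj]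
  · exact (Nat.mul_le_mul_right _ (by omega)).trans (h.nodesAbove_le hj)

theorem Balanced.height_le {T : BTree α} (h : T.Balanced) :
    T.height ≤ 2 * Nat.log 2 T.leaves.length + 1 := by
  have h1 := Nat.log_mono_right (b := 2) h.two_pow_height_le.1
  rw [Nat.log_pow (by norm_num)] at h1
  omega

end BTree

/-! ## Entropy-sort -/

section Sorting

variable [LinearOrder K]

/-- Type and item of a call, ordered lexicographically. -/
def callKey (c : Call N K V) : ℕ ×ₗ K := toLex (c.2.accessType, c.2.item)

/-- Type and item of a group-operation, ordered lexicographically. -/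
def Group.key (g : Group N K V) : ℕ ×ₗ K := toLex (g.accessType, g.item)

theorem Group.before_iff {g h : Group N K V} : g.before h ↔ g.key < h.key := by
  unfold before key
  rw [Prod.Lex.toLex_lt_toLex]

omit [LinearOrder K] in
theorem Group.Valid.callKey_eq {g : Group N K V} (hg : g.Valid) {c : Call N K V}
    (hc : c ∈ g.ops) : callKey c = g.key := by
  unfold callKey Group.key
  rw [hg.type c hc, hg.item c hc]

/-- A sorted batch of group-operations. -/
def SortedGroups (G : List (Group N K V)) : Prop := G.Pairwise (fun g h => g.key < h.key)

theorem mergeGroups_spec : ∀ (A B : List (Group N K V)), SortedGroups A → SortedGroups B →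
    (∀ g ∈ A, g.Valid) → (∀ g ∈ B, g.Valid) →
    SortedGroups (mergeGroups A B) ∧ (∀ g ∈ mergeGroups A B, g.Valid) ∧
      ((mergeGroups A B).flatMap Group.ops).Perm (A.flatMap Group.ops ++ B.flatMap Group.ops) ∧
      ∀ g ∈ mergeGroups A B, (∃ g' ∈ A, g'.key = g.key) ∨ ∃ g' ∈ B, g'.key = g.key
  | [], B, _, hB, _, hvB => by
    rw [mergeGroups]
    exact ⟨hB, hvB, by simp, fun g hg => Or.inr ⟨g, hg, rfl⟩⟩
  | g :: A, [], hA, _, hvA, _ => by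
    rw [mergeGroups]
    · exact ⟨hA, hvA, by simp, fun g hg => Or.inl ⟨g, hg, rfl⟩⟩
    · simp
  | g :: A, h :: B, hA, hB, hvA, hvB => by
    have hA' := List.pairwise_cons.mp hA
    have hB' := List.pairwise_cons.mp hB
    rw [mergeGroups]
    split_ifs with h1 h2
    · rw [Group.before_iff] at h1
      obtain ⟨a1, a2, a3, a4⟩ := mergeGroups_spec A (h :: B) hA'.2 hB
        (fun g hg => hvA g (by simp [hg])) hvB
      refine ⟨List.pairwise_cons.mpr ⟨fun x hx => ?_, a1⟩, ?_, ?_, ?_⟩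
      · rcases a4 x hx with ⟨y, hy, e⟩ | ⟨y, hy, e⟩
        · rw [← e]; exact hA'.1 y hy
        · rw [← e]
          rcases List.mem_cons.mp hy with rfl | hy
          · exact h1
          · exact h1.trans (hB'.1 y hy)
      · intro x hx
        rcases List.mem_cons.mp hx with rfl | hx
        · exact hvA x (by simp)
        · exact a2 x hx
      · rw [List.flatMap_cons, List.flatMap_cons, List.append_assoc]
        exact a3.append_left _
      · intro x hx
        rcases List.mem_cons.mp hx with rfl | hx
        · exact Or.inl ⟨x, by simp, rfl⟩
        · rcases a4 x hx with ⟨y, hy, e⟩ | ⟨y, hy, e⟩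
          · exact Or.inl ⟨y, by simp [hy], e⟩
          · exact Or.inr ⟨y, hy, e⟩
    · rw [Group.before_iff] at h1 h2
      obtain ⟨a1, a2, a3, a4⟩ := mergeGroups_spec (g :: A) B hA hB'.2 hvA
        (fun g hg => hvB g (by simp [hg]))
      refine ⟨List.pairwise_cons.mpr ⟨fun x hx => ?_, a1⟩, ?_, ?_, ?_⟩
      · rcases a4 x hx with ⟨y, hy, e⟩ | ⟨y, hy, e⟩
        · rw [← e]
          rcases List.mem_cons.mp hy with rfl | hy
          · exact h2
          · exact h2.trans (hA'.1 y hy)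
        · rw [← e]; exact hB'.1 y hy
      · intro x hx
        rcases List.mem_cons.mp hx with rfl | hx
        · exact hvB x (by simp)
        · exact a2 x hx
      · rw [List.flatMap_cons (xs := B), List.flatMap_cons]
        refine (a3.append_left _).trans ?_
        rw [← List.append_assoc, ← List.append_assoc]
        exact List.perm_append_comm.append_right _
      · intro x hx
        rcases List.mem_cons.mp hx with rfl | hx
        · exact Or.inr ⟨x, by simp, rfl⟩
        · rcases a4 x hx with ⟨y, hy, e⟩ | ⟨y, hy, e⟩
          · exact Or.inl ⟨y, hy, e⟩
          · exact Or.inr ⟨y, by simp [hy], e⟩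
    · rw [Group.before_iff] at h1 h2
      have e : g.key = h.key := le_antisymm (not_lt.mp h2) (not_lt.mp h1)
      have e' : g.accessType = h.accessType ∧ g.item = h.item := by
        have := congrArg ofLex e
        simpa [Group.key] using this
      obtain ⟨a1, a2, a3, a4⟩ := mergeGroups_spec A B hA'.2 hB'.2
        (fun g hg => hvA g (by simp [hg])) (fun g hg => hvB g (by simp [hg]))
      have hg := hvA g (by simp)
      have hh := hvB h (by simp)
      refine ⟨List.pairwise_cons.mpr ⟨fun x hx => ?_, a1⟩, ?_, ?_, ?_⟩
      · change g.key < x.key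
        rcases a4 x hx with ⟨y, hy, e''⟩ | ⟨y, hy, e''⟩
        · rw [← e'']; exact hA'.1 y hy
        · rw [← e'', e]; exact hB'.1 y hy
      · intro x hx
        rcases List.mem_cons.mp hx with rfl | hx
        · refine ⟨by simp [hg.nonempty], fun c hc => ?_, fun c hc => ?_⟩
          · rcases List.mem_append.mp hc with hc | hc
            · exact hg.type c hc
            · exact (hh.type c hc).trans e'.1.symm
          · rcases List.mem_append.mp hc with hc | hc
            · exact hg.item c hc
            · exact (hh.item c hc).trans e'.2.symm
        · exact a2 x hx
      · rw [List.flatMap_cons, List.flatMap_cons, List.flatMap_cons]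
        refine (a3.append_left _).trans ?_
        simp only [List.append_assoc]
        refine List.Perm.append_left _ ?_
        rw [← List.append_assoc, ← List.append_assoc]
        exact List.perm_append_comm.append_right _
      · intro x hx
        rcases List.mem_cons.mp hx with rfl | hx
        · exact Or.inl ⟨g, by simp, rfl⟩
        · rcases a4 x hx with ⟨y, hy, e⟩ | ⟨y, hy, e⟩
          · exact Or.inl ⟨y, by simp [hy], e⟩
          · exact Or.inr ⟨y, by simp [hy], e⟩
termination_by A B => A.length + B.length

theorem entropySort_spec (T : BTree (Call N K V)) :
    SortedGroups (entropySort T).val ∧ (∀ g ∈ (entropySort T).val, g.Valid) ∧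
      ((entropySort T).val.flatMap Group.ops).Perm T.leaves := by
  induction T with
  | leaf c =>
    refine ⟨by simp [entropySort, SortedGroups], ?_, by simp [entropySort, BTree.leaves]⟩
    intro g hg
    simp only [entropySort, Costed.tick_val, Costed.pure_val, List.mem_singleton] at hg
    subst hg
    exact ⟨by simp, by simp, by simp⟩
  | node l r ihl ihr =>
    obtain ⟨a1, a2, a3⟩ := ihl
    obtain ⟨b1, b2, b3⟩ := ihr
    obtain ⟨c1, c2, c3, -⟩ := mergeGroups_spec _ _ a1 b1 a2 b2
    exact ⟨c1, c2, c3.trans (a3.append b3)⟩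

/-- Merging a sorted batch at a node of height `H` costs each key with threshold above `H` one unit
per leaf, and each other key one unit for the node. -/
theorem entropySort_length_le (h : ℕ ×ₗ K → ℕ) (Ks : Finset (ℕ ×ₗ K)) (T : BTree (Call N K V))
    (hK : ∀ c ∈ T.leaves, callKey c ∈ Ks) (H : ℕ) :
    (entropySort T).val.length ≤
      (T.leaves.filter (fun c => decide (H < h (callKey c)))).length +
        (Ks.filter (fun j => h j ≤ H)).card := by
  obtain ⟨a1, a2, a3⟩ := entropySort_spec T
  have h1 : (entropySort T).val.length =
      (((entropySort T).val.map Group.key).toFinset).card := by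
    rw [List.toFinset_card_of_nodup, List.length_map]
    rw [List.Nodup, List.pairwise_map]
    exact List.Pairwise.imp (fun h => h.ne) a1
  rw [h1]
  have h2 : ((entropySort T).val.map Group.key).toFinset ⊆
      ((T.leaves.filter (fun c => decide (H < h (callKey c)))).map callKey).toFinset ∪
        Ks.filter (fun j => h j ≤ H) := by
    intro j hj
    rw [List.mem_toFinset, List.mem_map] at hj
    obtain ⟨g, hg, rfl⟩ := hj
    -- Every group has a member among the leaves below. Its key is counted through that leaf if the
    -- threshold is above H, and through the key itself otherwise.
    obtain ⟨c, hc⟩ := List.exists_mem_of_ne_nil _ (a2 g hg).nonempty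
    have hc' : c ∈ T.leaves := a3.mem_iff.mp (List.mem_flatMap.mpr ⟨g, hg, hc⟩)
    have e := (a2 g hg).callKey_eq hc
    rw [Finset.mem_union, List.mem_toFinset, Finset.mem_filter, ← e]
    by_cases hH : H < h (callKey c)
    · exact Or.inl (List.mem_map.mpr ⟨c, List.mem_filter.mpr ⟨hc', by simpa using hH⟩, rfl⟩)
    · exact Or.inr ⟨hK c hc', by omega⟩
  refine (Finset.card_le_card h2).trans ((Finset.card_union_le _ _).trans ?_)
  refine Nat.add_le_add_right ((List.toFinset_card_le _).trans ?_) _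
  rw [List.length_map]

-- Raising the truncation from a height at most H to H + 1 yields a unit for each leaf with
-- threshold above H.
omit [LinearOrder K] in
theorem sum_map_min_add_le (f : Call N K V → ℕ) {a H : ℕ} (ha : a ≤ H) (L : List (Call N K V)) :
    (L.map fun c => min (f c) a).sum + (L.filter (fun c => decide (H < f c))).length ≤
      (L.map fun c => min (f c) (H + 1)).sum := by
  induction L with
  | nil => simp
  | cons c L ih =>
    rw [List.map_cons, List.map_cons, List.sum_cons, List.sum_cons]
    by_cases h : H < f c
    · rw [List.filter_cons_of_pos (by simpa using h), List.length_cons]; omega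
    · rw [List.filter_cons_of_neg (by simpa using h)]; omega

/-- A key pays one unit per leaf at the heights below its threshold and one unit per node at the
heights above. Including the length of the output on the left prepays the merge at the parent. As
outputs are nonempty, a node adds at most twice the length of its output, which leaves room in the
factor 3. -/
theorem cost_entropySort (h : ℕ ×ₗ K → ℕ) (Ks : Finset (ℕ ×ₗ K)) (T : BTree (Call N K V))
    (hK : ∀ c ∈ T.leaves, callKey c ∈ Ks) :
    cost (entropySort T).log + (entropySort T).val.length ≤
      3 * ((T.leaves.map fun c => min (h (callKey c)) (T.height + 1)).sum +
        ∑ j ∈ Ks, T.nodesAbove (h j)) := by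
  induction T with
  | leaf c =>
    have h1 : cost (entropySort (.leaf c)).log + (entropySort (.leaf c)).val.length = 3 := by
      simp [entropySort, Prim.bound]
    rw [h1]
    simp only [BTree.leaves, BTree.height, List.map_cons, List.map_nil, List.sum_cons,
      List.sum_nil]
    by_cases h0 : h (callKey c) = 0
    · have := Finset.single_le_sum (f := fun j => (BTree.leaf c).nodesAbove (h j)) (s := Ks)
        (fun _ _ => Nat.zero_le _) (hK c (by simp [BTree.leaves]))
      simp only [BTree.nodesAbove, h0, if_true] at this ⊢
      omega
    · have : 1 ≤ min (h (callKey c)) (0 + 1) := by omega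
      omega
  | node l r ihl ihr =>
    have ihl := ihl fun c hc => hK c (by simp [BTree.leaves, hc])
    have ihr := ihr fun c hc => hK c (by simp [BTree.leaves, hc])
    set H := max l.height r.height + 1 with hH
    have hd := entropySort_length_le h Ks (.node l r) hK H
    have h1 : cost (entropySort (.node l r)).log = cost (entropySort l).log +
        cost (entropySort r).log + ((entropySort l).val.length + (entropySort r).val.length + 1) := by
      simp [entropySort, Prim.bound]; ring
    have hpos : 1 ≤ (entropySort (.node l r)).val.length := by
      rw [Nat.one_le_iff_ne_zero, ne_eq, List.length_eq_zero_iff]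
      intro h0
      have := (entropySort_spec (.node l r)).2.2
      rw [h0, List.flatMap_nil, List.nil_perm] at this
      have hl : ∀ T : BTree (Call N K V), T.leaves ≠ [] := by
        intro T
        induction T with
        | leaf a => simp [BTree.leaves]
        | node l r ihl _ => simp [BTree.leaves, ihl]
      exact hl _ this
    have h2 : ∑ j ∈ Ks, (BTree.node l r).nodesAbove (h j) =
        ∑ j ∈ Ks, l.nodesAbove (h j) + ∑ j ∈ Ks, r.nodesAbove (h j) +
          (Ks.filter (fun j => h j ≤ H)).card := by
      rw [Finset.card_filter, ← Finset.sum_add_distrib, ← Finset.sum_add_distrib]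
      rfl
    have h3 := sum_map_min_add_le (fun c => h (callKey c)) (a := l.height + 1) (H := H)
      (by omega) l.leaves
    have h4 := sum_map_min_add_le (fun c => h (callKey c)) (a := r.height + 1) (H := H)
      (by omega) r.leaves
    have h5 : (BTree.node l r).height + 1 = H + 1 := rfl
    simp only [BTree.leaves, List.filter_append, List.length_append] at hd
    rw [h1, h2, h5]
    simp only [BTree.leaves, List.map_append, List.sum_append]
    omega

/-- The cost of sorting, if keys are given weights whose inverse squares have a bounded sum. -/
theorem cost_sortBatch_of_weights {T : Option (BTree (Call N K V))} {L : List (Call N K V)}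
    (hT : Represents T L) (ρ : ℕ ×ₗ K → ℕ) (h1 : ∀ j, 1 ≤ ρ j) :
    (cost (sortBatch T).log : ℝ) ≤
      12 * (L.map fun c => ((Nat.log 2 (ρ (callKey c)) : ℝ) + 1)).sum +
        12 * L.length * ∑ j ∈ (L.map callKey).toFinset, 1 / (ρ j : ℝ) ^ 2 := by
  cases T with
  | none =>
    have : L = [] := hT
    subst this
    simp [sortBatch]
  | some T =>
    obtain ⟨rfl, hb⟩ := hT
    -- With the threshold 4 (log ρ + 1) a node that counts has height at least 4 (log ρ + 1), so by
    -- `nodesAbove_mul_le` there are at most 4 b / ρ² of them.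
    have h := cost_entropySort (fun j => 4 * (Nat.log 2 (ρ j) + 1)) (T.leaves.map callKey).toFinset T
      (fun c hc => by rw [List.mem_toFinset]; exact List.mem_map_of_mem hc)
    have h2 : (T.leaves.map fun c => min (4 * (Nat.log 2 (ρ (callKey c)) + 1)) (T.height + 1)).sum ≤
        4 * (T.leaves.map fun c => Nat.log 2 (ρ (callKey c)) + 1).sum := by
      rw [← List.sum_map_mul_left]
      exact List.sum_le_sum fun c _ => min_le_left _ _
    have h3 : ∀ j, ((T.nodesAbove (4 * (Nat.log 2 (ρ j) + 1)) : ℕ) : ℝ) ≤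
        4 * T.leaves.length * (1 / (ρ j : ℝ) ^ 2) := by
      intro j
      have h4 := hb.nodesAbove_mul_le (4 * (Nat.log 2 (ρ j) + 1))
      have h5 : ρ j < 2 ^ (Nat.log 2 (ρ j) + 1) := Nat.lt_pow_succ_log_self (by norm_num) _
      have h6 : ρ j ^ 2 ≤ 2 ^ (4 * (Nat.log 2 (ρ j) + 1) / 2) := by
        rw [show 4 * (Nat.log 2 (ρ j) + 1) / 2 = (Nat.log 2 (ρ j) + 1) * 2 by omega, pow_mul]
        exact Nat.pow_le_pow_left h5.le 2
      have h7 : T.nodesAbove (4 * (Nat.log 2 (ρ j) + 1)) * ρ j ^ 2 ≤ 4 * T.leaves.length :=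
        (Nat.mul_le_mul_left _ h6).trans h4
      have h8 : (0 : ℝ) < (ρ j : ℝ) ^ 2 := by
        have : (0 : ℝ) < ρ j := by exact_mod_cast h1 j
        positivity
      rw [mul_one_div, le_div_iff₀ h8]
      exact_mod_cast h7
    have h4 : (∑ j ∈ (T.leaves.map callKey).toFinset,
        ((T.nodesAbove (4 * (Nat.log 2 (ρ j) + 1)) : ℕ) : ℝ)) ≤
        4 * T.leaves.length * ∑ j ∈ (T.leaves.map callKey).toFinset, 1 / (ρ j : ℝ) ^ 2 := by
      rw [Finset.mul_sum]
      exact Finset.sum_le_sum fun j _ => h3 j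
    have h5 : cost (sortBatch (some T)).log ≤
        3 * (4 * (T.leaves.map fun c => Nat.log 2 (ρ (callKey c)) + 1).sum +
        ∑ j ∈ (T.leaves.map callKey).toFinset, T.nodesAbove (4 * (Nat.log 2 (ρ j) + 1))) := by
      refine le_trans (Nat.le_add_right _ _) (h.trans ?_)
      omega
    have h6 : (cost (sortBatch (some T)).log : ℝ) ≤
        3 * (4 * ((T.leaves.map fun c => Nat.log 2 (ρ (callKey c)) + 1).sum : ℕ) +
        ∑ j ∈ (T.leaves.map callKey).toFinset,
          ((T.nodesAbove (4 * (Nat.log 2 (ρ j) + 1)) : ℕ) : ℝ)) := by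
      exact_mod_cast h5
    have h7 : (((T.leaves.map fun c => Nat.log 2 (ρ (callKey c)) + 1).sum : ℕ) : ℝ) =
        (T.leaves.map fun c => ((Nat.log 2 (ρ (callKey c)) : ℝ) + 1)).sum := by
      rw [Nat.cast_list_sum, List.map_map]
      congr 1
      refine List.map_congr_left fun c _ => ?_
      simp
    rw [h7] at h6
    linarith

/-- The cost of sorting, without regard to the distribution of the keys. -/
theorem cost_sortBatch_le {T : Option (BTree (Call N K V))} {L : List (Call N K V)}
    (hT : Represents T L) :
    cost (sortBatch T).log ≤ 6 * (L.length * (Nat.log 2 L.length + 1)) := by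
  cases T with
  | none =>
    have : L = [] := hT
    subst this
    simp [sortBatch]
  | some T =>
    obtain ⟨rfl, hb⟩ := hT
    -- A threshold beyond the height of the tree: no node reaches it, and every operation pays once
    -- per level.
    have h := cost_entropySort (fun _ => T.height + 1) (T.leaves.map callKey).toFinset T
      (fun c hc => by rw [List.mem_toFinset]; exact List.mem_map_of_mem hc)
    rw [Finset.sum_congr rfl fun j _ => BTree.nodesAbove_eq_zero (Nat.lt_succ_self _)] at h
    simp only [min_self, List.map_const', List.sum_replicate, smul_eq_mul, Finset.sum_const_zero,
      add_zero] at h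
    have h1 := hb.height_le
    have h2 : T.leaves.length * (T.height + 1) ≤
        T.leaves.length * (2 * (Nat.log 2 T.leaves.length + 1)) := Nat.mul_le_mul_left _ (by omega)
    refine le_trans (Nat.le_add_right _ _) (h.trans ?_)
    nlinarith

theorem sortBatch_spec {T : Option (BTree (Call N K V))} {L : List (Call N K V)}
    (hT : Represents T L) : SortedGroups (sortBatch T).val ∧ (∀ g ∈ (sortBatch T).val, g.Valid) ∧
      ((sortBatch T).val.flatMap Group.ops).Perm L := by
  cases T with
  | none =>
    have : L = [] := hT
    subst this
    exact ⟨List.Pairwise.nil, by simp [sortBatch], by simp [sortBatch]⟩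
  | some T =>
    obtain ⟨rfl, hb⟩ := hT
    exact entropySort_spec T

end Sorting

end

/-! ### Finger distances in finite sets, and lower bounds for the finger bound -/

section

variable {N : Type w} {K : Type u} {V : Type v} [LinearOrder K]

/-! ## Finger distances in finite sets -/

instance Side.decidableLt (i : Side) (x y : K) : Decidable (i.lt x y) :=
  inferInstanceAs (Decidable (¬ _))

/-- The number of items of `A` before `x`, from the end `i` inward. -/
def rank (i : Side) (A : Finset K) (x : K) : ℕ := (A.filter (fun y => i.lt y x)).card

/-- The finger distance of `x` in the set `A`. -/
def fd (A : Finset K) (x : K) : ℕ := min (rank .front A x) (rank .back A x) + 1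

theorem one_le_fd (A : Finset K) (x : K) : 1 ≤ fd A x := Nat.le_add_left _ _

theorem fd_le_rank (i : Side) (A : Finset K) (x : K) : fd A x ≤ rank i A x + 1 := by
  unfold fd
  cases i <;> omega

theorem rank_mono (i : Side) {A B : Finset K} (h : A ⊆ B) (x : K) : rank i A x ≤ rank i B x :=
  Finset.card_le_card (Finset.filter_subset_filter _ h)

theorem fd_mono {A B : Finset K} (h : A ⊆ B) (x : K) : fd A x ≤ fd B x := by
  have h1 := rank_mono .front h x
  have h2 := rank_mono .back h x
  unfold fd
  omega

theorem rank_lt_rank {i : Side} {A : Finset K} {x y : K} (hx : x ∈ A) (h : i.lt x y) :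
    rank i A x < rank i A y := by
  refine Finset.card_lt_card ((Finset.ssubset_iff_of_subset ?_).mpr ⟨x, ?_, ?_⟩)
  · intro z hz
    rw [Finset.mem_filter] at *
    exact ⟨hz.1, Side.lt_trans hz.2 h⟩
  · exact Finset.mem_filter.mpr ⟨hx, h⟩
  · intro hx
    exact Side.ne_of_lt (Finset.mem_filter.mp hx).2 rfl

theorem rank_injOn (i : Side) (A : Finset K) : Set.InjOn (rank i A) A := by
  intro x hx y hy h
  by_contra hne
  have : i.lt x y ∨ i.lt y x := by
    by_cases hle : i.le x y
    · exact Or.inl (Side.lt_of_le_of_ne hle hne)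
    · exact Or.inr hle
  rcases this with h' | h'
  · have := rank_lt_rank hx h'; omega
  · have := rank_lt_rank hy h'; omega

/-- Every subset splits into two parts on which the finger distance is injective. -/
theorem exists_split (A G : Finset K) (hG : G ⊆ A) : ∃ G₁ G₂, G₁ ∪ G₂ = G ∧ Disjoint G₁ G₂ ∧
    Set.InjOn (fd A) G₁ ∧ Set.InjOn (fd A) G₂ := by
  -- Split by the nearer end; on each part the finger distance is the rank from that end plus one.
  refine ⟨G.filter (fun x => rank .front A x ≤ rank .back A x),
    G.filter (fun x => ¬ rank .front A x ≤ rank .back A x), Finset.filter_union_filter_not_eq _ _,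
    Finset.disjoint_filter_filter_not _ _ _, ?_, ?_⟩
  · intro x hx y hy h
    rw [Finset.mem_coe, Finset.mem_filter] at hx hy
    refine rank_injOn .front A (hG hx.1) (hG hy.1) ?_
    unfold fd at h
    omega
  · intro x hx y hy h
    rw [Finset.mem_coe, Finset.mem_filter] at hx hy
    refine rank_injOn .back A (hG hx.1) (hG hy.1) ?_
    unfold fd at h
    omega

omit [LinearOrder K] in
theorem sum_inv_sq_le_of_injOn {f : K → ℕ} {G : Finset K} (h1 : ∀ x, 1 ≤ f x)
    (hf : Set.InjOn f G) : ∑ x ∈ G, 1 / (f x : ℝ) ^ 2 ≤ 2 := by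
  have h2 : ∑ x ∈ G, 1 / (f x : ℝ) ^ 2 = ∑ n ∈ G.image f, 1 / (n : ℝ) ^ 2 :=
    (Finset.sum_image (f := fun n : ℕ => 1 / (n : ℝ) ^ 2) hf).symm
  rw [h2]
  obtain ⟨M, hM⟩ := (G.image f).exists_nat_subset_range
  have h3 : G.image f ⊆ Finset.Ioo 0 M := by
    intro n hn
    have h4 := Finset.mem_range.mp (hM hn)
    obtain ⟨x, -, rfl⟩ := Finset.mem_image.mp hn
    exact Finset.mem_Ioo.mpr ⟨h1 x, h4⟩
  refine (Finset.sum_le_sum_of_subset_of_nonneg h3 fun _ _ _ => by positivity).trans ?_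
  have := sum_Ioo_inv_sq_le (α := ℝ) 0 M
  simpa [one_div] using this

/-- An item is determined by its finger distance and the nearer end, so every value occurs at most
twice. -/
theorem sum_inv_sq_fd_le {A G : Finset K} (hG : G ⊆ A) : ∑ x ∈ G, 1 / (fd A x : ℝ) ^ 2 ≤ 4 := by
  obtain ⟨G₁, G₂, rfl, hd, h1, h2⟩ := exists_split A G hG
  rw [Finset.sum_union hd]
  have a := sum_inv_sq_le_of_injOn (one_le_fd A) h1
  have b := sum_inv_sq_le_of_injOn (one_le_fd A) h2
  linarith

theorem card_fd_le {A G : Finset K} (hG : G ⊆ A) (r : ℕ) :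
    (G.filter (fun x => fd A x ≤ r)).card ≤ 2 * r := by
  obtain ⟨G₁, G₂, rfl, hd, h1, h2⟩ := exists_split A G hG
  have key : ∀ G' : Finset K, Set.InjOn (fd A) G' → (G'.filter (fun x => fd A x ≤ r)).card ≤ r := by
    intro G' h
    have := Finset.card_le_card_of_injOn (s := G'.filter (fun x => fd A x ≤ r))
      (t := Finset.Icc 1 r) (fd A)
      (fun x hx => Finset.mem_coe.mpr (Finset.mem_Icc.mpr ⟨one_le_fd A x, (Finset.mem_filter.mp hx).2⟩))
      (h.mono (by exact_mod_cast Finset.filter_subset _ _))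
    simpa using this
  rw [Finset.filter_union]
  have a := key G₁ h1
  have b := key G₂ h2
  have := Finset.card_union_le (G₁.filter (fun x => fd A x ≤ r)) (G₂.filter (fun x => fd A x ≤ r))
  omega

/-- Accessing many items cannot be cheap. -/
theorem card_mul_log_le {A G : Finset K} (hG : G ⊆ A) :
    G.card * (Nat.log 2 G.card + 1) ≤ 4 * ∑ x ∈ G, (Nat.log 2 (fd A x) + 1) := by
  set d := G.card
  -- At most half of the items have finger distance at most d / 4. Each of the others contributes
  -- about log d - 1, and the loss is made up by the unit that every item contributes.
  set H := G.filter (fun x => ¬ fd A x ≤ d / 4)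
  have h1 : d ≤ 2 * H.card := by
    have h2 := card_fd_le hG (d / 4)
    have h3 : (G.filter (fun x => fd A x ≤ d / 4)).card + H.card = d :=
      Finset.card_filter_add_card_filter_not (fun x => fd A x ≤ d / 4)
    omega
  have h2 : ∀ x ∈ H, Nat.log 2 d - 2 + 1 ≤ Nat.log 2 (fd A x) + 1 := by
    intro x hx
    have h3 : d / 4 < fd A x := by simpa using (Finset.mem_filter.mp hx).2
    have h4 : Nat.log 2 (d / 2 / 2) = Nat.log 2 d - 2 := by
      rw [Nat.log_div_base, Nat.log_div_base]; omega
    rw [Nat.div_div_eq_div_mul, show 2 * 2 = 4 from rfl] at h4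
    have h5 := Nat.log_mono_right (b := 2) h3.le
    omega
  have h3 : H.card * (Nat.log 2 d - 2 + 1) ≤ ∑ x ∈ G, (Nat.log 2 (fd A x) + 1) := by
    refine le_trans ?_ (Finset.sum_le_sum_of_subset
      (Finset.filter_subset (fun x => ¬ fd A x ≤ d / 4) G))
    rw [← smul_eq_mul]
    exact Finset.card_nsmul_le_sum _ _ _ h2
  have h4 : d ≤ ∑ x ∈ G, (Nat.log 2 (fd A x) + 1) := by
    have : d = ∑ x ∈ G, 1 := by simp [d]
    rw [this]
    exact Finset.sum_le_sum fun x _ => by omega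
  have h5 : Nat.log 2 d + 1 ≤ (Nat.log 2 d - 2 + 1) + 2 := by omega
  calc d * (Nat.log 2 d + 1) ≤ d * ((Nat.log 2 d - 2 + 1) + 2) := Nat.mul_le_mul_left _ h5
    _ = d * (Nat.log 2 d - 2 + 1) + 2 * d := by ring
    _ ≤ 2 * H.card * (Nat.log 2 d - 2 + 1) + 2 * d := by
      have := Nat.mul_le_mul_right (Nat.log 2 d - 2 + 1) h1
      omega
    _ ≤ _ := by rw [mul_assoc]; omega

/-- Let y be the outermost item before x whose rank is at least r. Everything before y has rank
below r, hence finger distance at most r, and there are at least r such items. If no such y exists,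
all items before x qualify. -/
theorem card_outermost (i : Side) (A : Finset K) (x : K) {r : ℕ} (hr : r ≤ rank i A x) :
    r ≤ ((A.filter (fun y => i.lt y x)).filter (fun y => fd A y ≤ r)).card := by
  set L := A.filter (fun y => i.lt y x)
  suffices h : r ≤ (L.filter (fun y => rank i A y < r)).card by
    refine h.trans (Finset.card_le_card fun y hy => ?_)
    rw [Finset.mem_filter] at *
    exact ⟨hy.1, (fd_le_rank i A y).trans hy.2⟩
  by_cases hT : (L.filter (fun y => ¬ rank i A y < r)).Nonempty
  · obtain ⟨y, hy, hmin⟩ := Finset.exists_min_image _ (rank i A) hT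
    rw [Finset.mem_filter] at hy
    refine (not_lt.mp hy.2).trans (Finset.card_le_card fun z hz => ?_)
    rw [Finset.mem_filter] at hz
    have hzL : z ∈ L := Finset.mem_filter.mpr
      ⟨hz.1, Side.lt_trans hz.2 (Finset.mem_filter.mp hy.1).2⟩
    rw [Finset.mem_filter]
    refine ⟨hzL, ?_⟩
    by_contra h
    have h1 := hmin z (Finset.mem_filter.mpr ⟨hzL, h⟩)
    have h2 := rank_lt_rank hz.1 hz.2
    omega
  · rw [Finset.not_nonempty_iff_eq_empty] at hT
    have h3 := Finset.card_filter_add_card_filter_not (s := L) (fun y => rank i A y < r)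
    rw [hT, Finset.card_empty] at h3
    have : rank i A x = L.card := rfl
    omega

/-- The finger distance of `x` only depends on the items with a smaller finger distance. -/
theorem fd_le_of_outermost {A A' : Finset K} {x : K} (h : ∀ y ∈ A, fd A y < fd A x → y ∈ A') :
    fd A x ≤ fd A' x := by
  -- From either end, `fd A x - 1` items before x have finger distance smaller than x, so all of
  -- them are in A'.
  have key : ∀ i : Side, fd A x - 1 ≤ rank i A' x := by
    intro i
    have h1 := fd_le_rank i A x
    refine (card_outermost i A x (r := fd A x - 1) (by omega)).trans (Finset.card_le_card fun y hy => ?_)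
    rw [Finset.mem_filter, Finset.mem_filter] at hy
    have := one_le_fd A x
    exact Finset.mem_filter.mpr ⟨h y hy.1.1 (by omega), hy.1.2⟩
  have h1 := key .front
  have h2 := key .back
  have h3 : fd A' x = min (rank .front A' x) (rank .back A' x) + 1 := rfl
  omega

/-! ## Finger bounds of sequences of accesses -/

/-- `A` is the set of items of the map `M`. -/
def HasSupport (M : K → Option V) (A : Finset K) : Prop := ∀ y, M y ≠ none ↔ y ∈ A

theorem HasSupport.fingerDist_eq {M : K → Option V} {A : Finset K} (h : HasSupport M A) (x : K) :
    fingerDist M x = fd A x := by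
  unfold fingerDist fd rank
  have h1 : {y | y < x ∧ M y ≠ none} = ↑(A.filter (fun y => Side.front.lt y x)) := by
    ext y
    simp [h y, Side.front_lt, and_comm]
  have h2 : {y | x < y ∧ M y ≠ none} = ↑(A.filter (fun y => Side.back.lt y x)) := by
    ext y
    simp [h y, Side.back_lt, and_comm]
  rw [h1, h2, Set.ncard_coe_finset, Set.ncard_coe_finset]

theorem log_fd_le (A : Finset K) (x : K) : (Nat.log 2 (fd A x) : ℝ) ≤ Real.logb 2 (fd A x) := by
  have := Real.natLog_le_logb (fd A x) 2
  exact_mod_cast this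

theorem HasSupport.perform_of_le {M : K → Option V} {A : Finset K} (h : HasSupport M A)
    {o : MapOp K V} (ho : o.accessType ≤ 1) : HasSupport (o.perform M) A := by
  intro y
  rw [← h y]
  by_cases hy : o.item = y
  · subst hy
    rw [perform_item]
    cases o <;> simp [MapOp.accessType, MapOp.effect] at *
  · rw [perform_of_ne _ _ hy]

theorem HasSupport.perform_insert {M : K → Option V} {A : Finset K} (h : HasSupport M A)
    {o : MapOp K V} (ho : o.accessType = 2) : HasSupport (o.perform M) (insert o.item A) := by
  intro y
  rw [Finset.mem_insert, ← h y]
  by_cases hy : o.item = y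
  · subst hy
    rw [perform_item]
    cases o <;> simp [MapOp.accessType, MapOp.effect] at *
  · rw [perform_of_ne _ _ hy]
    simp [Ne.symm hy]

theorem HasSupport.perform_delete {M : K → Option V} {A : Finset K} (h : HasSupport M A)
    {o : MapOp K V} (ho : o.accessType = 3) : HasSupport (o.perform M) (A.erase o.item) := by
  intro y
  rw [Finset.mem_erase, ← h y]
  by_cases hy : o.item = y
  · subst hy
    rw [perform_item]
    cases o <;> simp [MapOp.accessType, MapOp.effect] at *
  · rw [perform_of_ne _ _ hy]
    simp [Ne.symm hy]

theorem fingerBound_append (M : K → Option V) (C C' : List (Call N K V)) :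
    fingerBound M ((C ++ C').map Prod.snd) =
      fingerBound M (C.map Prod.snd) + fingerBound (applyCalls M C) (C'.map Prod.snd) := by
  induction C generalizing M with
  | nil => simp [fingerBound]
  | cons c C ih =>
    simp only [List.cons_append, List.map_cons, fingerBound, applyCalls_cons, ih]
    ring

theorem fingerBound_nonneg (M : K → Option V) (L : List (MapOp K V)) : 0 ≤ fingerBound M L := by
  induction L generalizing M with
  | nil => simp [fingerBound]
  | cons o L ih =>
    have h1 : 0 ≤ Real.logb 2 (fingerDist M o.item : ℝ) := by
      refine Real.logb_nonneg (by norm_num) ?_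
      have : 1 ≤ fingerDist M o.item := Nat.le_add_left _ _
      exact_mod_cast this
    have := ih (o.perform M)
    unfold fingerBound
    linarith

/-- The total logarithmic finger distance, rounded down, of the items of calls in a set. -/
noncomputable def logSum (A : Finset K) (C : List (Call N K V)) : ℕ :=
  (C.map fun c => Nat.log 2 (fd A c.2.item) + 1).sum

theorem logSum_append (A : Finset K) (C C' : List (Call N K V)) :
    logSum A (C ++ C') = logSum A C + logSum A C' := by
  simp [logSum]

theorem logSum_perm (A : Finset K) {C C' : List (Call N K V)} (h : C.Perm C') :
    logSum A C = logSum A C' := (h.map _).sum_eq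

theorem logSum_cons (A : Finset K) (c : Call N K V) (C : List (Call N K V)) :
    logSum A (c :: C) = Nat.log 2 (fd A c.2.item) + 1 + logSum A C := by
  simp [logSum]

/-- These calls never change the set of items, so all distances are measured in the same set. -/
theorem fingerBound_of_neutral {A : Finset K} {C : List (Call N K V)} {M : K → Option V}
    (hM : HasSupport M A)
    (hC : ∀ c ∈ C, c.2.accessType ≤ 1 ∨ (c.2.accessType = 3 ∧ c.2.item ∉ A)) :
    HasSupport (applyCalls M C) A ∧ (logSum A C : ℝ) ≤ fingerBound M (C.map Prod.snd) := by
  induction C generalizing M with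
  | nil => exact ⟨hM, by simp [logSum, fingerBound]⟩
  | cons c C ih =>
    have h1 : HasSupport (c.2.perform M) A := by
      rcases hC c (by simp) with h | h
      · exact hM.perform_of_le h
      · have := hM.perform_delete h.1
        rwa [Finset.erase_eq_of_notMem h.2] at this
    obtain ⟨i1, i2⟩ := ih h1 fun c hc => hC c (by simp [hc])
    refine ⟨i1, ?_⟩
    have h2 := log_fd_le A c.2.item
    rw [logSum_cons, List.map_cons, fingerBound, hM.fingerDist_eq]
    push_cast
    linarith

/-- When an item is inserted, all items of `A` at smaller distance are already there, because the
remaining insertions are at least as far in. By `fd_le_of_outermost` its current distance is at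
least that in `A`. -/
theorem fingerBound_of_insertions {A : Finset K} {C : List (Call N K V)} {M : K → Option V}
    {A' : Finset K} (hM : HasSupport M A') (hC : ∀ c ∈ C, c.2.accessType = 2)
    (hs : C.Pairwise (fun c d => fd A c.2.item ≤ fd A d.2.item))
    (hA : ∀ y ∈ A, y ∈ A' ∨ ∃ c ∈ C, c.2.item = y) :
    (∃ A'', HasSupport (applyCalls M C) A'' ∧ A ⊆ A'') ∧
      (logSum A C : ℝ) ≤ fingerBound M (C.map Prod.snd) := by
  induction C generalizing M A' with
  | nil => exact ⟨⟨A', hM, fun y hy => by simpa using hA y hy⟩, by simp [logSum, fingerBound]⟩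
  | cons c C ih =>
    rw [List.pairwise_cons] at hs
    obtain ⟨i1, i2⟩ := ih (hM.perform_insert (hC c (by simp))) (fun c hc => hC c (by simp [hc]))
      hs.2 (fun y hy => by
        rcases hA y hy with h | ⟨d, hd, rfl⟩
        · exact Or.inl (Finset.mem_insert_of_mem h)
        · rcases List.mem_cons.mp hd with rfl | hd
          · exact Or.inl (Finset.mem_insert_self _ _)
          · exact Or.inr ⟨d, hd, rfl⟩)
    refine ⟨i1, ?_⟩
    have h1 : fd A c.2.item ≤ fd A' c.2.item := by
      refine fd_le_of_outermost fun y hy hlt => ?_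
      rcases hA y hy with h | ⟨d, hd, rfl⟩
      · exact h
      · rcases List.mem_cons.mp hd with rfl | hd
        · omega
        · have := hs.1 d hd; omega
    have h2 := log_fd_le A' c.2.item
    have h3 : (Nat.log 2 (fd A c.2.item) : ℝ) ≤ Nat.log 2 (fd A' c.2.item) := by
      exact_mod_cast Nat.log_mono_right h1
    rw [logSum_cons, List.map_cons, fingerBound, hM.fingerDist_eq]
    push_cast
    linarith

/-- The mirror image for decreasing distances: every item of `A` that is already missing is at least
as far in as all items still to be deleted. -/
theorem fingerBound_of_deletions {A : Finset K} {C : List (Call N K V)} {M : K → Option V}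
    {A' : Finset K} (hM : HasSupport M A') (hC : ∀ c ∈ C, c.2.accessType = 3)
    (hs : C.Pairwise (fun c d => fd A d.2.item ≤ fd A c.2.item))
    (hA : ∀ y ∈ A, y ∈ A' ∨ ∀ c ∈ C, fd A c.2.item ≤ fd A y) :
    (logSum A C : ℝ) ≤ fingerBound M (C.map Prod.snd) := by
  induction C generalizing M A' with
  | nil => simp [logSum, fingerBound]
  | cons c C ih =>
    rw [List.pairwise_cons] at hs
    have i2 := ih (hM.perform_delete (hC c (by simp))) (fun c hc => hC c (by simp [hc]))
      hs.2 (fun y hy => by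
        by_cases hyc : y = c.2.item
        · subst hyc
          exact Or.inr hs.1
        · rcases hA y hy with h | h
          · exact Or.inl (Finset.mem_erase.mpr ⟨hyc, h⟩)
          · exact Or.inr fun d hd => h d (by simp [hd]))
    have h1 : fd A c.2.item ≤ fd A' c.2.item := by
      refine fd_le_of_outermost fun y hy hlt => ?_
      rcases hA y hy with h | h
      · exact h
      · have := h c (by simp); omega
    have h2 := log_fd_le A' c.2.item
    have h3 : (Nat.log 2 (fd A c.2.item) : ℝ) ≤ Nat.log 2 (fd A' c.2.item) := by
      exact_mod_cast Nat.log_mono_right h1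
    rw [logSum_cons, List.map_cons, fingerBound, hM.fingerDist_eq]
    push_cast
    linarith

end

/-! ### Reordering the calls of a batch without changing their results -/

section

variable {N : Type w} {K : Type u} {V : Type v}

/-! ## Linearizing a batch -/

section Reorder

variable [DecidableEq K]

theorem perform_comm (M : K → Option V) {o o' : MapOp K V} (h : o.item ≠ o'.item) :
    o'.perform (o.perform M) = o.perform (o'.perform M) := by
  unfold MapOp.perform
  rw [Function.update_of_ne h.symm, Function.update_of_ne h, Function.update_comm h]

/-- Results carry the node that made the call, so exchanging calls on different items only permutes
the list of results. -/
theorem seqResults_move (c : Call N K V) (W : List (Call N K V)) :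
    ∀ (U : List (Call N K V)) (M : K → Option V), (∀ d ∈ U, d.2.item ≠ c.2.item) →
      (seqResults M (U ++ c :: W)).Perm (seqResults M (c :: (U ++ W))) ∧
        applyCalls M (U ++ c :: W) = applyCalls M (c :: (U ++ W))
  | [], _, _ => ⟨List.Perm.refl _, rfl⟩
  | d :: U, M, h => by
    have hd := h d (by simp)
    obtain ⟨i1, i2⟩ := seqResults_move c W U (d.2.perform M) fun e he => h e (by simp [he])
    simp only [List.cons_append, seqResults, applyCalls_cons] at *
    constructor
    · rw [perform_of_ne _ _ hd] at i1
      rw [perform_of_ne _ _ hd.symm]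
      refine (i1.cons _).trans ((List.Perm.swap _ _ _).trans ?_)
      rw [perform_comm _ hd]
    · rw [i2, perform_comm _ hd]

/-- Calls on different items can be exchanged. -/
theorem seqResults_perm_of_filter_eq : ∀ (P L : List (Call N K V)) (M : K → Option V),
    (∀ x, L.filter (fun c => decide (c.2.item = x)) = P.filter (fun c => decide (c.2.item = x))) →
      (seqResults M L).Perm (seqResults M P) ∧ applyCalls M L = applyCalls M P
  | [], L, M, h => by
    have : L = [] := by
      rw [List.eq_nil_iff_forall_not_mem]
      intro c hc
      have h1 := h c.2.item
      rw [List.filter_nil, List.filter_eq_nil_iff] at h1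
      exact h1 c hc (by simp)
    subst this
    exact ⟨List.Perm.refl _, rfl⟩
  | c :: P, L, M, h => by
    have hc := h c.2.item
    rw [List.filter_cons_of_pos (by simp)] at hc
    obtain ⟨U, W, rfl, hU, -, hW⟩ := List.filter_eq_cons_iff.mp hc
    have hU' : ∀ d ∈ U, d.2.item ≠ c.2.item := fun d hd => by simpa using hU d hd
    obtain ⟨m1, m2⟩ := seqResults_move c W U M hU'
    have hP : ∀ x, (U ++ W).filter (fun d => decide (d.2.item = x)) =
        P.filter (fun d => decide (d.2.item = x)) := by
      intro x
      have hx := h x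
      rw [List.filter_append] at hx ⊢
      by_cases hxc : c.2.item = x
      · rw [List.filter_cons_of_pos (by simpa using hxc),
          List.filter_cons_of_pos (by simpa using hxc)] at hx
        have : U.filter (fun d => decide (d.2.item = x)) = [] := by
          rw [List.filter_eq_nil_iff]
          intro d hd
          rw [← hxc]
          simpa using hU' d hd
        rw [this, List.nil_append] at hx ⊢
        exact (List.cons.inj hx).2
      · rw [List.filter_cons_of_neg (by simpa using hxc),
          List.filter_cons_of_neg (by simpa using hxc)] at hx
        exact hx
    obtain ⟨i1, i2⟩ := seqResults_perm_of_filter_eq P (U ++ W) (c.2.perform M) hP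
    refine ⟨m1.trans ?_, m2.trans ?_⟩
    · simp only [seqResults]
      exact i1.cons _
    · rw [applyCalls_cons, applyCalls_cons, i2]

/-- Sorting by a function of the item does not change the order of the calls on an item. -/
theorem filter_mergeSort_item (r : K → K → Bool) (hr : ∀ x, r x x = true)
    (htrans : ∀ x y z, r x y = true → r y z = true → r x z = true)
    (htotal : ∀ x y, r x y = true ∨ r y x = true) (L : List (Call N K V)) (x : K) :
    (L.mergeSort (fun c d => r c.2.item d.2.item)).filter (fun c => decide (c.2.item = x)) =
      L.filter (fun c => decide (c.2.item = x)) := by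
  symm
  have h1 : (L.filter (fun c => decide (c.2.item = x))).Sublist
      (L.mergeSort (fun c d => r c.2.item d.2.item)) := by
    refine List.sublist_mergeSort (le := fun c d : Call N K V => r c.2.item d.2.item)
      (fun a b c => htrans _ _ _)
      (fun a b => by rw [Bool.or_eq_true]; exact htotal _ _) ?_ List.filter_sublist
    refine List.pairwise_of_forall_mem_list fun c hc d hd => ?_
    have hc := (List.mem_filter.mp hc).2
    have hd := (List.mem_filter.mp hd).2
    rw [decide_eq_true_eq] at hc hd
    rw [hc, hd]
    exact hr x
  have h2 := h1.filter (fun c => decide (c.2.item = x))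
  rw [List.filter_filter] at h2
  simp only [Bool.and_self] at h2
  refine h2.eq_of_length ?_
  exact (((List.mergeSort_perm L _).filter _).length_eq).symm

/-- On a single item the calls already occur by type, so separating the types leaves their order as
it is. -/
theorem TypeOrdered.filter_item_eq {Q : List (Call N K V)} (hQ : TypeOrdered Q) (x : K) :
    (Q.filter (fun c => decide (c.2.accessType ≤ 1))).filter (fun c => decide (c.2.item = x)) ++
      ((Q.filter (fun c => decide (c.2.accessType = 2))).filter (fun c => decide (c.2.item = x)) ++
      (Q.filter (fun c => decide (c.2.accessType = 3))).filter
        (fun c => decide (c.2.item = x))) = Q.filter (fun c => decide (c.2.item = x)) := by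
  induction Q with
  | nil => rfl
  | cons c Q ih =>
    unfold TypeOrdered at hQ
    rw [List.pairwise_cons] at hQ
    have ih := ih hQ.2
    have hc := c.2.accessType_le
    have hempty : ∀ p : Call N K V → Bool, c.2.item = x →
        (∀ d, p d = true → d.2.accessType < c.2.accessType) →
        (Q.filter p).filter (fun c => decide (c.2.item = x)) = [] := by
      intro p hx hp
      rw [List.filter_eq_nil_iff]
      intro d hd hdx
      rw [List.mem_filter] at hd
      have h1 := hQ.1 d hd.1 (by rw [decide_eq_true_eq] at hdx; exact hx.trans hdx.symm)
      have h2 := hp d hd.2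
      omega
    by_cases hx : c.2.item = x
    · rw [List.filter_cons_of_pos (p := fun c : Call N K V => decide (c.2.item = x)) (by simpa using hx),
        ← ih]
      rcases (by omega : c.2.accessType ≤ 1 ∨ c.2.accessType = 2 ∨ c.2.accessType = 3) with h | h | h
      · simp [h, hx, show c.2.accessType ≠ 2 by omega, show c.2.accessType ≠ 3 by omega]
      · have e := hempty (fun d => decide (d.2.accessType ≤ 1)) hx fun d hd => by
          rw [decide_eq_true_eq] at hd; omega
        simp only [List.filter_filter] at e
        simp [h, hx, e]
      · have e := hempty (fun d => decide (d.2.accessType ≤ 1)) hx fun d hd => by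
          rw [decide_eq_true_eq] at hd; omega
        have e' := hempty (fun d => decide (d.2.accessType = 2)) hx fun d hd => by
          rw [decide_eq_true_eq] at hd; omega
        simp only [List.filter_filter] at e e'
        simp [h, hx, e, e']
    · rw [List.filter_cons_of_neg (p := fun c : Call N K V => decide (c.2.item = x)) (by simpa using hx),
        ← ih]
      have hf : ∀ p : Call N K V → Bool,
          ((c :: Q).filter p).filter (fun c => decide (c.2.item = x)) =
            (Q.filter p).filter (fun c => decide (c.2.item = x)) := by
        intro p
        rw [List.filter_filter, List.filter_cons_of_neg (by simp [hx]), List.filter_filter]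
      rw [hf, hf, hf]

end Reorder

variable [LinearOrder K]

/-- Every batch has a linearization whose finger bound is governed by the finger distances before
the batch (for searches and updates) and after its insertions (for insertions and deletions). -/
theorem exists_batch_order {M : K → Option V} {A : Finset K} (hM : HasSupport M A)
    {I Q : List (Call N K V)} (hI : ∀ c ∈ I, c.2.accessType ≠ 2 ∧ c.2.item ∉ A)
    (hQ : TypeOrdered Q) {A₁ : Finset K} (hA : ∀ y, y ∈ A₁ ↔ y ∈ A ∨
      ∃ c ∈ Q, c.2.accessType = 2 ∧ c.2.item = y) :
    ∃ L : List (Call N K V), L.Perm (I ++ Q) ∧ (seqResults M L).Perm (seqResults M (I ++ Q)) ∧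
      applyCalls M L = applyCalls M (I ++ Q) ∧
      (logSum A I : ℝ) + logSum A (Q.filter (fun c => decide (c.2.accessType ≤ 1))) +
        logSum A₁ (Q.filter (fun c => decide (c.2.accessType = 2))) +
        logSum A₁ (Q.filter (fun c => decide (c.2.accessType = 3))) ≤
        fingerBound M (L.map Prod.snd) := by
  set Q₁ := Q.filter (fun c => decide (c.2.accessType ≤ 1)) with e₁
  set Q₂ := Q.filter (fun c => decide (c.2.accessType = 2)) with e₂
  set Q₃ := Q.filter (fun c => decide (c.2.accessType = 3)) with e₃
  set r₂ : K → K → Bool := fun x y => decide (fd A₁ x ≤ fd A₁ y)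
  set r₃ : K → K → Bool := fun x y => decide (fd A₁ y ≤ fd A₁ x)
  set L₂ := Q₂.mergeSort (fun c d => r₂ c.2.item d.2.item)
  set L₃ := Q₃.mergeSort (fun c d => r₃ c.2.item d.2.item)
  have t₂ : ∀ x y z, r₂ x y = true → r₂ y z = true → r₂ x z = true := by
    intro x y z; simp only [r₂, decide_eq_true_eq]; omega
  have t₃ : ∀ x y z, r₃ x y = true → r₃ y z = true → r₃ x z = true := by
    intro x y z; simp only [r₃, decide_eq_true_eq]; omega
  have o₂ : ∀ x y, r₂ x y = true ∨ r₂ y x = true := by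
    intro x y; simp only [r₂, decide_eq_true_eq]; omega
  have o₃ : ∀ x y, r₃ x y = true ∨ r₃ y x = true := by
    intro x y; simp only [r₃, decide_eq_true_eq]; omega
  have s₂ : L₂.Pairwise (fun c d => fd A₁ c.2.item ≤ fd A₁ d.2.item) :=
    List.Pairwise.imp (fun h => by simpa [r₂] using h) (List.pairwise_mergeSort
      (le := fun c d : Call N K V => r₂ c.2.item d.2.item) (fun a b c => t₂ _ _ _)
      (fun a b => by rw [Bool.or_eq_true]; exact o₂ _ _) Q₂)
  have s₃ : L₃.Pairwise (fun c d => fd A₁ d.2.item ≤ fd A₁ c.2.item) :=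
    List.Pairwise.imp (fun h => by simpa [r₃] using h) (List.pairwise_mergeSort
      (le := fun c d : Call N K V => r₃ c.2.item d.2.item) (fun a b c => t₃ _ _ _)
      (fun a b => by rw [Bool.or_eq_true]; exact o₃ _ _) Q₃)
  have p₂ : L₂.Perm Q₂ := List.mergeSort_perm _ _
  have p₃ : L₃.Perm Q₃ := List.mergeSort_perm _ _
  -- Separating the types and sorting stably by a function of the item both keep the order of the
  -- calls on each item, which is all that matters for results and effects.
  have hfil : ∀ x, ((I ++ Q₁) ++ (L₂ ++ L₃)).filter (fun c => decide (c.2.item = x)) =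
      (I ++ Q).filter (fun c => decide (c.2.item = x)) := by
    intro x
    rw [List.filter_append, List.filter_append, List.filter_append, List.filter_append,
      filter_mergeSort_item r₂ (fun x => by simp [r₂]) t₂ o₂,
      filter_mergeSort_item r₃ (fun x => by simp [r₃]) t₃ o₃, List.append_assoc,
      hQ.filter_item_eq]
  obtain ⟨q1, q2⟩ := seqResults_perm_of_filter_eq _ _ M hfil
  refine ⟨(I ++ Q₁) ++ (L₂ ++ L₃), ?_, q1, q2, ?_⟩
  · classical
    -- A call is counted among the calls on its own item, and these sublists are equal.
    rw [List.perm_iff_count]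
    intro c
    have h1 := congrArg (List.count c) (hfil c.2.item)
    rwa [List.count_filter (by simp), List.count_filter (by simp)] at h1
  · obtain ⟨n1, n2⟩ := fingerBound_of_neutral (C := I ++ Q₁) hM fun c hc => by
      rcases List.mem_append.mp hc with hc | hc
      · have h1 := hI c hc
        have h2 := c.2.accessType_le
        rcases (by omega : c.2.accessType ≤ 1 ∨ c.2.accessType = 3) with h | h
        · exact Or.inl h
        · exact Or.inr ⟨h, h1.2⟩
      · left
        simpa using (List.mem_filter.mp hc).2
    have m₂ : ∀ c ∈ L₂, c.2.accessType = 2 := fun c hc => by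
      simpa using (List.mem_filter.mp (p₂.mem_iff.mp hc)).2
    have m₃ : ∀ c ∈ L₃, c.2.accessType = 3 := fun c hc => by
      simpa using (List.mem_filter.mp (p₃.mem_iff.mp hc)).2
    obtain ⟨⟨A₂, i1, i2⟩, i3⟩ := fingerBound_of_insertions (C := L₂) n1 m₂ s₂ fun y hy => by
      rcases (hA y).mp hy with h | ⟨c, hc, h2, rfl⟩
      · exact Or.inl h
      · exact Or.inr ⟨c, p₂.mem_iff.mpr (List.mem_filter.mpr ⟨hc, by simpa using h2⟩), rfl⟩
    have i4 := fingerBound_of_deletions (C := L₃) i1 m₃ s₃ fun y hy => Or.inl (i2 hy)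
    rw [fingerBound_append M (I ++ Q₁), fingerBound_append _ L₂, ← logSum_perm A₁ p₂,
      ← logSum_perm A₁ p₃]
    rw [logSum_append] at n2
    push_cast at n2
    linarith

end

/-! ### The invariant between batches, and the charging of sorting and deletions to finger distances
-/

section

variable {N : Type w} {K : Type u} {V : Type v} [LinearOrder K]

/-! ## The state between batches -/

namespace FS1

/-- The invariant that holds between batches. -/
structure Inv (S : FS1 K V) (n : ℕ) : Prop where
  pos : 1 ≤ n
  hasLength : S.HasLength n
  sorted : S.Sorted
  tidy : ∀ i, Chain.Tidy (S.chain i)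

/-- The set of items. -/
def items (S : FS1 K V) : Finset K := (S.entries.map Prod.fst).toFinset

theorem mem_items {S : FS1 K V} {x : K} : x ∈ S.items ↔ ∃ e ∈ S.entries, e.1 = x := by
  simp [items]

theorem hasSupport_toMap (S : FS1 K V) : HasSupport S.toMap S.items := by
  intro x
  rw [mem_items, ← Segment.entry_isSome_iff, ← Option.isSome_iff_ne_none]
  rfl

omit [LinearOrder K] in
theorem mem_entries_of_mem_seg {S : FS1 K V} {i : Side} {k : ℕ} (hk : k < (S.chain i).length)
    {e : K × V} (he : e ∈ S.seg i k) : e ∈ S.entries := by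
  have h1 : e ∈ S.inward i := by rw [inward_eq hk]; simp [he]
  cases i
  · exact h1
  · rw [inward_back] at h1; simpa using h1

theorem Inv.length_seg_le {S : FS1 K V} {n : ℕ} (h : S.Inv n) (i : Side) (k : ℕ) :
    (S.seg i k).length ≤ 3 * cap k := by
  rcases Nat.lt_or_ge k n with hk | hk
  · have h1 := (h.tidy i k (by rw [h.hasLength]; exact hk)).1
    have h2 : Chain.size (S.chain i) k = (S.seg i k).length := rfl
    unfold Chain.Overfull target at h1
    omega
  · have : S.seg i k = [] := List.getD_eq_default _ _ (by rw [h.hasLength]; exact hk)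
    rw [this]; simp

theorem Sorted.seg {S : FS1 K V} (h : S.Sorted) {i : Side} {k : ℕ}
    (hk : k < (S.chain i).length) : (S.seg i k).SortedBy i := by
  have := h.inward i
  rw [inward_eq hk, Segment.SortedBy, List.pairwise_append, List.pairwise_append] at this
  exact this.2.1.1

/-- Items deep inside the structure have a large finger distance. -/
theorem Inv.two_pow_fitIdx_le {S : FS1 K V} {n : ℕ} (h : S.Inv n) (x : K) :
    2 ^ S.fitIdx x ≤ Nat.log 2 (fd S.items x) + 1 := by
  rcases Nat.eq_zero_or_pos (S.fitIdx x) with h0 | h0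
  · rw [h0]; omega
  obtain ⟨k, hk⟩ : ∃ k, S.fitIdx x = k + 1 := ⟨S.fitIdx x - 1, by omega⟩
  have hkn : k + 1 < n := hk ▸ fitIdx_lt h.hasLength h.pos x
  -- Segment k is neither last nor underfull, so it holds at least c(k) items; as x fits only in
  -- section k + 1, all of them come before x from that end.
  have key : ∀ i : Side, cap k ≤ rank i S.items x := by
    intro i
    have hkc : k < (S.chain i).length := by rw [h.hasLength]; omega
    have h1 := (h.tidy i k hkc).2
    have h2 : Chain.size (S.chain i) k = (S.seg i k).length := rfl
    unfold Chain.Underfull Chain.IsLast target at h1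
    rw [h.hasLength] at h1
    have h3 : cap k ≤ (S.seg i k).length := by omega
    refine h3.trans ?_
    have h4 : ((S.seg i k).map Prod.fst).Nodup := by
      rw [List.Nodup, List.pairwise_map]
      exact List.Pairwise.imp (fun h => Side.ne_of_lt h) (h.sorted.seg hkc)
    have h5 := List.toFinset_card_of_nodup h4
    rw [List.length_map] at h5
    rw [← h5]
    refine Finset.card_le_card fun y hy => ?_
    obtain ⟨e, he, rfl⟩ := List.mem_map.mp (List.mem_toFinset.mp hy)
    rw [Finset.mem_filter]
    exact ⟨mem_items.mpr ⟨e, mem_entries_of_mem_seg hkc he, rfl⟩,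
      lt_of_fitsSeg (by omega) (fitsSeg_of_mem he)⟩
  have h1 := key .front
  have h2 := key .back
  have h3 : cap k ≤ fd S.items x := by unfold fd; omega
  have h4 := Nat.log_mono_right (b := 2) h3
  rw [cap, Nat.log_pow (by norm_num)] at h4
  rw [hk]; omega

end FS1

/-! ## Sums over batches -/

theorem sum_toFinset_le (f : K → ℕ) (l : List K) : ∑ x ∈ l.toFinset, f x ≤ (l.map f).sum := by
  induction l with
  | nil => simp
  | cons x l ih =>
    rw [List.toFinset_cons, List.map_cons, List.sum_cons]
    by_cases hx : x ∈ l.toFinset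
    · rw [Finset.insert_eq_of_mem hx]; omega
    · rw [Finset.sum_insert hx]; omega

theorem credit_sum_le (S : FS1 K V) (k : ℕ) (G : List (Group N K V)) (hv : ∀ g ∈ G, g.Valid) :
    (G.map (credit S k)).sum ≤
      2 * ((G.flatMap Group.ops).map fun c => 2 ^ S.fitIdx c.2.item).sum := by
  induction G with
  | nil => simp
  | cons g G ih =>
    have ih := ih fun g hg => hv g (by simp [hg])
    have h1 : (g.ops.map fun c => 2 ^ S.fitIdx c.2.item).sum =
        g.ops.length * 2 ^ S.fitIdx g.item := by
      rw [List.map_congr_left fun c hc => by rw [(hv g (by simp)).item c hc]]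
      simp
    have h2 : credit S k g ≤ g.ops.length * (2 * 2 ^ S.fitIdx g.item) := by
      unfold credit
      refine Nat.mul_le_mul_left _ ((Nat.sub_le _ _).trans (le_of_eq ?_))
      ring
    rw [List.map_cons, List.sum_cons, List.flatMap_cons, List.map_append, List.sum_append, h1]
    have : g.ops.length * (2 * 2 ^ S.fitIdx g.item) = 2 * (g.ops.length * 2 ^ S.fitIdx g.item) := by
      ring
    omega

/-- The set in which finger distances are measured, for accesses of type `a`. -/
def measureSet (A A₁ : Finset K) (a : ℕ) : Finset K := if a ≤ 1 then A else A₁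

/-- The total logarithmic finger distance, measured according to the type. -/
noncomputable def typedSum (A A₁ : Finset K) (C : List (Call N K V)) : ℕ :=
  (C.map fun c => Nat.log 2 (fd (measureSet A A₁ c.2.accessType) c.2.item) + 1).sum

theorem typedSum_append (A A₁ : Finset K) (C C' : List (Call N K V)) :
    typedSum A A₁ (C ++ C') = typedSum A A₁ C + typedSum A A₁ C' := by
  simp [typedSum]

theorem typedSum_perm (A A₁ : Finset K) {C C' : List (Call N K V)} (h : C.Perm C') :
    typedSum A A₁ C = typedSum A A₁ C' := (h.map _).sum_eq

theorem typedSum_eq (A A₁ : Finset K) (Q : List (Call N K V)) :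
    typedSum A A₁ Q = logSum A (Q.filter (fun c => decide (c.2.accessType ≤ 1))) +
      logSum A₁ (Q.filter (fun c => decide (c.2.accessType = 2))) +
      logSum A₁ (Q.filter (fun c => decide (c.2.accessType = 3))) := by
  induction Q with
  | nil => rfl
  | cons c Q ih =>
    have h1 : typedSum A A₁ (c :: Q) =
        Nat.log 2 (fd (measureSet A A₁ c.2.accessType) c.2.item) + 1 + typedSum A A₁ Q := by
      simp [typedSum]
    have hc := c.2.accessType_le
    rw [h1, ih]
    unfold measureSet
    rcases (by omega : c.2.accessType ≤ 1 ∨ c.2.accessType = 2 ∨ c.2.accessType = 3) with h | h | h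
    · rw [if_pos h, List.filter_cons_of_pos (by simpa using h),
        List.filter_cons_of_neg (by rw [decide_eq_true_eq]; omega),
        List.filter_cons_of_neg (by rw [decide_eq_true_eq]; omega), logSum_cons]
      omega
    · rw [if_neg (by omega), List.filter_cons_of_neg (by rw [decide_eq_true_eq]; omega),
        List.filter_cons_of_pos (by simpa using h),
        List.filter_cons_of_neg (by rw [decide_eq_true_eq]; omega), logSum_cons]
      omega
    · rw [if_neg (by omega), List.filter_cons_of_neg (by rw [decide_eq_true_eq]; omega),
        List.filter_cons_of_neg (by rw [decide_eq_true_eq]; omega),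
        List.filter_cons_of_pos (by simpa using h), logSum_cons]
      omega

theorem logSum_le_typedSum {A A₁ : Finset K} (h : A ⊆ A₁) (C : List (Call N K V)) :
    logSum A C ≤ typedSum A A₁ C := by
  refine List.sum_le_sum fun c _ => ?_
  unfold measureSet
  split_ifs
  · exact le_rfl
  · exact Nat.add_le_add_right (Nat.log_mono_right (fd_mono h _)) 1

/-- Keys of one type have distinct items in one common set, so each of the four types contributes at
most 4. -/
theorem sum_keys_inv_sq_le {A A₁ : Finset K} (J : Finset (ℕ ×ₗ K)) (h3 : ∀ j ∈ J, (ofLex j).1 ≤ 3)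
    (hJ : ∀ j ∈ J, (ofLex j).2 ∈ measureSet A A₁ (ofLex j).1) :
    ∑ j ∈ J, 1 / (fd (measureSet A A₁ (ofLex j).1) (ofLex j).2 : ℝ) ^ 2 ≤ 16 := by
  rw [← Finset.sum_fiberwise_of_maps_to (t := Finset.range 4) (g := fun j => (ofLex j).1)
    (fun j hj => Finset.mem_range.mpr (by have := h3 j hj; omega))]
  have key : ∀ a ∈ Finset.range 4, ∑ j ∈ J with (ofLex j).1 = a,
      1 / (fd (measureSet A A₁ (ofLex j).1) (ofLex j).2 : ℝ) ^ 2 ≤ 4 := by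
    intro a _
    have h1 : ∑ j ∈ J with (ofLex j).1 = a,
        1 / (fd (measureSet A A₁ (ofLex j).1) (ofLex j).2 : ℝ) ^ 2 =
        ∑ x ∈ (J.filter (fun j => (ofLex j).1 = a)).image (fun j => (ofLex j).2),
          1 / (fd (measureSet A A₁ a) x : ℝ) ^ 2 := by
      rw [Finset.sum_image]
      · refine Finset.sum_congr rfl fun j hj => ?_
        rw [(Finset.mem_filter.mp hj).2]
      · intro j hj j' hj' h
        have e := (Finset.mem_filter.mp hj).2
        have e' := (Finset.mem_filter.mp hj').2
        exact ofLex.injective (Prod.ext (e.trans e'.symm) h)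
    rw [h1]
    refine sum_inv_sq_fd_le fun x hx => ?_
    obtain ⟨j, hj, rfl⟩ := Finset.mem_image.mp hx
    rw [Finset.mem_filter] at hj
    rw [← hj.2]
    exact hJ j hj.1
  refine (Finset.sum_le_sum key).trans ?_
  norm_num

/-- The cost of sorting the effectual operations. -/
theorem cost_sortBatch_effectual {A A₁ : Finset K} {T : Option (BTree (Call N K V))}
    {L : List (Call N K V)} (hT : Represents T L)
    (hL : ∀ c ∈ L, c.2.item ∈ measureSet A A₁ c.2.accessType) :
    (cost (sortBatch T).log : ℝ) ≤ 12 * typedSum A A₁ L + 192 * L.length := by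
  have h := cost_sortBatch_of_weights hT
    (fun j => fd (measureSet A A₁ (ofLex j).1) (ofLex j).2) (fun _ => one_le_fd _ _)
  have h1 : ∑ j ∈ (L.map callKey).toFinset,
      1 / (fd (measureSet A A₁ (ofLex j).1) (ofLex j).2 : ℝ) ^ 2 ≤ 16 := by
    refine sum_keys_inv_sq_le _ (fun j hj => ?_) fun j hj => ?_
    · obtain ⟨c, hc, rfl⟩ := List.mem_map.mp (List.mem_toFinset.mp hj)
      exact c.2.accessType_le
    · obtain ⟨c, hc, rfl⟩ := List.mem_map.mp (List.mem_toFinset.mp hj)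
      exact hL c hc
  have h2 : (typedSum A A₁ L : ℝ) = (L.map fun c => ((Nat.log 2 (fd (measureSet A A₁
      (ofLex (callKey c)).1) (ofLex (callKey c)).2) : ℝ) + 1)).sum := by
    unfold typedSum
    rw [Nat.cast_list_sum, List.map_map]
    congr 1
    refine List.map_congr_left fun c _ => ?_
    simp [callKey]
  rw [← h2] at h
  have h3 := mul_le_mul_of_nonneg_left h1 (by positivity : (0 : ℝ) ≤ 12 * L.length)
  linarith

/-- Deletions are paid for by their finger distances. -/
theorem typeCount_mul_log_le {A : Finset K} {G : List (Group N K V)} (hs : SortedGroups G)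
    (hv : ∀ g ∈ G, g.Valid) (hA : ∀ g ∈ G, g.accessType = 3 → g.item ∈ A)
    {Q : List (Call N K V)} (hQ : ∀ g ∈ G, ∀ c ∈ g.ops, c ∈ Q) :
    typeCount 3 G * (Nat.log 2 (typeCount 3 G) + 1) ≤
      4 * logSum A (Q.filter (fun c => decide (c.2.accessType = 3))) := by
  set G₃ := G.filter (fun g => decide (g.accessType = 3))
  have hm : ∀ g ∈ G₃, g ∈ G ∧ g.accessType = 3 := fun g hg => by
    simpa using List.mem_filter.mp hg
  -- Groups with the same type and strictly increasing keys have distinct items, so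
  -- `card_mul_log_le` applies to the items deleted.
  have h1 : (G₃.map Group.item).Nodup := by
    rw [List.Nodup, List.pairwise_map]
    refine List.Pairwise.imp_of_mem ?_ (hs.filter _)
    intro g g' hg hg' hlt heq
    refine hlt.ne ?_
    unfold Group.key
    rw [(hm g hg).2, (hm g' hg').2, heq]
  have h2 : typeCount 3 G = ((G₃.map Group.item).toFinset).card := by
    rw [List.toFinset_card_of_nodup h1, List.length_map]; rfl
  rw [h2]
  refine (card_mul_log_le (A := A) ?_).trans (Nat.mul_le_mul_left 4 ?_)
  · intro x hx
    obtain ⟨g, hg, rfl⟩ := List.mem_map.mp (List.mem_toFinset.mp hx)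
    exact hA g (hm g hg).1 (hm g hg).2
  · set Q₃ := Q.filter (fun c => decide (c.2.accessType = 3))
    have h3 : (G₃.map Group.item).toFinset ⊆ (Q₃.map fun c => c.2.item).toFinset := by
      intro x hx
      obtain ⟨g, hg, rfl⟩ := List.mem_map.mp (List.mem_toFinset.mp hx)
      have hgv := hv g (hm g hg).1
      obtain ⟨c, hc⟩ := List.exists_mem_of_ne_nil _ hgv.nonempty
      rw [List.mem_toFinset, List.mem_map]
      refine ⟨c, List.mem_filter.mpr ⟨hQ g (hm g hg).1 c hc, ?_⟩, hgv.item c hc⟩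
      rw [hgv.type c hc, (hm g hg).2]; rfl
    refine (Finset.sum_le_sum_of_subset h3).trans ((sum_toFinset_le _ _).trans ?_)
    rw [List.map_map]
    exact le_rfl

/-- The first slab is chosen just long enough for this: an operation that passes it has 2^fitIdx ≥
log b + 1, so ordinary sorting of the residual operations is within their finger bound. -/
theorem log_le_two_pow_slabSize {b : ℕ} (hb : 1 ≤ b) : Nat.log 2 b + 1 ≤ 2 ^ slabSize b := by
  have h1 : Nat.log 2 b + 1 ≤ Nat.clog 2 (2 * b) := by
    rw [← Nat.log_mul_base (by norm_num) (by omega), mul_comm]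
    exact Nat.log_le_clog _ _
  have h2 := Nat.le_pow_clog (b := 2) (by norm_num) (Nat.clog 2 (2 * b))
  unfold slabSize
  rw [pow_succ]
  omega

theorem seqResults_ineffectual {M : K → Option V} {I : List (Call N K V)}
    (hI : ∀ c ∈ I, c.2.accessType ≠ 2 ∧ M c.2.item = none) :
    seqResults M I = I.map (fun c => (c.1, none)) ∧ applyCalls M I = M := by
  induction I with
  | nil => exact ⟨rfl, rfl⟩
  | cons c I ih =>
    obtain ⟨h1, h2⟩ := hI c (by simp)
    have h3 : c.2.perform M = M := by
      unfold MapOp.perform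
      rw [h2]
      have : c.2.effect none = none := by
        cases hc : c.2 <;> simp [hc, MapOp.accessType, MapOp.effect] at *
      rw [this, ← h2, Function.update_eq_self]
    obtain ⟨i1, i2⟩ := ih fun c hc => hI c (by simp [hc])
    simp only [seqResults, applyCalls_cons, h3, i1, i2, h2, List.map_cons, and_self]

theorem perm_three_filters {α : Type*} (p q r : α → Bool) (l : List α)
    (h : ∀ x ∈ l, (p x = true ∧ q x = false ∧ r x = false) ∨
      (p x = false ∧ q x = true ∧ r x = false) ∨ (p x = false ∧ q x = false ∧ r x = true)) :
    (l.filter p ++ (l.filter q ++ l.filter r)).Perm l := by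
  have h1 : l.filter q = (l.filter (fun x => !p x)).filter q := by
    rw [List.filter_filter]
    refine List.filter_congr fun x hx => ?_
    rcases h x hx with h | h | h <;> simp [h.1, h.2.1]
  have h2 : l.filter r = (l.filter (fun x => !p x)).filter (fun x => !q x) := by
    rw [List.filter_filter]
    refine List.filter_congr fun x hx => ?_
    rcases h x hx with h | h | h <;> simp [h.1, h.2.1, h.2.2]
  rw [h1, h2]
  exact ((List.filter_append_perm _ _).append_left _).trans (List.filter_append_perm _ _)

end

/-! ### Execution on both slabs, and rebalancing thereafter -/

section

variable {N : Type w} {K : Type u} {V : Type v} [LinearOrder K]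

/-! ## Both slabs -/

omit [LinearOrder K] in
theorem TypeOrdered.append_of_ne {Q Q' : List (Call N K V)} (h : TypeOrdered Q)
    (h' : TypeOrdered Q') (hne : ∀ c ∈ Q, ∀ d ∈ Q', c.2.item ≠ d.2.item) :
    TypeOrdered (Q ++ Q') :=
  List.pairwise_append.mpr ⟨h, h', fun c hc d hd he => absurd he (hne c hc d hd)⟩

omit [LinearOrder K] in
theorem item_of_mem_perm {G : List (Group N K V)} (hv : ∀ g ∈ G, g.Valid) {Q : List (Call N K V)}
    (hQ : Q.Perm (G.flatMap Group.ops)) {c : Call N K V} (hc : c ∈ Q) :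
    ∃ g ∈ G, c.2.item = g.item := by
  obtain ⟨g, hg, hcg⟩ := List.mem_flatMap.mp (hQ.mem_iff.mp hc)
  exact ⟨g, hg, (hv g hg).item c hcg⟩

open FS1 in
theorem execSlabs_spec {S : FS1 K V} {n m : ℕ} (hS : S.Inv n) {G₁ G₂ : List (Group N K V)}
    (R : List (N × Option V)) (hv₁ : ∀ g ∈ G₁, g.Valid) (hv₂ : ∀ g ∈ G₂, g.Valid)
    (hf₁ : ∀ g ∈ G₁, S.fitIdx g.item < m) (hf₂ : ∀ g ∈ G₂, m ≤ S.fitIdx g.item) {Λ₁ Λ₂ : ℕ}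
    (hΛ₁ : Nat.log 2 (typeCount 3 G₁) + 1 ≤ Λ₁) (hΛ₂ : Nat.log 2 (typeCount 3 G₂) + 1 ≤ Λ₂)
    (r₁ r₂ : Costed (ExecState N K V × ℕ)) (hr₁ : r₁ = execSlab (min m n) 0 ⟨S, G₁, R⟩)
    (hr₂ : r₂ = execSlab (n - m) m ⟨r₁.val.1.str, G₂, r₁.val.1.results⟩) :
    ∃ Q : List (Call N K V), r₂.val.1.str.Sorted ∧ r₂.val.1.str.HasLength n ∧
      r₂.val.1.results = R ++ seqResults S.toMap Q ∧
      r₂.val.1.str.toMap = applyCalls S.toMap Q ∧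
      Q.Perm (G₁.flatMap Group.ops ++ G₂.flatMap Group.ops) ∧ TypeOrdered Q ∧
      r₁.val.2 + (r₂.val.2 - m) ≤ (G₁.map (credit S 0)).sum + (G₂.map (credit S m)).sum ∧
      (∀ i j, ¬ (j < r₁.val.2 ∨ (m ≤ j ∧ j < r₂.val.2)) → r₂.val.1.str.seg i j = S.seg i j) ∧
      cost r₁.log + cost r₂.log + r₂.val.1.str.pot ≤ S.pot +
        33305 * ((G₁.map (credit S 0)).sum + (G₂.map (credit S m)).sum) +
        (typeCount 3 G₁ : ℝ) * Λ₁ + (typeCount 3 G₂ : ℝ) * Λ₂ := by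
  have hlen := fun i k => hS.length_seg_le i k
  have hI : ExecInv S n 0 (⟨S, G₁, R⟩ : ExecState N K V) :=
    ⟨hS.sorted, hS.hasLength, fun _ _ _ => rfl, fun x _ i e he => by simp [outer] at he,
      hv₁, fun _ _ => Nat.zero_le _⟩
  obtain ⟨Q₁, a1, a2, a3, a4, a5, a6, -, a8, a9, a10, a11⟩ :=
    execSlab_spec hS.hasLength hlen (min m n) 0 _ hI (by omega) (fun g hg => by
      have := hf₁ g hg
      have := fitIdx_lt hS.hasLength hS.pos g.item
      omega) hΛ₁ r₁ hr₁
  simp only at a3 a4 a5 a9 a10 a11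
  -- If the first slab extends beyond all sections, there are no residual operations, and the run on
  -- the final slab does nothing and stops at index m.
  rcases Nat.lt_or_ge n m with hnm | hmn
  · have hG₂ : G₂ = [] := by
      refine List.eq_nil_iff_forall_not_mem.mpr fun g hg => ?_
      have := hf₂ g hg
      have := fitIdx_lt hS.hasLength hS.pos g.item
      omega
    subst hG₂
    have e : r₂ = ⟨(⟨r₁.val.1.str, [], r₁.val.1.results⟩, m), []⟩ := by
      rw [hr₂, Nat.sub_eq_zero_of_le hnm.le]; rfl
    subst e
    refine ⟨Q₁, a1.sorted, a1.hasLength, a3, a4, by simpa using a5, a6, ?_, ?_, ?_⟩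
    · simp only [List.map_nil, List.sum_nil]; omega
    · intro i j hj
      exact a10 i j (Or.inr (by simp only at hj; omega))
    · simp only [cost_nil, List.map_nil, List.sum_nil, Nat.cast_zero, add_zero, typeCount,
        List.filter_nil, List.length_nil, zero_mul]
      exact a11
  · rw [Nat.zero_add, Nat.min_eq_left hmn] at a1
    have hI' : ExecInv S n m (⟨r₁.val.1.str, G₂, r₁.val.1.results⟩ : ExecState N K V) :=
      ⟨a1.sorted, a1.hasLength, a1.seg_eq, a1.outer_lt, hv₂, hf₂⟩
    obtain ⟨Q₂, b1, b2, b3, b4, b5, b6, b7, b8, b9, b10, b11⟩ :=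
      execSlab_spec hS.hasLength hlen (n - m) m _ hI' (by omega) (fun g hg => by
        have := fitIdx_lt hS.hasLength hS.pos g.item
        omega) hΛ₂ r₂ hr₂
    simp only at b3 b4 b5 b9 b10 b11
    refine ⟨Q₁ ++ Q₂, b1.sorted, b1.hasLength, ?_, ?_, a5.append b5, a6.append_of_ne b6 ?_,
      by omega, ?_, ?_⟩
    · rw [b3, a3, a4, seqResults_append, List.append_assoc]
    · rw [b4, a4, applyCalls_append]
    · intro c hc d hd h
      obtain ⟨g, hg, e⟩ := item_of_mem_perm hv₁ a5 hc
      obtain ⟨g', hg', e'⟩ := item_of_mem_perm hv₂ b5 hd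
      have h1 := hf₁ g hg
      have h2 := hf₂ g' hg'
      rw [← e, h, e'] at h1
      omega
    · intro i j hj
      rw [b10 i j (by omega), a10 i j (by omega)]
    · linarith

/-! ## Rebalancing after the execution phase -/

theorem unskipped_slabs_le (m e₁ e₂ : ℕ) :
    Chain.unskipped (fun k => decide (¬ (k < e₁ ∨ (m ≤ k ∧ k < e₂)))) (max e₁ e₂) 0 ≤
      e₁ + (e₂ - m) := by
  have : Chain.unskipped (fun k => decide (¬ (k < e₁ ∨ (m ≤ k ∧ k < e₂)))) (max e₁ e₂) 0 ≤
      (Finset.range e₁ ∪ Finset.Ico m e₂).card := by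
    refine Finset.card_le_card fun j hj => ?_
    simp only [Finset.mem_filter, decide_eq_false_iff_not, not_not] at hj
    simpa using hj.2.2
  refine this.trans ((Finset.card_union_le _ _).trans ?_)
  simp

-- Skipped sections are as they were before the batch and hence balanced. That is all that
-- `Chain.Ready` demands at index 0, where its other clauses are vacuous.
open FS1 in
theorem rebalance_after_exec {S S₁ : FS1 K V} {n m e₁ e₂ : ℕ} (hS : S.Inv n)
    (hs : S₁.Sorted) (hn : S₁.HasLength n)
    (hseg : ∀ i j, ¬ (j < e₁ ∨ (m ≤ j ∧ j < e₂)) → S₁.seg i j = S.seg i j)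
    (r : Costed (FS1 K V))
    (hr : r = S₁.rebalance m (fun k => decide (¬ (k < e₁ ∨ (m ≤ k ∧ k < e₂))))) :
    (∃ n', r.val.Inv n') ∧ r.val.toMap = S₁.toMap ∧
      cost r.log + r.val.pot ≤ S₁.pot + 10 + 4 * ((e₁ + (e₂ - m) : ℕ) : ℝ) := by
  have hready : ∀ i, Chain.Ready (fun k => decide (¬ (k < e₁ ∨ (m ≤ k ∧ k < e₂)))) 0
      (S₁.chain i) := by
    intro i
    refine ⟨fun _ h => absurd h (by omega), fun h => absurd h (by omega),
      fun _ h => absurd h (by omega), fun j _ hj hsk => ?_⟩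
    have h1 : Chain.size (S₁.chain i) j = Chain.size (S.chain i) j :=
      congrArg List.length (hseg i j (of_decide_eq_true hsk))
    have h2 : (S₁.chain i).length = (S.chain i).length := by rw [hn, hS.hasLength]
    rw [Chain.overfull_congr h1, Chain.underfull_congr h2 h1]
    exact hS.tidy i j (by omega)
  obtain ⟨h1, h2, h3, h4, h5, h6⟩ := rebalance_spec (m := m) (E := max e₁ e₂)
    (fun k hk h j hkj hj => by simp only [decide_eq_true_eq] at h ⊢; omega)
    (fun k hk h j hkj => by simp only [decide_eq_true_eq] at h ⊢; omega)
    (fun j hj => by simp only [decide_eq_true_eq]; omega)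
    hn.front hn.back hS.pos (hready .front) (hready .back) r hr
  refine ⟨⟨_, h3, fun i => ?_, ?_, fun i => ?_⟩, ?_, ?_⟩
  · cases i
    · rfl
    · exact h2.symm
  · unfold Sorted; rw [h1]; exact hs
  · cases i
    · exact h4
    · exact h5
  · unfold toMap; rw [h1]
  · have := unskipped_slabs_le m e₁ e₂
    have : (Chain.unskipped (fun k => decide (¬ (k < e₁ ∨ (m ≤ k ∧ k < e₂)))) (max e₁ e₂) 0 : ℝ) ≤
      ((e₁ + (e₂ - m) : ℕ) : ℝ) := by exact_mod_cast this
    linarith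

end

/-! ### The amortized bound for one batch -/

section

variable {N : Type w} {K : Type u} {V : Type v} [LinearOrder K]

/-! ## One batch -/

omit [LinearOrder K] in
theorem length_le_flatMap_ops {G : List (Group N K V)} (hv : ∀ g ∈ G, g.Valid) :
    G.length ≤ (G.flatMap Group.ops).length := by
  induction G with
  | nil => simp
  | cons g G ih =>
    have h1 := ih fun g hg => hv g (by simp [hg])
    have h2 := List.length_pos_of_ne_nil (hv g (by simp)).nonempty
    rw [List.flatMap_cons, List.length_append, List.length_cons]
    omega

omit [LinearOrder K] in
theorem length_mul_log_le_sum {f : Call N K V → ℕ} {L : List (Call N K V)} {l : ℕ}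
    (h : ∀ c ∈ L, Nat.log 2 l + 1 ≤ f c) : L.length * (Nat.log 2 l + 1) ≤ (L.map f).sum := by
  have := List.card_nsmul_le_sum (L.map f) (Nat.log 2 l + 1) (fun x hx => by
    obtain ⟨c, hc, rfl⟩ := List.mem_map.mp hx
    exact h c hc)
  simpa using this

theorem length_le_logSum (A : Finset K) (L : List (Call N K V)) : L.length ≤ logSum A L := by
  induction L with
  | nil => simp
  | cons c L ih => rw [logSum_cons, List.length_cons]; omega

omit [LinearOrder K] in
theorem log_typeCount_le {G : List (Group N K V)} (hv : ∀ g ∈ G, g.Valid) (a : ℕ)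
    {L : List (Call N K V)} (hL : (G.flatMap Group.ops).Perm L) :
    typeCount a G * (Nat.log 2 (typeCount a G) + 1) ≤ L.length * (Nat.log 2 L.length + 1) := by
  have h1 : typeCount a G ≤ L.length :=
    (List.length_filter_le _ _).trans ((length_le_flatMap_ops hv).trans_eq hL.length_eq)
  exact Nat.mul_le_mul h1 (Nat.add_le_add_right (Nat.log_mono_right h1) 1)

-- Every cost is compared with X, the sum of the logarithmic distances in the items before the batch
-- (ineffectual calls, searches, updates) or in those together with all inserted items (other
-- insertions and deletions). The largest share is 2 * 33305 for the execution phase; everything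
-- else fits below 70000.
open FS1 in
theorem runBatch_spec {S : FS1 K V} {n : ℕ} (hS : S.Inv n) {B : List (Call N K V)} (hB : B ≠ [])
    {Teff Tres : Option (BTree (Call N K V))}
    (repr_eff : Represents Teff (effectual (tagBatch S B).val))
    (repr_res : Represents Tres (residual (tagBatch S B).val)) :
    (∃ n', (runBatch S B Teff Tres).val.1.Inv n') ∧ ∃ L : List (Call N K V), L.Perm B ∧
      (seqResults S.toMap L).Perm (runBatch S B Teff Tres).val.2 ∧
      applyCalls S.toMap L = (runBatch S B Teff Tres).val.1.toMap ∧
      cost (runBatch S B Teff Tres).log + (runBatch S B Teff Tres).val.1.pot ≤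
        S.pot + 70000 * fingerBound S.toMap (L.map Prod.snd) := by
  obtain rfl : S.sections = n := hS.hasLength.sections_eq
  set m := slabSize B.length with hm
  obtain ⟨t1, t2, t3, t4⟩ := tagBatch_spec hS.hasLength hS.pos hS.sorted
    (fun i k => hS.length_seg_le i k) B m hm
  obtain ⟨u1, u2, u3⟩ := sortBatch_spec repr_eff
  obtain ⟨v1, v2, v3⟩ := sortBatch_spec repr_res
  set I := ineffectual (tagBatch S B).val with hI
  set eff := effectual (tagBatch S B).val with heff
  set res := residual (tagBatch S B).val with hres
  set G₁ := (sortBatch Teff).val with hG₁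
  set G₂ := (sortBatch Tres).val with hG₂
  set W := (B.map fun c => 2 ^ S.fitIdx c.2.item).sum with hW
  have mI : ∀ c ∈ I, S.toMap c.2.item = none ∧ c.2.accessType ≠ 2 := fun c hc => by
    rw [t1, List.mem_filter, decide_eq_true_eq] at hc; exact hc.2.2
  have mE : ∀ c ∈ eff, S.fitIdx c.2.item < m ∧
      (S.toMap c.2.item ≠ none ∨ c.2.accessType = 2) := fun c hc => by
    rw [t2, List.mem_filter, decide_eq_true_eq] at hc; exact hc.2
  have mR : ∀ c ∈ res, m ≤ S.fitIdx c.2.item := fun c hc => by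
    rw [t3, List.mem_filter, decide_eq_true_eq] at hc; exact hc.2
  have hfilter : (I ++ (eff ++ res)).Perm B := by
    rw [t1, t2, t3]
    refine perm_three_filters _ _ _ _ fun c _ => ?_
    simp only [decide_eq_true_eq, decide_eq_false_iff_not]
    rcases Nat.lt_or_ge (S.fitIdx c.2.item) m with h | h
    · by_cases h1 : S.toMap c.2.item = none <;> by_cases h2 : c.2.accessType = 2 <;>
        simp [h, h1, h2]
    · simp [h, Nat.not_lt.mpr h]
  have key : ∀ {G : List (Group N K V)} {l : List (Call N K V)} (_ : ∀ g ∈ G, g.Valid)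
      (_ : (G.flatMap Group.ops).Perm l) (g : Group N K V), g ∈ G →
      ∃ c ∈ l, c.2.item = g.item ∧ c.2.accessType = g.accessType := by
    intro G l hv hp g hg
    obtain ⟨c, hc⟩ := List.exists_mem_of_ne_nil _ (hv g hg).nonempty
    exact ⟨c, hp.mem_iff.mp (List.mem_flatMap.mpr ⟨g, hg, hc⟩), (hv g hg).item c hc,
      (hv g hg).type c hc⟩
  have hf₁ : ∀ g ∈ G₁, S.fitIdx g.item < m := fun g hg => by
    obtain ⟨c, hc, h1, -⟩ := key u2 u3 g hg
    rw [← h1]; exact (mE c hc).1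
  have hf₂ : ∀ g ∈ G₂, m ≤ S.fitIdx g.item := fun g hg => by
    obtain ⟨c, hc, h1, -⟩ := key v2 v3 g hg
    rw [← h1]; exact mR c hc
  set R : List (N × Option V) := I.map (fun c => (c.1, none)) with hR
  obtain ⟨r₁, hr₁⟩ : ∃ r₁, r₁ = execSlab (min m S.sections) 0 ⟨S, G₁, R⟩ := ⟨_, rfl⟩
  obtain ⟨r₂, hr₂⟩ : ∃ r₂, r₂ = execSlab (S.sections - m) m ⟨r₁.val.1.str, G₂, r₁.val.1.results⟩ :=
    ⟨_, rfl⟩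
  obtain ⟨r₃, hr₃⟩ : ∃ r₃, r₃ = r₂.val.1.str.rebalance m
    (fun k => decide (¬ (k < r₁.val.2 ∨ (m ≤ k ∧ k < r₂.val.2)))) := ⟨_, rfl⟩
  have hval : (runBatch S B Teff Tres).val = (r₃.val, r₂.val.1.results) := by
    subst hr₃ hr₂ hr₁; rfl
  have hlog : cost (runBatch S B Teff Tres).log = 2 * (B.length + 1) + cost (tagBatch S B).log +
      cost (sortBatch Teff).log + cost (sortBatch Tres).log + (cost r₁.log + cost r₂.log) +
      cost r₃.log := by
    have : (runBatch S B Teff Tres).log = Prim.linear B.length :: ((tagBatch S B).log ++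
        (Prim.linear B.length :: ((sortBatch Teff).log ++ ((sortBatch Tres).log ++
        (r₁.log ++ (r₂.log ++ (r₃.log ++ []))))))) := by
      subst hr₃ hr₂ hr₁; rfl
    rw [this]
    simp only [cost_cons, cost_append, cost_nil, Prim.bound]
    ring
  rw [hval, hlog]
  obtain ⟨Q, x1, x2, x3, x4, x5, x6, x8, x9, x10⟩ := execSlabs_spec hS R u2 v2 hf₁ hf₂
    le_rfl le_rfl r₁ r₂ hr₁ hr₂
  obtain ⟨y1, y2, y3⟩ := rebalance_after_exec hS x1 x2 x9 r₃ hr₃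
  have hQ : Q.Perm (eff ++ res) := x5.trans (u3.append v3)
  set A := S.items with hA
  set A₁ := A ∪ ((Q.filter (fun c => decide (c.2.accessType = 2))).map
    (fun c => c.2.item)).toFinset with hA₁
  have hAA₁ : A ⊆ A₁ := Finset.subset_union_left
  have hmem : ∀ y, y ∈ A₁ ↔ y ∈ A ∨ ∃ c ∈ Q, c.2.accessType = 2 ∧ c.2.item = y := by
    intro y
    simp [hA₁, and_assoc]
  have hsup := hasSupport_toMap S
  obtain ⟨L, l1, l2, l3, l4⟩ := exists_batch_order hsup
    (fun c hc => ⟨(mI c hc).2, fun h => (hsup _).mpr h (mI c hc).1⟩) x6 hmem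
  have hIne := seqResults_ineffectual (M := S.toMap) (I := I)
    (fun c hc => ⟨(mI c hc).2, (mI c hc).1⟩)
  refine ⟨y1, L, l1.trans ((hQ.append_left I).trans hfilter), ?_, ?_, ?_⟩
  · rw [x3, hR, ← hIne.1]
    rw [seqResults_append, hIne.2] at l2
    exact l2
  · rw [y2, x4, l3, applyCalls_append, hIne.2]
  have hX : (logSum A I : ℝ) + typedSum A A₁ Q ≤ fingerBound S.toMap (L.map Prod.snd) := by
    rw [typedSum_eq]; push_cast; linarith
  have hBX : logSum A B ≤ logSum A I + typedSum A A₁ Q := by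
    rw [← logSum_perm A hfilter, logSum_append, ← logSum_perm A hQ]
    exact Nat.add_le_add_left (logSum_le_typedSum hAA₁ Q) _
  have hWB : W ≤ logSum A B := List.sum_le_sum fun c _ => hS.two_pow_fitIdx_le c.2.item
  have hb := length_le_logSum A B
  have hb1 : 1 ≤ B.length := List.length_pos_of_ne_nil hB
  have hWs : (eff.map fun c => 2 ^ S.fitIdx c.2.item).sum +
      (res.map fun c => 2 ^ S.fitIdx c.2.item).sum ≤ W := by
    rw [hW, ← (hfilter.map _).sum_eq, List.map_append, List.map_append, List.sum_append,
      List.sum_append]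
    omega
  have hlens : eff.length + res.length ≤ B.length := by
    rw [← hfilter.length_eq, List.length_append, List.length_append]
    omega
  have hEQ : typedSum A A₁ eff ≤ typedSum A A₁ Q := by
    rw [typedSum_perm A A₁ hQ, typedSum_append]; omega
  -- The weights need items that belong to the measuring set. Effectual operations satisfy this:
  -- their items were found, or they are insertions.
  have c1 : (cost (sortBatch Teff).log : ℝ) ≤ 12 * typedSum A A₁ eff + 192 * eff.length := by
    refine cost_sortBatch_effectual repr_eff fun c hc => ?_
    unfold measureSet
    split_ifs with h
    · exact (hsup _).mp ((mE c hc).2.resolve_right (by omega))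
    · rcases (mE c hc).2 with h' | h'
      · exact hAA₁ ((hsup _).mp h')
      · exact (hmem _).mpr (Or.inr ⟨c, hQ.mem_iff.mpr (by simp [hc]), h', rfl⟩)
  have c2 : res.length * (Nat.log 2 res.length + 1) ≤
      (res.map fun c => 2 ^ S.fitIdx c.2.item).sum := by
    refine length_mul_log_le_sum fun c hc => ?_
    calc Nat.log 2 res.length + 1 ≤ Nat.log 2 B.length + 1 :=
          Nat.add_le_add_right (Nat.log_mono_right (by omega)) 1
      _ ≤ 2 ^ m := log_le_two_pow_slabSize hb1
      _ ≤ 2 ^ S.fitIdx c.2.item := Nat.pow_le_pow_right (by norm_num) (mR c hc)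
  have c3 := cost_sortBatch_le repr_res
  -- Effectual deletions are of distinct items that are present, so their finger distances pay for d
  -- log d. Residual deletions may be of absent items, and there the depth of the operations pays,
  -- as in `c2`.
  have c4 : typeCount 3 G₁ * (Nat.log 2 (typeCount 3 G₁) + 1) ≤ 4 * typedSum A A₁ Q := by
    refine (typeCount_mul_log_le (A := A₁) (Q := Q) u1 u2 (fun g hg h3 => ?_)
      fun g hg c hc => ?_).trans ?_
    · obtain ⟨c, hc, h1, h2⟩ := key u2 u3 g hg
      rw [← h1]
      exact hAA₁ ((hsup _).mp ((mE c hc).2.resolve_right (by omega)))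
    · refine hQ.mem_iff.mpr (List.mem_append_left _ (u3.mem_iff.mp ?_))
      exact List.mem_flatMap.mpr ⟨g, hg, hc⟩
    · rw [typedSum_eq]; omega
  have c5 := log_typeCount_le v2 3 v3
  have c6 := credit_sum_le S 0 G₁ u2
  have c7 := credit_sum_le S m G₂ v2
  rw [(u3.map _).sum_eq] at c6
  rw [(v3.map _).sum_eq] at c7
  set X := logSum A I + typedSum A A₁ Q with hXdef
  have d1 : cost (tagBatch S B).log ≤ 28 * X := by omega
  have d2 : (cost (sortBatch Teff).log : ℝ) ≤ 204 * X := by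
    have e1 : (typedSum A A₁ eff : ℝ) ≤ X := by
      exact_mod_cast hEQ.trans (Nat.le_add_left _ _)
    have e2 : (eff.length : ℝ) ≤ X := by
      exact_mod_cast (by omega : eff.length ≤ X)
    linarith
  have d3 : cost (sortBatch Tres).log ≤ 6 * X := by omega
  have d4 : (G₁.map (credit S 0)).sum + (G₂.map (credit S m)).sum ≤ 2 * X := by omega
  have d5 : typeCount 3 G₁ * (Nat.log 2 (typeCount 3 G₁) + 1) ≤ 4 * X := by omega
  have d6 : typeCount 3 G₂ * (Nat.log 2 (typeCount 3 G₂) + 1) ≤ X := by omega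
  have d7 : 2 * (B.length + 1) ≤ 4 * X := by omega
  have d8 : r₁.val.2 + (r₂.val.2 - m) ≤ 2 * X := by omega
  -- Input batches are nonempty, so X absorbs the constant costs of a batch.
  have d9 : 1 ≤ X := by omega
  have hX' : (X : ℝ) ≤ fingerBound S.toMap (L.map Prod.snd) := by
    rw [hXdef]; push_cast; exact hX
  have f1 : (cost (tagBatch S B).log : ℝ) ≤ 28 * X := by exact_mod_cast d1
  have f3 : (cost (sortBatch Tres).log : ℝ) ≤ 6 * X := by exact_mod_cast d3
  have f4 : (((G₁.map (credit S 0)).sum : ℕ) : ℝ) + ((G₂.map (credit S m)).sum : ℕ) ≤ 2 * X := by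
    exact_mod_cast d4
  have f5 : (typeCount 3 G₁ : ℝ) * ((Nat.log 2 (typeCount 3 G₁) + 1 : ℕ) : ℝ) ≤ 4 * X := by
    exact_mod_cast d5
  have f6 : (typeCount 3 G₂ : ℝ) * ((Nat.log 2 (typeCount 3 G₂) + 1 : ℕ) : ℝ) ≤ X := by
    exact_mod_cast d6
  have f7 : ((2 * (B.length + 1) : ℕ) : ℝ) ≤ 4 * X := by exact_mod_cast d7
  have f8 : ((r₁.val.2 + (r₂.val.2 - m) : ℕ) : ℝ) ≤ 2 * X := by exact_mod_cast d8
  have f9 : (1 : ℝ) ≤ X := by exact_mod_cast d9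
  rw [Nat.cast_add, Nat.cast_add, Nat.cast_add, Nat.cast_add, Nat.cast_add, Nat.cast_add]
  linarith

end

/-! ### Telescoping over the batches, and compatibility with the program DAG -/

section

variable {N : Type w} {K : Type u} {V : Type v} [LinearOrder K]

/-! ## Whole executions -/

namespace FS1

/-- The bound equals the initial potential, so the two cancel over a whole execution. -/
theorem Inv.le_pot {S : FS1 K V} {n : ℕ} (hS : S.Inv n) : 1200 ≤ S.pot := by
  have h1 := Chain.pot_nonneg S.front
  have h2 := Chain.pot_nonneg S.back
  have h3 : (2 : ℝ) ^ 1 ≤ 2 ^ max S.front.length S.back.length := by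
    refine pow_le_pow_right₀ (by norm_num) (le_max_of_le_left ?_)
    rw [hS.hasLength.front]; exact hS.pos
  unfold pot
  linarith

theorem Runs.exists_order {S : FS1 K V} {Bs : List (List (Call N K V))}
    {results : List (N × Option V)} {log : List Prim} (h : Runs S Bs results log) :
    ∀ n, S.Inv n → ∃ Ls : List (List (Call N K V)), List.Forall₂ List.Perm Ls Bs ∧
      (seqResults S.toMap Ls.flatten).Perm results ∧
      cost log + 1200 ≤ S.pot + 70000 * fingerBound S.toMap (Ls.flatten.map Prod.snd) := by
  induction h with
  | nil S =>
    intro n hS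
    refine ⟨[], List.Forall₂.nil, List.Perm.refl _, ?_⟩
    have := hS.le_pot
    simpa [fingerBound] using this
  | @cons S B Bs Teff Tres results log hne he hr _ ih =>
    intro n hS
    obtain ⟨⟨n', hS'⟩, L, h1, h2, h3, h4⟩ := runBatch_spec hS hne he hr
    obtain ⟨Ls, i1, i2, i3⟩ := ih n' hS'
    refine ⟨L :: Ls, List.Forall₂.cons h1 i1, ?_, ?_⟩
    · rw [List.flatten_cons, seqResults_append, h3]
      exact h2.append i2
    · rw [List.flatten_cons, fingerBound_append, h3, cost_append, Nat.cast_add]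
      linarith

theorem inv_empty : (empty : FS1 K V).Inv 1 := by
  refine ⟨le_rfl, fun i => by cases i <;> rfl, by simp [Sorted, entries, empty, Segment.SortedBy],
    fun i j hj => ?_⟩
  have h : (empty : FS1 K V).chain i = [[]] := by cases i <;> rfl
  rw [h] at hj ⊢
  obtain rfl : j = 0 := by simpa using hj
  refine ⟨?_, fun h => h.1 rfl⟩
  simp [Chain.Overfull, Chain.size]

theorem toMap_empty : (empty : FS1 K V).toMap = fun _ => none := rfl

omit [LinearOrder K] in
theorem pot_empty : (empty : FS1 K V).pot = 1200 := by
  have h : Chain.pot ([[]] : Chain K V) = 0 := by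
    simp [Chain.pot, FingerStructure.segPot, Chain.size]
  simp only [pot, empty, h, List.length_singleton, max_self]
  norm_num

end FS1

namespace ProgramDAG

variable (D : ProgramDAG N K V)

omit [LinearOrder K] in
theorem mem_calls {l : List N} {c : Call N K V} :
    c ∈ D.calls l ↔ c.1 ∈ l ∧ D.call c.1 = some c.2 := by
  unfold calls
  rw [List.mem_filterMap]
  constructor
  · rintro ⟨a, ha, h⟩
    obtain ⟨o, ho, rfl⟩ := Option.map_eq_some_iff.mp h
    exact ⟨ha, ho⟩
  · rintro ⟨h1, h2⟩
    exact ⟨c.1, h1, by rw [h2]; rfl⟩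

omit [LinearOrder K] in
theorem map_fst_calls {l : List N} (h : ∀ a ∈ l, (D.call a).isSome) :
    (D.calls l).map Prod.fst = l := by
  induction l with
  | nil => rfl
  | cons a l ih =>
    obtain ⟨o, ho⟩ := Option.isSome_iff_exists.mp (h a (by simp))
    have : D.calls (a :: l) = (a, o) :: D.calls l := by
      unfold calls; rw [List.filterMap_cons, ho]; rfl
    rw [this, List.map_cons, ih fun a ha => h a (by simp [ha])]

omit [LinearOrder K] in
theorem calls_map_fst {C : List (Call N K V)} (h : ∀ c ∈ C, D.call c.1 = some c.2) :
    D.calls (C.map Prod.fst) = C := by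
  induction C with
  | nil => rfl
  | cons c C ih =>
    have : D.calls (c.1 :: C.map Prod.fst) = c :: D.calls (C.map Prod.fst) := by
      unfold calls; rw [List.filterMap_cons, h c (by simp)]; rfl
    rw [List.map_cons, this, ih fun c hc => h c (by simp [hc])]

end ProgramDAG

namespace Execution

variable {D : ProgramDAG N K V}

/-- The absolute value is needed since κ is an arbitrary real number. -/
theorem totalWork_le {E : Execution D} {κ : ℝ} (h : E.WithinBounds κ) :
    E.totalWork ≤ |κ| * cost E.log := by
  unfold WithinBounds at h
  unfold totalWork
  generalize E.log = log at h
  generalize E.work = work at h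
  induction h with
  | nil => simp
  | @cons q t log work h1 _ ih =>
    have h2 : κ * (q.bound : ℝ) ≤ |κ| * q.bound :=
      mul_le_mul_of_nonneg_right (le_abs_self κ) (Nat.cast_nonneg _)
    rw [List.sum_cons, cost_cons, Nat.cast_add, mul_add]
    linarith

/-- Reordering the calls within each batch respects the program DAG. -/
theorem isLinearization_of_forall₂_perm (E : Execution D) {Ls : List (List (Call N K V))}
    (h : List.Forall₂ List.Perm Ls (E.batches.map D.calls))
    (hres : (seqResults (fun _ => none) Ls.flatten).Perm E.results) :
    D.IsLinearization E.results (Ls.flatten.map Prod.fst) ∧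
      D.calls (Ls.flatten.map Prod.fst) = Ls.flatten := by
  have hcall : ∀ b ∈ E.batches, ∀ a ∈ b, (D.call a).isSome := fun b hb a ha =>
    (E.mem_iff a).mp (List.mem_flatten.mpr ⟨b, hb, ha⟩)
  obtain ⟨hlen, hget⟩ := List.forall₂_iff_get.mp h
  have hnodes : List.Forall₂ List.Perm (Ls.map (List.map Prod.fst)) E.batches := by
    refine List.forall₂_iff_get.mpr ⟨by simpa using hlen, fun i h1 h2 => ?_⟩
    have h3 := (hget i (by simpa using h1) (by simpa using h2)).map Prod.fst
    simp only [List.get_eq_getElem, List.getElem_map] at h3 ⊢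
    rwa [D.map_fst_calls (hcall _ (List.getElem_mem _))] at h3
  have hflat : (Ls.flatten.map Prod.fst).Perm E.batches.flatten := by
    rw [List.map_flatten]
    exact List.Perm.flatten_congr hnodes
  have hcalls : D.calls (Ls.flatten.map Prod.fst) = Ls.flatten := by
    refine D.calls_map_fst fun c hc => ?_
    have h1 := (List.Perm.flatten_congr h).mem_iff.mp hc
    obtain ⟨l, hl, hcl⟩ := List.mem_flatten.mp h1
    obtain ⟨b, -, rfl⟩ := List.mem_map.mp hl
    exact (D.mem_calls.mp hcl).2
  obtain ⟨hlen', hget'⟩ := List.forall₂_iff_get.mp hnodes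
  refine ⟨⟨hflat.nodup_iff.mpr E.nodup, fun a => hflat.mem_iff.trans (E.mem_iff a), ?_,
    by rw [hcalls]; exact hres⟩, hcalls⟩
  rw [List.map_flatten, List.pairwise_flatten]
  constructor
  · intro l hl
    obtain ⟨i, hi, rfl⟩ := List.getElem_of_mem hl
    have hp := hget' i hi (hlen' ▸ hi)
    -- A dependency inside one batch would give i < i by `ordered`, so the order within a batch is
    -- free.
    refine List.Pairwise.imp_of_mem (R := fun _ _ => True) (fun {a b} ha hb _ hba => ?_)
      (List.pairwise_of_forall fun _ _ => trivial)
    exact absurd (E.ordered i i (hlen' ▸ hi) (hlen' ▸ hi) b a (hp.mem_iff.mp hb)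
      (hp.mem_iff.mp ha) hba) (lt_irrefl i)
  · rw [List.pairwise_iff_getElem]
    intro i j hi hj hij a ha b hb hba
    have hp := hget' i hi (hlen' ▸ hi)
    have hp' := hget' j hj (hlen' ▸ hj)
    exact absurd (E.ordered j i (hlen' ▸ hj) (hlen' ▸ hi) b a (hp'.mem_iff.mp hb)
      (hp.mem_iff.mp ha) hba) hij.not_gt

end Execution

end

end FingerStructure
theorem mainTheorem3 (κ : ℝ) :
    ∃ C : ℝ, 0 < C ∧
      ∀ (N : Type*) (K : Type*) (V : Type*) [LinearOrder K]
        (D : FingerStructure.ProgramDAG N K V) (E : FingerStructure.Execution D),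
        E.WithinBounds κ →
        ∃ L : List N, D.IsLinearization E.results L ∧
          E.totalWork ≤ C * FingerStructure.fingerBound (fun _ => none) (D.accesses L) := by
  -- The summand 1 only makes the constant positive when κ = 0.
  refine ⟨|κ| * 70000 + 1, by positivity, fun N K V _ D E hE => ?_⟩
  obtain ⟨Ls, h1, h2, h3⟩ := E.runs.exists_order 1 FingerStructure.FS1.inv_empty
  rw [FingerStructure.FS1.toMap_empty] at h2 h3
  rw [FingerStructure.FS1.pot_empty] at h3
  obtain ⟨h4, h5⟩ := E.isLinearization_of_forall₂_perm h1 h2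
  refine ⟨_, h4, ?_⟩
  unfold FingerStructure.ProgramDAG.accesses
  rw [h5]
  have h6 := FingerStructure.fingerBound_nonneg (fun _ => none) (Ls.flatten.map Prod.snd)
  have h7 := FingerStructure.Execution.totalWork_le hE
  have h8 := mul_le_mul_of_nonneg_left (by linarith : (FingerStructure.cost E.log : ℝ) ≤
    70000 * FingerStructure.fingerBound (fun _ => none) (Ls.flatten.map Prod.snd)) (abs_nonneg κ)
  linarith
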